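/- Let $\mathbb{C}_{\omega_1}$ (the $\omega_1$-Chang model) be the least inner model of ZF containing all $\omega_1$-sequences of ordinals: $\mathbb{C}_{\omega_1}=\bigcup_{\alpha}C_\alpha$, where $C_0=\emptyset$, $C_{\alpha+1}=\mathrm{Def}(C_\alpha)$ is the set of subsets of $C_\alpha$ first-order definable over $(C_\alpha,\in)$ with parameters, and $C_\alpha=\{y\subseteq\alpha : |y|\le\aleph_1\}\cup\bigcup_{\alpha'<\alpha}C_{\alpha'}$ for limit $\alpha$. An extender model is a class $L[\mathcal E]$, where $\mathcal E=\langle\mathcal E_\gamma\mid\gamma\in\mathrm{Ord}\rangle$ is a coherent sequence of (possibly partial) extenders: whenever $\mathcal E_\gamma\neq\emptyset$, $\gamma$ is a limit ordinal, $\mathcal E_\gamma$ is a $(\kappa,\lambda)$-extender over $L_\gamma[\mathcal E{\restriction}\gamma]$ for some $\kappa<\lambda\le\gamma$, its ultrapower $j:L_\gamma[\mathcal E{\restriction}\gamma]\to N$ is well-founded, and $\bigcup_{\beta<\gamma}j(\mathcal E{\restriction}\beta)$ agrees with $\mathcal E$ below $\gamma$ and is empty at $\gamma$. An iterated ultrapower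 $i:V\to M$ is a linear iteration $\langle M_\nu, i_{\mu\nu}\mid \mu\le\nu\le\theta\rangle$ of some length $\theta\le\mathrm{Ord}$, with all $M_\nu$ transitive classes, $M_0=V$, $M_{\nu+1}=\mathrm{Ult}(M_\nu,E_\nu)$ for some $E_\nu\in M_\nu$ that is an extender in $M_\nu$, direct limits at limit stages, $M=M_\theta$ and $i=i_{0\theta}$. **Proposition.** Suppose that $V=L[\mathcal E]$ is an extender model, and that there is an iterated ultrapower $i:V\to M$ where $M\subseteq\mathbb{C}_{\omega_1}$ is definable, by a first-order formula without parameters, over $(\mathbb{C}_{\omega_1},\in)$. Then there is no strong cardinal in $V$; that is, there is no $\kappa$ such that for every ordinal $\delta$ there are a transitive class $N$ with $V_\delta\subseteq N$ and an elementary embedding $j:V\to N$ with critical point $\kappa$ and $j(\kappa)>\delta$. -/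

import Mathlib

universe u

noncomputable section

namespace InnerModels

open FirstOrder FirstOrder.Language ZFSet
open scoped Ordinal Cardinal

/-! ### The language of set theory, without and with a class predicate -/

/-- The only relation symbol of the language of set theory. -/
inductive MemRel : ℕ → Type
  | mem : MemRel 2

/-- The language `{∈}` of set theory. -/
def memLang : FirstOrder.Language.{0, 0} := ⟨fun _ => Empty, MemRel⟩

/-- The universe of sets as an `∈`-structure. -/
instance univStructure : memLang.Structure ZFSet.{u} where
  funMap := fun f => f.elim
  RelMap | .mem => fun v => v 0 ∈ v 1

/-- A class of sets as an `∈`-structure. -/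
instance classStructure (A : Set ZFSet.{u}) : memLang.Structure A where
  funMap := fun f => f.elim
  RelMap | .mem => fun v => (v 0 : ZFSet.{u}) ∈ (v 1 : ZFSet.{u})

/-- Relation symbols: membership and a unary predicate. -/
inductive MemPredRel : ℕ → Type
  | mem : MemPredRel 2
  | pred : MemPredRel 1

/-- The language of set theory with an additional unary predicate. -/
def memPredLang : FirstOrder.Language.{0, 0} := ⟨fun _ => Empty, MemPredRel⟩

/-- The structure `(D, ∈, A ∩ D)`. -/
@[reducible]
def predStructure (A D : Set ZFSet.{u}) : memPredLang.Structure D where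
  funMap := fun f => f.elim
  RelMap
    | .mem => fun v => (v 0 : ZFSet.{u}) ∈ (v 1 : ZFSet.{u})
    | .pred => fun v => (v 0 : ZFSet.{u}) ∈ A

/-- A transitive class. -/
def IsTransClass (A : Set ZFSet.{u}) : Prop := ∀ x ∈ A, ∀ y ∈ x, y ∈ A

/-- `Def(D)`: the set of subsets of `D` that are first-order definable over `(D, ∈)` from
parameters in `D`. -/
def defPow (D : ZFSet.{u}) : ZFSet.{u} :=
  (powerset D).sep fun y =>
    (Set.univ : Set (D : Set ZFSet.{u})).Definable₁ memLang {x | (x : ZFSet.{u}) ∈ y}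

/-- `Def_A(D)`: the set of subsets of `D` that are first-order definable over `(D, ∈, A ∩ D)`
from parameters in `D`. -/
def defPowRel (A : Set ZFSet.{u}) (D : ZFSet.{u}) : ZFSet.{u} :=
  (powerset D).sep fun y =>
    letI := predStructure A (D : Set ZFSet.{u})
    (Set.univ : Set (D : Set ZFSet.{u})).Definable₁ memPredLang {x | (x : ZFSet.{u}) ∈ y}

/-! ### The `ω₁`-Chang model -/

open Classical in
/-- The hierarchy of the `ω₁`-Chang model: it is built like the constructible hierarchy, except
that at every limit stage `α` all subsets of `α` of cardinality at most `ℵ₁` are added. -/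
def omegaOneChangStage (α : Ordinal.{u}) : ZFSet.{u} :=
  (⋃ β : Set.Iio α, defPow (omegaOneChangStage β)) ∪
    (if Order.IsSuccLimit α then (powerset α.toZFSet).sep fun y => y.card ≤ ℵ₁ else ∅)
termination_by α
decreasing_by exact β.2

/-- The `ω₁`-Chang model, the least inner model of ZF that contains all `ω₁`-sequences of
ordinals. -/
def omegaOneChang : Set ZFSet.{u} := {x | ∃ α : Ordinal.{u}, x ∈ omegaOneChangStage α}

/-- `M` is a definable submodel of the `ω₁`-Chang model: a subclass which is definable, without
parameters, over the `∈`-structure `omegaOneChang`. -/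
def IsDefinableSubmodel (M : Set ZFSet.{u}) : Prop :=
  M ⊆ omegaOneChang ∧
    (∅ : Set (omegaOneChang : Set ZFSet.{u})).Definable₁ memLang {x | (x : ZFSet.{u}) ∈ M}

/-! ### Strong cardinals -/

/-- `κ` is a strong cardinal: for every ordinal `δ` there is an elementary embedding `j` of the
universe into a transitive class `N` with critical point `κ`, `j κ > δ` and `V_δ ⊆ N`. -/
def IsStrong (κ : Ordinal.{u}) : Prop :=
  ∀ δ : Ordinal.{u}, ∃ (N : Set ZFSet.{u}) (j : ZFSet.{u} ↪ₑ[memLang] N),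
    IsTransClass N ∧
    (∀ α < κ, (j α.toZFSet : ZFSet.{u}) = α.toZFSet) ∧
    κ.toZFSet ∈ (j κ.toZFSet : ZFSet.{u}) ∧
    δ.toZFSet ∈ (j κ.toZFSet : ZFSet.{u}) ∧
    ∀ x ∈ V_ δ, x ∈ N

/-! ### Extenders and their ultrapowers -/

/-- A finite set of ordinals, as a set in the universe. -/
def code (a : Finset Ordinal.{u}) : ZFSet.{u} := ZFSet.range fun o : a => (o : Ordinal.{u}).toZFSet

/-- `[κ]^n`, the set of `n`-element subsets of `κ`. -/
def brk (κ : Ordinal.{u}) (n : ℕ) : ZFSet.{u} :=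
  (powerset κ.toZFSet).sep fun x => ∃ s : Finset Ordinal.{u}, s.card = n ∧ x = code s

/-- `{s ∈ [κ]^n | P s}`. -/
def brkSep (κ : Ordinal.{u}) (n : ℕ) (P : Finset Ordinal.{u} → Prop) : ZFSet.{u} :=
  (brk κ n).sep fun x => ∃ s : Finset Ordinal.{u}, x = code s ∧ P s

open Classical in
/-- For finite sets of ordinals `a ⊆ b` and `s` with `|s| = |b|`, the subset of `s` that sits in
`s` as `a` sits in `b`: the image of `a` under the order isomorphism of `b` and `s`. -/
def proj (a b s : Finset Ordinal.{u}) : Finset Ordinal.{u} :=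
  s.filter fun η => ∃ ξ ∈ a, (b.filter (· < ξ)).card = (s.filter (· < η)).card

/-- `f` is a function with domain `d`. -/
def IsFunOn (f d : ZFSet.{u}) : Prop := ∃ r, IsFunc d r f

/-- The value `f(x)` of a function `f` at a point `x` of its domain. -/
def app (f x : ZFSet.{u}) : ZFSet.{u} :=
  ⋃₀ ((⋃₀ (⋃₀ f : ZFSet.{u}) : ZFSet.{u}).sep fun y => pair x y ∈ f)

/-- `X ∈ E_a`, where the system `E = ⟨E_a⟩` is represented by the set of all pairs `(a, X)` with
`X ∈ E_a`. -/
def Meas (E : ZFSet.{u}) (a : Finset Ordinal.{u}) (X : ZFSet.{u}) : Prop := pair (code a) X ∈ E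

/-- All elements of `a` are below `l`. -/
def Below (a : Finset Ordinal.{u}) (l : Ordinal.{u}) : Prop := ∀ ξ ∈ a, ξ < l

/-- `E` is a `(κ, l)`-extender over the transitive class (or set) `M`; sets, sequences and
functions range over members of `M`. Well-foundedness of the ultrapower is not part of this
definition; it is contained in `IsUltrapower`. -/
structure IsExtender (M : Set ZFSet.{u}) (E : ZFSet.{u}) (κ l : Ordinal.{u}) : Prop where
  omega_lt : ω < κ
  lt_length : κ < l
  /-- `E` consists of pairs `(a, X)` with `a ∈ [l]^{<ω}`, `X ⊆ [κ]^{|a|}` and `X ∈ M`. -/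
  dom : ∀ p ∈ E, ∃ (a : Finset Ordinal.{u}) (X : ZFSet.{u}),
    p = pair (code a) X ∧ Below a l ∧ X ∈ M ∧ X ⊆ brk κ a.card
  /-- Each `E_a` is an ultrafilter on the subsets of `[κ]^{|a|}` in `M`. -/
  whole : ∀ a, Below a l → Meas E a (brk κ a.card)
  notEmpty : ∀ a, ¬ Meas E a ∅
  upward : ∀ a, ∀ X Y : ZFSet.{u}, Meas E a X → X ⊆ Y → Y ⊆ brk κ a.card → Y ∈ M → Meas E a Y
  ultra : ∀ a, Below a l → ∀ X ∈ M, X ⊆ brk κ a.card → Meas E a X ∨ Meas E a (brk κ a.card \ X)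
  /-- Each `E_a` is `κ`-complete for sequences in `M`. -/
  complete : ∀ a, Below a l → ∀ η < κ, ∀ g ∈ M, IsFunOn g η.toZFSet →
    (∀ ξ < η, Meas E a (app g ξ.toZFSet)) →
    Meas E a ((brk κ a.card).sep fun x => ∀ ξ < η, x ∈ app g ξ.toZFSet)
  /-- Some `E_a` is not `κ⁺`-complete. -/
  notComplete : ∃ a, Below a l ∧ ∃ g ∈ M, IsFunOn g κ.toZFSet ∧
    (∀ ξ < κ, Meas E a (app g ξ.toZFSet)) ∧
    ¬ Meas E a ((brk κ a.card).sep fun x => ∀ ξ < κ, x ∈ app g ξ.toZFSet)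
  /-- For every `α < κ` some `E_a` concentrates on the sets that contain `α`. -/
  contains : ∀ α < κ, ∃ a, Below a l ∧ Meas E a (brkSep κ a.card fun s => α ∈ s)
  /-- Coherence of the measures. -/
  coherent : ∀ a b, a ⊆ b → Below b l → ∀ X ∈ M, X ⊆ brk κ a.card →
    (Meas E a X ↔ Meas E b (brkSep κ b.card fun s => code (proj a b s) ∈ X))
  /-- Normality: a function that is `< max s` almost everywhere is represented by an ordinal
  below the length. -/
  normal : ∀ a, Below a l → ∀ f ∈ M, IsFunOn f (brk κ a.card) →
    Meas E a (brkSep κ a.card fun s => ∃ η ∈ s, app f (code s) ∈ η.toZFSet) →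
    ∃ b, a ⊆ b ∧ Below b l ∧
      Meas E b (brkSep κ b.card fun t => app f (code (proj a b t)) ∈ code t)

/-- `N` is (the transitive collapse of) the ultrapower `Ult(M, E)` of the transitive class (or
set) `M` by the `(κ, l)`-extender `E`, formed with the functions in `M`, and `j : M → N` is the
ultrapower embedding. The collapse is the map `(a, f) ↦ [a, f]`, given by `cls`. -/
def IsUltrapower (M : Set ZFSet.{u}) (E : ZFSet.{u}) (κ l : Ordinal.{u})
    (N : Set ZFSet.{u}) (j : ZFSet.{u} → ZFSet.{u}) : Prop :=
  IsTransClass N ∧ ∃ cls : Finset Ordinal.{u} → ZFSet.{u} → ZFSet.{u},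
    (∀ y, y ∈ N ↔
      ∃ a f, Below a l ∧ f ∈ M ∧ IsFunOn f (brk κ a.card) ∧ cls a f = y) ∧
    (∀ a f b g, Below a l → f ∈ M → IsFunOn f (brk κ a.card) →
      Below b l → g ∈ M → IsFunOn g (brk κ b.card) →
      (cls a f ∈ cls b g ↔ Meas E (a ∪ b) (brkSep κ (a ∪ b).card fun s =>
        app f (code (proj a (a ∪ b) s)) ∈ app g (code (proj b (a ∪ b) s)))) ∧
      (cls a f = cls b g ↔ Meas E (a ∪ b) (brkSep κ (a ∪ b).card fun s =>
        app f (code (proj a (a ∪ b) s)) = app g (code (proj b (a ∪ b) s))))) ∧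
    ∀ x ∈ M, j x = cls ∅ {pair ∅ x}

/-! ### Iterated ultrapowers -/

/-- `M ν`, `i μ ν : M μ → M ν` (`μ ≤ ν ≤ θ`) is a linear iterated ultrapower of the universe of
length `θ`, where `θ` is an ordinal or `⊤`, the class of all ordinals. At each `ν < θ` one takes
the ultrapower of `M ν` by a set `E ν ∈ M ν` which is an extender in `M ν`; at limits one takes
direct limits. All the models are transitive classes. -/
structure IsIteration (θ : WithTop Ordinal.{u}) (M : WithTop Ordinal.{u} → Set ZFSet.{u})
    (i : WithTop Ordinal.{u} → WithTop Ordinal.{u} → ZFSet.{u} → ZFSet.{u})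
    (E : Ordinal.{u} → ZFSet.{u}) (κ l : Ordinal.{u} → Ordinal.{u}) : Prop where
  zero : M 0 = Set.univ
  trans : ∀ ν ≤ θ, IsTransClass (M ν)
  /-- The maps `i μ ν` form a commuting system of `∈`-embeddings. -/
  mapsTo : ∀ μ ν, μ ≤ ν → ν ≤ θ → ∀ x ∈ M μ, i μ ν x ∈ M ν
  mem_iff : ∀ μ ν, μ ≤ ν → ν ≤ θ → ∀ x ∈ M μ, ∀ y ∈ M μ, (i μ ν x ∈ i μ ν y ↔ x ∈ y)
  id : ∀ ν ≤ θ, ∀ x ∈ M ν, i ν ν x = x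
  comp : ∀ lo μ ν, lo ≤ μ → μ ≤ ν → ν ≤ θ → ∀ x ∈ M lo, i μ ν (i lo μ x) = i lo ν x
  /-- Successor steps are internal extender ultrapowers. -/
  succ : ∀ ν : Ordinal.{u}, (ν : WithTop Ordinal.{u}) < θ →
    E ν ∈ M ν ∧ IsExtender (M ν) (E ν) (κ ν) (l ν) ∧
    IsUltrapower (M ν) (E ν) (κ ν) (l ν) (M ((ν + 1 : Ordinal.{u}) : WithTop Ordinal.{u}))
      (i ν ((ν + 1 : Ordinal.{u}) : WithTop Ordinal.{u}))
  /-- Limit steps are direct limits. -/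
  limit : ∀ ν ≤ θ, Order.IsSuccLimit ν → ∀ y ∈ M ν, ∃ μ < ν, ∃ x ∈ M μ, i μ ν x = y

/-- `i : V → M` is an iterated ultrapower of the universe. -/
def IsIteratedUltrapower (M : Set ZFSet.{u}) (i : ZFSet.{u} → ZFSet.{u}) : Prop :=
  ∃ θ Ms is E κ l, IsIteration θ Ms is E κ l ∧ Ms θ = M ∧ is 0 θ = i

/-! ### Extender models -/

/-- The stage `L_α[A]` of the hierarchy constructible relative to the class `A`. -/
def relStage (A : Set ZFSet.{u}) (α : Ordinal.{u}) : ZFSet.{u} :=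
  ⋃ β : Set.Iio α, defPowRel A (relStage A β)
termination_by α
decreasing_by exact β.2

/-- A sequence `⟨𝓔_β⟩` of sets as the class of all pairs `(β, e)` with `e ∈ 𝓔_β`. -/
def seqClass (𝓔 : Ordinal.{u} → ZFSet.{u}) : Set ZFSet.{u} :=
  {x | ∃ β : Ordinal.{u}, ∃ e ∈ 𝓔 β, x = pair β.toZFSet e}

/-- The restriction `𝓔 ↾ γ`, as the set of all pairs `(β, e)` with `β < γ` and `e ∈ 𝓔_β`. -/
def seqRestrict (𝓔 : Ordinal.{u} → ZFSet.{u}) (γ : Ordinal.{u}) : ZFSet.{u} :=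
  ⋃ β : Set.Iio γ, ZFSet.prod {(β : Ordinal.{u}).toZFSet} (𝓔 β)

/-- The set `L_γ[𝓔 ↾ γ]`, as a class. -/
def initialModel (𝓔 : Ordinal.{u} → ZFSet.{u}) (γ : Ordinal.{u}) : Set ZFSet.{u} :=
  (relStage (seqRestrict 𝓔 γ : Set ZFSet.{u}) γ : Set ZFSet.{u})

/-- `𝓔` is a coherent sequence of (possibly partial) extenders; `𝓔_γ = ∅` means that there is no
extender at `γ`. If there is one, then `γ` is a limit ordinal, `𝓔_γ` is an extender of length at
most `γ` over `L_γ[𝓔 ↾ γ]`, with well-founded ultrapower `j : L_γ[𝓔 ↾ γ] → N`, and coherence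
holds: `j(𝓔 ↾ γ)` agrees with `𝓔` below `γ` and has no extender at `γ`. Here `j(𝓔 ↾ γ)` is the
union of the `j(𝓔 ↾ β)` for `β < γ`. -/
def IsExtenderSequence (𝓔 : Ordinal.{u} → ZFSet.{u}) : Prop :=
  ∀ γ, 𝓔 γ ≠ ∅ → Order.IsSuccLimit γ ∧
    ∃ (κ l : Ordinal.{u}) (N : Set ZFSet.{u}) (j : ZFSet.{u} → ZFSet.{u}), l ≤ γ ∧
      IsExtender (initialModel 𝓔 γ) (𝓔 γ) κ l ∧
      IsUltrapower (initialModel 𝓔 γ) (𝓔 γ) κ l N j ∧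
      ∀ α ≤ γ, ∀ e, (∃ β < γ, pair α.toZFSet e ∈ j (seqRestrict 𝓔 β)) ↔ (α < γ ∧ e ∈ 𝓔 α)

/-- The class `L[𝓔]`. -/
def relConstructible (𝓔 : Ordinal.{u} → ZFSet.{u}) : Set ZFSet.{u} :=
  {x | ∃ α : Ordinal.{u}, x ∈ relStage (seqClass 𝓔) α}

end InnerModels

end

/-! The argument compares the ordinals definable over the Chang model with a cardinal carrying
arbitrarily long extenders. From a strong `κ₀`, each ordinal `D` yields a system of ultrafilters on
the functions from `reals` to `κ₀`, indexed by functions `a` from `reals` to `D`: a set `X` has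
measure one at `a` when `a ∈ j X` (`IsStrong.hasUltraSystems`). The existence of such systems is a
first-order property of sets, so the least ordinal `κ` with it is definable in the universe without
parameters.

The heart is `HasUltraSystems.lt_of_definable`: an ordinal `μ` definable over the Chang model is
below `κ`. Take the ultrapower by a system of length `μ + 1`. An index is a whole family of ordinals
indexed by reals, and `ℵ₁ ≤ 2^ℵ₀`; hence the ultrapower is well-founded, absorbs subsets of size
`ℵ₁`, and computes the Chang hierarchy correctly (`collapse_omegaOneChangStage`). Choose a fixed
point `η` of cofinality `ω` at which the Chang model reflects. Łoś's theorem for the union of the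
stages below `η` shows that the image of `μ` satisfies the definition of `μ`, so `μ` is fixed
(`ordinalMap_eq_of_definable`). The length of the system puts `μ` below the image of `κ`
(`lt_ordinalMap`), so `κ ≤ μ` is impossible.

Finally, the iteration map `i` is elementary, by Łoś's theorem for internal extender ultrapowers
(`IsCollapse.sat_cls`) and by direct limits. Therefore `i κ` is definable in `M`, hence over the
Chang model, and so `i κ < κ`. But `i` is strictly increasing on ordinals, which gives `κ ≤ i κ`. -/

namespace InnerModels

open FirstOrder FirstOrder.Language ZFSet
open scoped Ordinal Cardinal

/-! ### Formulas of set theory with de Bruijn variables -/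

/-- Formulas of the language of set theory; the variables are de Bruijn indices. -/
inductive SetFormula : Type
  | mem (i j : ℕ)
  | eq (i j : ℕ)
  | fls
  | imp (φ ψ : SetFormula)
  | all (φ : SetFormula)

/-- Prepend a value to a valuation. -/
def vcons {α : Type*} (x : α) (v : ℕ → α) : ℕ → α
  | 0 => x
  | n + 1 => v n

@[simp] lemma vcons_zero {α : Type*} (x : α) (v : ℕ → α) : vcons x v 0 = x := rfl

@[simp] lemma vcons_succ {α : Type*} (x : α) (v : ℕ → α) (n : ℕ) : vcons x v (n + 1) = v n := rfl

lemma comp_vcons {α β : Type*} (f : α → β) (x : α) (v : ℕ → α) :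
    (fun n => f (vcons x v n)) = vcons (f x) fun n => f (v n) := by
  funext n; cases n <;> rfl

lemma vcons_mem {α : Type*} {A : Set α} {x : α} {v : ℕ → α} (hx : x ∈ A) (hv : ∀ n, v n ∈ A) :
    ∀ n, vcons x v n ∈ A
  | 0 => hx
  | n + 1 => hv n

namespace SetFormula

/-- Satisfaction in `(A, ∈)`, with quantifiers bounded by `A`. -/
def Sat (A : Set ZFSet.{u}) : SetFormula → (ℕ → ZFSet.{u}) → Prop
  | mem i j, v => v i ∈ v j
  | eq i j, v => v i = v j
  | fls, _ => False
  | imp φ ψ, v => Sat A φ v → Sat A ψ v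
  | all φ, v => ∀ x ∈ A, Sat A φ (vcons x v)

/-- Lift a renaming of variables below a quantifier. -/
def liftRen (ρ : ℕ → ℕ) : ℕ → ℕ
  | 0 => 0
  | n + 1 => ρ n + 1

/-- Rename the free variables. -/
def rename : (ℕ → ℕ) → SetFormula → SetFormula
  | ρ, mem i j => mem (ρ i) (ρ j)
  | ρ, eq i j => eq (ρ i) (ρ j)
  | _, fls => fls
  | ρ, imp φ ψ => imp (rename ρ φ) (rename ρ ψ)
  | ρ, all φ => all (rename (liftRen ρ) φ)

lemma sat_rename (A : Set ZFSet.{u}) (φ : SetFormula) (ρ : ℕ → ℕ) (v : ℕ → ZFSet.{u}) :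
    Sat A (rename ρ φ) v ↔ Sat A φ fun n => v (ρ n) := by
  induction φ generalizing ρ v with
  | mem i j => rfl
  | eq i j => rfl
  | fls => rfl
  | imp φ ψ h1 h2 => simp only [rename, Sat, h1, h2]
  | all φ h =>
    simp only [rename, Sat, h]
    refine forall₂_congr fun x _ => ?_
    have : (fun n => vcons x v (liftRen ρ n)) = vcons x fun n => v (ρ n) := by
      funext n; cases n <;> rfl
    rw [this]

/-- A bound for the free variables. -/
def bound : SetFormula → ℕ
  | mem i j => max i j + 1
  | eq i j => max i j + 1
  | fls => 0
  | imp φ ψ => max φ.bound ψ.bound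
  | all φ => φ.bound - 1

lemma sat_congr (A : Set ZFSet.{u}) (φ : SetFormula) (v w : ℕ → ZFSet.{u})
    (h : ∀ n < φ.bound, v n = w n) : Sat A φ v ↔ Sat A φ w := by
  induction φ generalizing v w with
  | mem i j => simp only [Sat]; rw [h i (by simp [bound]), h j (by simp [bound])]
  | eq i j => simp only [Sat]; rw [h i (by simp [bound]), h j (by simp [bound])]
  | fls => rfl
  | imp φ ψ h1 h2 =>
    simp only [Sat]
    rw [h1 v w fun n hn => h n (by simp [bound]; omega),
      h2 v w fun n hn => h n (by simp [bound]; omega)]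
  | all φ ih =>
    simp only [Sat]
    refine forall₂_congr fun x _ => ih _ _ fun n hn => ?_
    cases n with
    | zero => rfl
    | succ n => exact h n (by simp [bound]; omega)

/-- `n` universal quantifiers. -/
def alls : ℕ → SetFormula → SetFormula
  | 0, φ => φ
  | n + 1, φ => all (alls n φ)

lemma sat_alls_of_forall {A : Set ZFSet.{u}} {φ : SetFormula}
    (h : ∀ v : ℕ → ZFSet.{u}, (∀ n, v n ∈ A) → Sat A φ v) (n : ℕ) (v : ℕ → ZFSet.{u})
    (hv : ∀ n, v n ∈ A) : Sat A (alls n φ) v := by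
  induction n generalizing v with
  | zero => exact h v hv
  | succ n ih => exact fun x hx => ih _ (vcons_mem hx hv)

/-- The outermost of `n + 1` quantifiers binds the variable `n`; hence `w` is read below the number
of quantifiers and `v` is shifted above it. -/
lemma sat_of_sat_alls {A : Set ZFSet.{u}} {φ : SetFormula} {n : ℕ} {v : ℕ → ZFSet.{u}}
    (h : Sat A (alls n φ) v) (w : ℕ → ZFSet.{u}) (hw : ∀ k, w k ∈ A) :
    Sat A φ fun k => if k < n then w k else v (k - n) := by
  induction n generalizing v with
  | zero => simpa [alls] using h
  | succ n ih =>
    convert ih (h (w n) (hw n)) using 2 with k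
    split_ifs with h1 h2 h2
    · rfl
    · obtain rfl : k = n := by omega
      simp
    · omega
    · obtain ⟨m, rfl⟩ : ∃ m, k = n + 1 + m := ⟨k - (n + 1), by omega⟩
      rw [show n + 1 + m - (n + 1) = m by omega, show n + 1 + m - n = m + 1 by omega, vcons_succ]

/-- Countability of the set of formulas. -/
instance : Countable SetFormula := by
  let f : SetFormula → List ℕ := fun φ => SetFormula.rec (fun i j => [0, i, j])
    (fun i j => [1, i, j]) [2] (fun _ _ a b => 3 :: (a ++ b)) (fun _ a => 4 :: a) φ
  -- The code is Polish notation. Carrying arbitrary tails lets the induction split the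
  -- concatenation in the case of an implication.
  have key : ∀ φ ψ : SetFormula, ∀ l l' : List ℕ, f φ ++ l = f ψ ++ l' → φ = ψ ∧ l = l' := by
    intro φ
    induction φ with
    | mem i j => intro ψ l l' h; cases ψ <;> simp_all [f]
    | eq i j => intro ψ l l' h; cases ψ <;> simp_all [f]
    | fls => intro ψ l l' h; cases ψ <;> simp_all [f]
    | imp a b ha hb =>
      intro ψ l l' h
      cases ψ with
      | imp c d =>
        have h' : f a ++ (f b ++ l) = f c ++ (f d ++ l') := by simpa [f] using h
        obtain ⟨rfl, h2⟩ := ha _ _ _ h'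
        obtain ⟨rfl, h3⟩ := hb _ _ _ h2
        exact ⟨rfl, h3⟩
      | _ => simp [f] at h
    | all a ha =>
      intro ψ l l' h
      cases ψ with
      | all c =>
        have h' : f a ++ l = f c ++ l' := by simpa [f] using h
        obtain ⟨rfl, h2⟩ := ha _ _ _ h'
        exact ⟨rfl, h2⟩
      | _ => simp [f] at h
  exact Function.Injective.countable (f := f) fun φ ψ h => (key φ ψ [] [] (by simp [h])).1

/-! ### Comparison with the formulas of Mathlib -/

/-- The Mathlib formula that corresponds to a formula. -/
noncomputable def toFormula : SetFormula → memLang.Formula ℕ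
  | mem i j => Relations.formula₂ (L := memLang) MemRel.mem (Term.var i) (Term.var j)
  | eq i j => Term.equal (Term.var i) (Term.var j)
  | fls => ⊥
  | imp φ ψ => φ.toFormula.imp ψ.toFormula
  | all φ => Formula.iAlls Unit (φ.toFormula.relabel fun
      | 0 => Sum.inr ()
      | n + 1 => Sum.inl n)

variable {X : Type*} [memLang.Structure X]

/-- The carrier is an arbitrary type placed into the universe by `c`, so that one statement covers
both the universe and the subtype of a class. -/
lemma realize_toFormula {A : Set ZFSet.{u}} {c : X → ZFSet.{u}} (hc : c.Injective)
    (hA : Set.range c = A) (hm : ∀ v : Fin 2 → X, Structure.RelMap (L := memLang) (n := 2) MemRel.mem v ↔ c (v 0) ∈ c (v 1))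
    (φ : SetFormula) (v : ℕ → X) : φ.toFormula.Realize v ↔ Sat A φ fun n => c (v n) := by
  induction φ generalizing v with
  | mem i j => exact (Formula.realize_rel₂ (L := memLang)).trans (hm _)
  | eq i j => simp [toFormula, Sat, Formula.realize_equal, hc.eq_iff]
  | fls => simp [toFormula, Sat]
  | imp φ ψ h1 h2 => simp [toFormula, Sat, h1, h2]
  | all φ h =>
    simp only [toFormula, Sat, Formula.realize_iAlls, Formula.realize_relabel, h]
    subst hA
    simp only [Set.forall_mem_range]
    constructor
    · intro H x
      convert H (fun _ => x) using 2 with n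
      cases n <;> rfl
    · intro H x
      convert H (x ()) using 2 with n
      cases n <;> rfl

/-- The formula that corresponds to a Mathlib formula, for a given naming of its variables. -/
noncomputable def ofBounded {α : Type*} : ∀ {n : ℕ}, memLang.BoundedFormula α n →
    (α ⊕ Fin n → ℕ) → SetFormula
  | _, .falsum, _ => fls
  | _, .equal (.var a) (.var b), ρ => eq (ρ a) (ρ b)
  | _, .equal (.func f _) _, _ => f.elim
  | _, .equal _ (.func f _), _ => f.elim
  | _, .rel MemRel.mem ts, ρ => match ts 0, ts 1 with
    | .var a, .var b => mem (ρ a) (ρ b)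
    | .func f _, _ => f.elim
    | _, .func f _ => f.elim
  | _, .imp φ ψ, ρ => imp (ofBounded φ ρ) (ofBounded ψ ρ)
  | _, .all φ, ρ => all (ofBounded φ (Sum.elim (fun a => ρ (.inl a) + 1)
      fun i => Fin.lastCases (motive := fun _ => ℕ) 0 (fun i => ρ (.inr i) + 1) i))

lemma sat_ofBounded {α : Type*} {A : Set ZFSet.{u}} {c : X → ZFSet.{u}} (hc : c.Injective)
    (hA : Set.range c = A) (hm : ∀ v : Fin 2 → X, Structure.RelMap (L := memLang) (n := 2) MemRel.mem v ↔ c (v 0) ∈ c (v 1))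
    {n : ℕ} (φ : memLang.BoundedFormula α n) (ρ : α ⊕ Fin n → ℕ) (v : α → X) (xs : Fin n → X)
    (w : ℕ → ZFSet.{u}) (hw : ∀ a, w (ρ a) = c (Sum.elim v xs a)) :
    Sat A (ofBounded φ ρ) w ↔ φ.Realize v xs := by
  induction φ generalizing w with
  | falsum => simp [ofBounded, Sat, BoundedFormula.Realize]
  | equal t₁ t₂ =>
    rcases t₁ with a | ⟨f, _⟩
    · rcases t₂ with b | ⟨f, _⟩
      · simp [ofBounded, Sat, BoundedFormula.Realize, hw, hc.eq_iff]
      · exact f.elim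
    · exact f.elim
  | rel R ts =>
    cases R
    have h0 : ∃ a, ts 0 = .var a := by
      rcases ts 0 with a | ⟨f, _⟩
      · exact ⟨a, rfl⟩
      · exact f.elim
    have h1 : ∃ a, ts 1 = .var a := by
      rcases ts 1 with a | ⟨f, _⟩
      · exact ⟨a, rfl⟩
      · exact f.elim
    obtain ⟨a, ha⟩ := h0
    obtain ⟨b, hb⟩ := h1
    simp only [ofBounded, ha, hb, Sat, BoundedFormula.Realize, hm, hw, Term.realize_var]
  | imp φ ψ h1 h2 => simp only [ofBounded, Sat, BoundedFormula.Realize, h1 _ _ _ hw, h2 _ _ _ hw]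
  | all φ h =>
    subst hA
    simp only [ofBounded, Sat, BoundedFormula.Realize, Set.forall_mem_range]
    refine forall_congr' fun x => h _ _ _ fun a => ?_
    rcases a with a | i
    · simp [hw]
    · induction i using Fin.lastCases with
      | last => simp
      | cast i => simp [hw]

lemma sat_iff_of_elementary {N : Set ZFSet.{u}} (j : ZFSet.{u} ↪ₑ[memLang] N) (φ : SetFormula)
    (v : ℕ → ZFSet.{u}) :
    Sat N φ (fun n => (j (v n) : ZFSet.{u})) ↔ Sat Set.univ φ v := by
  rw [← realize_toFormula (c := fun x : ZFSet.{u} => x) (fun _ _ h => h) Set.range_id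
      (fun _ => Iff.rfl), ← j.map_formula,
    realize_toFormula (c := fun x : N => (x : ZFSet.{u})) Subtype.val_injective Subtype.range_val
      (fun _ => Iff.rfl)]
  rfl

lemma exists_sat_iff_mem {C M : Set ZFSet.{u}}
    (h : (∅ : Set C).Definable₁ memLang {x | (x : ZFSet.{u}) ∈ M}) :
    ∃ θ, ∀ v : ℕ → ZFSet.{u}, (∀ n, v n ∈ C) → (Sat C θ v ↔ v 0 ∈ M) := by
  obtain ⟨φ, hφ⟩ := Set.empty_definable_iff.1 h
  refine ⟨ofBounded φ fun _ => 0, fun v hv => ?_⟩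
  rw [sat_ofBounded (c := fun x : C => (x : ZFSet.{u})) Subtype.val_injective Subtype.range_val
      (fun _ => Iff.rfl) φ _ (fun _ => ⟨v 0, hv 0⟩) default]
  · exact (Set.ext_iff.1 hφ fun _ => ⟨v 0, hv 0⟩).symm
  · rintro (a | i)
    · rfl
    · exact i.elim0

end SetFormula

/-! ### Definable power sets in terms of `SetFormula` -/

open SetFormula

/-- A sequence of parameters replaces the finitely many named ones, which is the shape that Łoś's
theorem handles. The parameters must lie in `D` only if `D` has an element, since an empty `D`
admits no sequence at all. -/
lemma mem_defPow {D y : ZFSet.{u}} : y ∈ defPow D ↔ y ⊆ D ∧ ∃ (φ : SetFormula) (p : ℕ → ZFSet.{u}),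
    (∀ x ∈ D, ∀ k, p k ∈ D) ∧ ∀ x ∈ D, (x ∈ y ↔ Sat (D : Set ZFSet.{u}) φ (vcons x p)) := by
  simp only [defPow, mem_sep, mem_powerset]
  refine and_congr_right fun hy => ?_
  by_cases hD : ∃ d, d ∈ D
  · obtain ⟨d, hd⟩ := hD
    constructor
    · intro h
      obtain ⟨A₀, -, h⟩ := Set.definable_iff_finitely_definable.1 h
      obtain ⟨φ, hφ⟩ := Set.definable_iff_exists_formula_sum.1 h
      obtain ⟨e, he⟩ := exists_injective_nat (A₀ : Set (D : Set ZFSet.{u}))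
      classical
      -- This inverts the injection `e` of the parameters into `ℕ`; indices outside its range get
      -- the filler `d`.
      let p : ℕ → ZFSet.{u} := fun k => if h : ∃ a, e a = k then (h.choose : (D : Set ZFSet.{u}))
        else d
      refine ⟨ofBounded φ (Sum.elim (Sum.elim (fun a => e a + 1) fun _ => 0) fun _ => 0), p,
        fun _ _ k => ?_, fun x hx => ?_⟩
      · simp only [p]
        split_ifs with h
        · exact (h.choose : (D : Set ZFSet.{u})).2
        · exact hd
      · rw [sat_ofBounded (c := fun x : (D : Set ZFSet.{u}) => (x : ZFSet.{u}))
          Subtype.val_injective Subtype.range_val (fun _ => Iff.rfl) φ _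
          (Sum.elim (fun a => (a : (D : Set ZFSet.{u}))) fun _ => ⟨x, hx⟩) default]
        · exact Set.ext_iff.1 hφ fun _ => ⟨x, hx⟩
        · rintro ((a | i) | i)
          · have h : ∃ b, e b = e a := ⟨a, rfl⟩
            simp only [Sum.elim_inl, vcons_succ, p, dif_pos h]
            rw [he h.choose_spec]
          · rfl
          · exact i.elim0
    · rintro ⟨φ, p, hp, h⟩
      refine Set.definable_iff_exists_formula_sum.2
        ⟨φ.toFormula.relabel fun
          | 0 => Sum.inr 0
          | n + 1 => Sum.inl ⟨⟨p n, hp d hd n⟩, trivial⟩, ?_⟩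
      ext v
      simp only [Set.mem_ofPred_eq, Formula.realize_relabel]
      rw [realize_toFormula (c := fun x : (D : Set ZFSet.{u}) => (x : ZFSet.{u}))
          Subtype.val_injective Subtype.range_val (fun _ => Iff.rfl), h _ (v 0).2]
      apply iff_of_eq
      congr 1
      funext n
      cases n <;> rfl
  · refine ⟨fun _ => ⟨.fls, fun _ => ∅, fun x hx => (hD ⟨x, hx⟩).elim,
      fun x hx => (hD ⟨x, hx⟩).elim⟩, fun _ => ?_⟩
    have : ({x | (x : ZFSet.{u}) ∈ y} : Set (D : Set ZFSet.{u})) = ∅ := by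
      ext x
      exact (hD ⟨x, x.2⟩).elim
    rw [this]
    exact Set.definable_empty

end InnerModels


namespace InnerModels

open FirstOrder FirstOrder.Language ZFSet
open scoped Ordinal Cardinal
open SetFormula

/-! ### Uniformly definable relations -/

/-- The class of all transitive classes. -/
def transClasses : Set (Set ZFSet.{u}) := {A | IsTransClass A}

/-- A relation on each class in `K` is uniformly definable. -/
def UDef (K : Set (Set ZFSet.{u})) (R : Set ZFSet.{u} → (ℕ → ZFSet.{u}) → Prop) : Prop :=
  ∃ φ : SetFormula, ∀ A ∈ K, ∀ v : ℕ → ZFSet.{u}, (∀ n, v n ∈ A) → (Sat A φ v ↔ R A v)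

namespace UDef

variable {K : Set (Set ZFSet.{u})} {R R' : Set ZFSet.{u} → (ℕ → ZFSet.{u}) → Prop}

lemma congr (h : UDef K R) (hR : ∀ A ∈ K, ∀ v, (∀ n, v n ∈ A) → (R A v ↔ R' A v)) : UDef K R' :=
  let ⟨φ, hφ⟩ := h
  ⟨φ, fun A hA v hv => (hφ A hA v hv).trans (hR A hA v hv)⟩

lemma mem (i j : ℕ) : UDef K fun _ v => v i ∈ v j := ⟨.mem i j, fun _ _ _ _ => Iff.rfl⟩

lemma eq (i j : ℕ) : UDef K fun _ v => v i = v j := ⟨.eq i j, fun _ _ _ _ => Iff.rfl⟩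

lemma fls : UDef K fun _ _ => False := ⟨.fls, fun _ _ _ _ => Iff.rfl⟩

lemma imp (h : UDef K R) (h' : UDef K R') : UDef K fun A v => R A v → R' A v :=
  let ⟨φ, hφ⟩ := h
  let ⟨ψ, hψ⟩ := h'
  ⟨.imp φ ψ, fun A hA v hv => imp_congr (hφ A hA v hv) (hψ A hA v hv)⟩

lemma not (h : UDef K R) : UDef K fun A v => ¬ R A v := h.imp fls

lemma and (h : UDef K R) (h' : UDef K R') : UDef K fun A v => R A v ∧ R' A v :=
  (h.imp h'.not).not.congr fun _ _ _ _ => by tauto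

lemma or (h : UDef K R) (h' : UDef K R') : UDef K fun A v => R A v ∨ R' A v :=
  (h.not.imp h').congr fun _ _ _ _ => by tauto

lemma iff (h : UDef K R) (h' : UDef K R') : UDef K fun A v => R A v ↔ R' A v :=
  ((h.imp h').and (h'.imp h)).congr fun _ _ _ _ => by tauto

lemma sat (φ : SetFormula) (ρ : ℕ → ℕ) : UDef K fun A v => Sat A φ fun n => v (ρ n) :=
  ⟨φ.rename ρ, fun A _ v _ => sat_rename A φ ρ v⟩

lemma comp (h : UDef K R) (ρ : ℕ → ℕ) : UDef K fun A v => R A fun n => v (ρ n) :=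
  let ⟨φ, hφ⟩ := h
  (sat φ ρ).congr fun A hA _ hv => hφ A hA _ fun n => hv (ρ n)

variable {Q : Set ZFSet.{u} → (ℕ → ZFSet.{u}) → ZFSet.{u} → Prop}

lemma all (h : UDef K fun A w => Q A (fun n => w (n + 1)) (w 0)) :
    UDef K fun A v => ∀ x, x ∈ A → Q A v x :=
  let ⟨φ, hφ⟩ := h
  ⟨.all φ, fun A hA v hv => forall₂_congr fun _ hx => hφ A hA (vcons _ v) (vcons_mem hx hv)⟩

lemma ex (h : UDef K fun A w => Q A (fun n => w (n + 1)) (w 0)) :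
    UDef K fun A v => ∃ x, x ∈ A ∧ Q A v x :=
  (all (Q := fun A v x => ¬ Q A v x) h.not).not.congr fun _ _ _ _ => by push Not; rfl

lemma allUniv (h : UDef {Set.univ} fun A w => Q A (fun n => w (n + 1)) (w 0)) :
    UDef {Set.univ} fun A v => ∀ x, Q A v x :=
  h.all.congr fun A hA _ _ => by subst hA; simp

lemma exUniv (h : UDef {Set.univ} fun A w => Q A (fun n => w (n + 1)) (w 0)) :
    UDef {Set.univ} fun A v => ∃ x, Q A v x :=
  h.ex.congr fun A hA _ _ => by subst hA; simp

/-- In a transitive class the elements of `v i` belong to the class, so a bounded quantifier agrees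
with its relativization. This is the source of all absoluteness below. -/
lemma ball (i : ℕ) (hK : K ⊆ transClasses)
    (h : UDef K fun A w => Q A (fun n => w (n + 1)) (w 0)) :
    UDef K fun A v => ∀ x, x ∈ v i → Q A v x :=
  (all (Q := fun A v x => x ∈ v i → Q A v x) ((mem 0 (i + 1)).imp h)).congr fun A hA v hv =>
    ⟨fun H x hx => H x (hK hA _ (hv i) x hx) hx, fun H x _ hx => H x hx⟩

lemma bex (i : ℕ) (hK : K ⊆ transClasses)
    (h : UDef K fun A w => Q A (fun n => w (n + 1)) (w 0)) :
    UDef K fun A v => ∃ x, x ∈ v i ∧ Q A v x :=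
  (ball (Q := fun A v x => ¬ Q A v x) i hK h.not).not.congr fun _ _ _ _ => by push Not; rfl

lemma eqSingleton (hK : K ⊆ transClasses) (i j : ℕ) : UDef K fun _ v => v i = {v j} :=
  ((mem j i).and (ball (Q := fun _ v x => x = v j) i hK (eq _ _))).congr fun A _ v _ => by
    constructor
    · rintro ⟨h1, h2⟩
      ext z
      rw [mem_singleton]
      exact ⟨h2 z, fun h => h ▸ h1⟩
    · intro h
      simp [h]

lemma eqUPair (hK : K ⊆ transClasses) (i j k : ℕ) : UDef K fun _ v => v i = {v j, v k} :=
  (((mem j i).and (mem k i)).and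
    (ball (Q := fun _ v x => x = v j ∨ x = v k) i hK ((eq _ _).or (eq _ _)))).congr
      fun A _ v _ => by
    constructor
    · rintro ⟨⟨h1, h2⟩, h3⟩
      ext z
      rw [ZFSet.mem_pair]
      exact ⟨h3 z, by rintro (rfl | rfl) <;> assumption⟩
    · intro h
      simp [h]

lemma eqPair (hK : K ⊆ transClasses) (i j k : ℕ) : UDef K fun _ v => v i = pair (v j) (v k) := by
  have : UDef K fun A v => ∃ p, p ∈ v i ∧ ∃ q, q ∈ v i ∧
      ((p = {v j} ∧ q = {v j, v k}) ∧ v i = {p, q}) := by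
    refine bex _ hK (bex _ hK ((and ?_ ?_).and ?_))
    · exact eqSingleton hK _ _
    · exact eqUPair hK _ _ _
    · exact eqUPair hK _ _ _
  refine this.congr fun A _ v _ => ?_
  constructor
  · rintro ⟨p, -, q, -, ⟨rfl, rfl⟩, h⟩
    exact h
  · intro h
    refine ⟨{v j}, ?_, {v j, v k}, ?_, ⟨rfl, rfl⟩, h⟩ <;> simp [h, pair]

lemma pairMem (hK : K ⊆ transClasses) (i j k : ℕ) : UDef K fun _ v => pair (v i) (v j) ∈ v k :=
  (bex (Q := fun _ v x => x = pair (v i) (v j)) k hK (eqPair hK _ _ _)).congr fun _ _ _ _ => by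
    simp

lemma subset (hK : K ⊆ transClasses) (i j : ℕ) : UDef K fun _ v => v i ⊆ v j :=
  (ball (Q := fun _ v x => x ∈ v j) i hK (mem _ _)).congr fun _ _ _ _ => Iff.rfl

lemma eqEmpty (hK : K ⊆ transClasses) (i : ℕ) : UDef K fun _ v => v i = ∅ :=
  (ball (Q := fun _ _ _ => False) i hK fls).congr fun _ _ _ _ => (ZFSet.eq_empty _).symm

lemma eqInsert (hK : K ⊆ transClasses) (i j k : ℕ) :
    UDef K fun _ v => v i = insert (v j) (v k) := by
  have : UDef K fun A v => (v j ∈ v i ∧ ∀ x, x ∈ v k → x ∈ v i) ∧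
      ∀ x, x ∈ v i → x = v j ∨ x ∈ v k :=
    ((mem _ _).and (ball _ hK (mem _ _))).and (ball _ hK ((eq _ _).or (mem _ _)))
  refine this.congr fun A _ v _ => ⟨fun h => ?_, fun h => by simp +contextual [h]⟩
  ext z
  rw [ZFSet.mem_insert_iff]
  exact ⟨h.2 z, by rintro (rfl | hz); exacts [h.1.1, h.1.2 z hz]⟩

lemma isFunc (hK : K ⊆ transClasses) (i j k : ℕ) :
    UDef K fun _ v => IsFunc (v i) (v j) (v k) := by
  have : UDef K fun A v => (∀ z, z ∈ v k → ∃ x, x ∈ v i ∧ ∃ y, y ∈ v j ∧ z = pair x y) ∧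
      ∀ x, x ∈ v i → ∃ y, y ∈ v j ∧ (pair x y ∈ v k ∧ ∀ y', y' ∈ v j → pair x y' ∈ v k → y' = y) :=
    (ball _ hK (bex _ hK (bex _ hK (eqPair hK _ _ _)))).and
      (ball _ hK (bex _ hK ((pairMem hK _ _ _).and (ball _ hK ((pairMem hK _ _ _).imp (eq _ _))))))
  refine this.congr fun A _ v _ => ?_
  have h1 : (∀ z, z ∈ v k → ∃ x, x ∈ v i ∧ ∃ y, y ∈ v j ∧ z = pair x y) ↔
      v k ⊆ ZFSet.prod (v i) (v j) :=
    forall₂_congr fun z _ => mem_prod.symm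
  rw [IsFunc, h1]
  refine and_congr_right fun hsub => forall₂_congr fun x hx => ?_
  have h2 : ∀ y, pair x y ∈ v k → y ∈ v j := fun y hy => (pair_mem_prod.1 (hsub hy)).2
  constructor
  · rintro ⟨y, _, hy, h⟩
    exact ⟨y, hy, fun y' hy' => h y' (h2 y' hy') hy'⟩
  · rintro ⟨y, hy, h⟩
    exact ⟨y, h2 y hy, hy, fun y' _ hy' => h y' hy'⟩

lemma isOrdinal (hK : K ⊆ transClasses) (i : ℕ) : UDef K fun _ v => (v i).IsOrdinal := by
  have : UDef K fun A v => (∀ x, x ∈ v i → ∀ y, y ∈ x → y ∈ v i) ∧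
      ∀ x, x ∈ v i → ∀ y, y ∈ x → ∀ z, z ∈ y → z ∈ x :=
    (ball _ hK (ball _ hK (mem _ _))).and (ball _ hK (ball _ hK (ball _ hK (mem _ _))))
  refine this.congr fun A _ v _ => ?_
  rw [isOrdinal_iff_forall_mem_isTransitive]
  rfl

/-- Absoluteness by a bounded characterization: `ω` contains `∅`, is closed under successor, and
each member is `∅` or the successor of a member. By `∈`-induction such members are natural numbers.
-/
lemma eqOmega (hK : K ⊆ transClasses) (i : ℕ) : UDef K fun _ v => v i = (ω).toZFSet := by
  have : UDef K fun A v => (∃ x, x ∈ v i ∧ x = ∅) ∧ (∀ x, x ∈ v i → ∃ y, y ∈ v i ∧ y = insert x x) ∧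
      ∀ x, x ∈ v i → x = ∅ ∨ ∃ y, y ∈ v i ∧ x = insert y y :=
    (bex _ hK (eqEmpty hK _)).and ((ball _ hK (bex _ hK (eqInsert hK _ _ _))).and
      (ball _ hK ((eqEmpty hK _).or (bex _ hK (eqInsert hK _ _ _)))))
  refine this.congr fun A _ v _ => ⟨?_, fun h => ?_⟩
  · rintro ⟨h0, hs, hc⟩
    ext z
    rw [Ordinal.mem_toZFSet_iff]
    constructor
    · induction z using ZFSet.inductionOn with
      | _ z ih =>
        intro hz
        rcases hc z hz with rfl | ⟨y, hy, rfl⟩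
        · exact ⟨0, Ordinal.omega0_pos, by simp⟩
        · obtain ⟨a, ha, rfl⟩ := ih y (by simp) hy
          exact ⟨a + 1, Ordinal.isSuccLimit_omega0.add_one_lt ha, Ordinal.toZFSet_add_one a⟩
    · rintro ⟨a, ha, rfl⟩
      obtain ⟨n, rfl⟩ := Ordinal.lt_omega0.1 ha
      clear ha
      induction n with
      | zero =>
        obtain ⟨x, hx, rfl⟩ := h0
        simpa using hx
      | succ n ih =>
        obtain ⟨y, hy, h⟩ := hs _ ih
        rw [Nat.cast_succ, Ordinal.toZFSet_add_one]
        exact h ▸ hy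
  · rw [h]
    refine ⟨⟨∅, ?_, rfl⟩, fun x hx => ?_, fun x hx => ?_⟩
    · exact Ordinal.mem_toZFSet_iff.2 ⟨0, Ordinal.omega0_pos, by simp⟩
    · obtain ⟨a, ha, rfl⟩ := Ordinal.mem_toZFSet_iff.1 hx
      exact ⟨_, Ordinal.mem_toZFSet_iff.2 ⟨a + 1, Ordinal.isSuccLimit_omega0.add_one_lt ha, rfl⟩,
        Ordinal.toZFSet_add_one a⟩
    · obtain ⟨a, ha, rfl⟩ := Ordinal.mem_toZFSet_iff.1 hx
      obtain ⟨n, rfl⟩ := Ordinal.lt_omega0.1 ha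
      cases n with
      | zero => exact Or.inl (by simp)
      | succ n =>
        exact Or.inr ⟨_, Ordinal.mem_toZFSet_iff.2 ⟨n, Ordinal.natCast_lt_omega0 n, rfl⟩, by
          rw [Nat.cast_succ, Ordinal.toZFSet_add_one]⟩

/-- `v i` is the relativized power set of `v j`. -/
lemma eqPowerset (hK : K ⊆ transClasses) (i j : ℕ) :
    UDef K fun A v => ∀ x, x ∈ A → (x ∈ v i ↔ x ⊆ v j) :=
  all ((mem _ _).iff (subset hK _ _))

/-- `v i` is the relativized set of functions from `v j` to `v k`. -/
lemma eqFuns (hK : K ⊆ transClasses) (i j k : ℕ) :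
    UDef K fun A v => ∀ x, x ∈ A → (x ∈ v i ↔ IsFunc (v j) (v k) x) :=
  all ((mem _ _).iff (isFunc hK _ _ _))

end UDef

/-! ### Elementary maps -/

/-- `f` is an elementary embedding of `(A, ∈)` into `(B, ∈)`. -/
structure ElemMap (A B : Set ZFSet.{u}) (f : ZFSet.{u} → ZFSet.{u}) : Prop where
  mapsTo : ∀ x ∈ A, f x ∈ B
  sat_iff : ∀ (φ : SetFormula) (v : ℕ → ZFSet.{u}), (∀ n, v n ∈ A) →
    (Sat B φ (fun n => f (v n)) ↔ Sat A φ v)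

namespace ElemMap

variable {A B C : Set ZFSet.{u}} {f g : ZFSet.{u} → ZFSet.{u}} {K : Set (Set ZFSet.{u})}
  {R : Set ZFSet.{u} → (ℕ → ZFSet.{u}) → Prop}

lemma iff (hf : ElemMap A B f) (hR : UDef K R) (hA : A ∈ K) (hB : B ∈ K) (v : ℕ → ZFSet.{u})
    (hv : ∀ n, v n ∈ A) : R B (fun n => f (v n)) ↔ R A v := by
  obtain ⟨φ, hφ⟩ := hR
  rw [← hφ A hA v hv, ← hφ B hB _ fun n => hf.mapsTo _ (hv n), hf.sat_iff φ v hv]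

lemma comp (hg : ElemMap B C g) (hf : ElemMap A B f) : ElemMap A C fun x => g (f x) where
  mapsTo x hx := hg.mapsTo _ (hf.mapsTo x hx)
  sat_iff φ v hv := (hg.sat_iff φ _ fun n => hf.mapsTo _ (hv n)).trans (hf.sat_iff φ v hv)

/-- Validity transfers along elementary embeddings. -/
lemma forall_of_forall (hf : ElemMap A B f) (hR : UDef K R) (hA : A ∈ K) (hB : B ∈ K)
    (hne : A.Nonempty) (h : ∀ v, (∀ n, v n ∈ A) → R A v) (w : ℕ → ZFSet.{u}) (hw : ∀ n, w n ∈ B) :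
    R B w := by
  obtain ⟨φ, hφ⟩ := hR
  obtain ⟨a, ha⟩ := hne
  rw [← hφ B hB w hw]
  -- Quantifying all `φ.bound` variables turns validity into the truth of a sentence, for which the
  -- constant valuation `a` is as good as any.
  have h1 : Sat A (alls φ.bound φ) fun _ => a :=
    sat_alls_of_forall (fun v hv => (hφ A hA v hv).2 (h v hv)) _ _ fun _ => ha
  rw [← hf.sat_iff _ _ fun _ => ha] at h1
  refine (sat_congr B φ _ _ fun n hn => ?_).1 (sat_of_sat_alls h1 w hw)
  simp [hn]

end ElemMap

end InnerModels


namespace InnerModels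

open FirstOrder FirstOrder.Language ZFSet
open scoped Ordinal Cardinal
open SetFormula UDef

/-! ### Systems of ultrafilters -/

/-- `U` is a coherent system of `|I|⁺`-complete ultrafilters `U_a = {X | (X, a) ∈ U}` on the set `S`
of functions from `I` to `L`, for functions `a` from `I` to `D`. -/
structure IsUltraSystem (I L D S U : ZFSet.{u}) : Prop where
  compl : ∀ a, IsFunc I D a → ∀ X, X ⊆ S → ∀ Y, Y ⊆ S → (∀ s, s ∈ S → (s ∈ Y ↔ ¬ s ∈ X)) →
    (pair Y a ∈ U ↔ ¬ pair X a ∈ U)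
  inter : ∀ a, IsFunc I D a → ∀ G Y : ZFSet.{u}, Y ⊆ S → (∀ s, s ∈ S → (s ∈ Y ↔ ∀ ξ, ξ ∈ I → pair ξ s ∈ G)) →
    (pair Y a ∈ U ↔ ∀ ξ, ξ ∈ I → ∀ X, X ⊆ S → (∀ s, s ∈ S → (s ∈ X ↔ pair ξ s ∈ G)) →
      pair X a ∈ U)
  coherent : ∀ a, IsFunc I D a → ∀ b, IsFunc I D b → ∀ σ, IsFunc I I σ →
    (∀ ξ, ξ ∈ I → ∃ ζ, ζ ∈ I ∧ ∃ y, y ∈ D ∧ pair ξ ζ ∈ σ ∧ pair ζ y ∈ a ∧ pair ξ y ∈ b) →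
    ∀ X, X ⊆ S → ∀ Y, Y ⊆ S →
    (∀ s, s ∈ S → (s ∈ Y ↔ ∃ t, t ∈ X ∧
      ∀ ξ, ξ ∈ I → ∃ ζ, ζ ∈ I ∧ ∃ y, y ∈ L ∧ pair ξ ζ ∈ σ ∧ pair ζ y ∈ s ∧ pair ξ y ∈ t)) →
    (pair X b ∈ U ↔ pair Y a ∈ U)
  mono : ∀ a, IsFunc I D a → ∀ ξ, ξ ∈ I → ∀ ζ, ζ ∈ I → ∀ x, x ∈ D → ∀ y, y ∈ D →
    pair ξ x ∈ a → pair ζ y ∈ a → x ∈ y → ∀ X, X ⊆ S →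
    (∀ s, s ∈ S → (s ∈ X ↔ ∃ x, x ∈ L ∧ ∃ y, y ∈ L ∧ pair ξ x ∈ s ∧ pair ζ y ∈ s ∧ x ∈ y)) →
    pair X a ∈ U

lemma singleton_univ_subset : ({Set.univ} : Set (Set ZFSet.{u})) ⊆ transClasses := by
  rintro _ rfl x _ y _
  trivial

/-- The clauses quantify over arbitrary sets, so definability is claimed over the universe only.
They are repeated in primitive form to match the closure lemmas for formulas. -/
lemma UDef.isUltraSystem (i l d s m : ℕ) :
    UDef.{u} {Set.univ} fun _ v => IsUltraSystem (v i) (v l) (v d) (v s) (v m) := by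
  have hK := singleton_univ_subset.{u}
  have h1 : UDef {Set.univ} fun _ v => ∀ a, IsFunc (v i) (v d) a → ∀ X, X ⊆ v s → ∀ Y, Y ⊆ v s →
      (∀ x, x ∈ v s → (x ∈ Y ↔ ¬ x ∈ X)) → (pair Y a ∈ v m ↔ ¬ pair X a ∈ v m) :=
    allUniv ((isFunc hK _ _ _).imp (allUniv ((subset hK _ _).imp (allUniv ((subset hK _ _).imp
      ((ball _ hK ((mem _ _).iff (mem _ _).not)).imp
        ((pairMem hK _ _ _).iff (pairMem hK _ _ _).not)))))))
  have h2 : UDef {Set.univ} fun _ v => ∀ a, IsFunc (v i) (v d) a → ∀ G Y : ZFSet.{u}, Y ⊆ v s →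
      (∀ x, x ∈ v s → (x ∈ Y ↔ ∀ ξ, ξ ∈ v i → pair ξ x ∈ G)) →
      (pair Y a ∈ v m ↔ ∀ ξ, ξ ∈ v i → ∀ X, X ⊆ v s →
        (∀ x, x ∈ v s → (x ∈ X ↔ pair ξ x ∈ G)) → pair X a ∈ v m) :=
    allUniv ((isFunc hK _ _ _).imp (allUniv (allUniv ((subset hK _ _).imp
      ((ball _ hK ((mem _ _).iff (ball _ hK (pairMem hK _ _ _)))).imp
        ((pairMem hK _ _ _).iff (ball _ hK (allUniv ((subset hK _ _).imp
          ((ball _ hK ((mem _ _).iff (pairMem hK _ _ _))).imp (pairMem hK _ _ _)))))))))))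
  have h3 : UDef {Set.univ} fun _ v => ∀ a, IsFunc (v i) (v d) a → ∀ b, IsFunc (v i) (v d) b →
      ∀ σ, IsFunc (v i) (v i) σ →
      (∀ ξ, ξ ∈ v i → ∃ ζ, ζ ∈ v i ∧ ∃ y, y ∈ v d ∧ pair ξ ζ ∈ σ ∧ pair ζ y ∈ a ∧ pair ξ y ∈ b) →
      ∀ X, X ⊆ v s → ∀ Y, Y ⊆ v s →
      (∀ x, x ∈ v s → (x ∈ Y ↔ ∃ t, t ∈ X ∧ ∀ ξ, ξ ∈ v i → ∃ ζ, ζ ∈ v i ∧ ∃ y, y ∈ v l ∧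
        pair ξ ζ ∈ σ ∧ pair ζ y ∈ x ∧ pair ξ y ∈ t)) →
      (pair X b ∈ v m ↔ pair Y a ∈ v m) :=
    allUniv ((isFunc hK _ _ _).imp (allUniv ((isFunc hK _ _ _).imp (allUniv ((isFunc hK _ _ _).imp
      ((ball _ hK (bex _ hK (bex _ hK
        ((pairMem hK _ _ _).and ((pairMem hK _ _ _).and (pairMem hK _ _ _)))))).imp
      (allUniv ((subset hK _ _).imp (allUniv ((subset hK _ _).imp
        ((ball _ hK ((mem _ _).iff (bex _ hK (ball _ hK (bex _ hK (bex _ hK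
          ((pairMem hK _ _ _).and ((pairMem hK _ _ _).and (pairMem hK _ _ _))))))))).imp
        ((pairMem hK _ _ _).iff (pairMem hK _ _ _)))))))))))))
  have h4 : UDef {Set.univ} fun _ v => ∀ a, IsFunc (v i) (v d) a → ∀ ξ, ξ ∈ v i → ∀ ζ, ζ ∈ v i →
      ∀ x, x ∈ v d → ∀ y, y ∈ v d → pair ξ x ∈ a → pair ζ y ∈ a → x ∈ y → ∀ X, X ⊆ v s →
      (∀ z, z ∈ v s → (z ∈ X ↔ ∃ x, x ∈ v l ∧ ∃ y, y ∈ v l ∧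
        pair ξ x ∈ z ∧ pair ζ y ∈ z ∧ x ∈ y)) → pair X a ∈ v m :=
    allUniv ((isFunc hK _ _ _).imp (ball _ hK (ball _ hK (ball _ hK (ball _ hK
      ((pairMem hK _ _ _).imp ((pairMem hK _ _ _).imp ((mem _ _).imp
      (allUniv ((subset hK _ _).imp ((ball _ hK ((mem _ _).iff (bex _ hK (bex _ hK
        ((pairMem hK _ _ _).and ((pairMem hK _ _ _).and (mem _ _))))))).imp
        (pairMem hK _ _ _))))))))))))
  exact (h1.and (h2.and (h3.and h4))).congr fun _ _ _ _ =>
    ⟨fun ⟨a, b, c, d⟩ => ⟨a, b, c, d⟩, fun ⟨a, b, c, d⟩ => ⟨a, b, c, d⟩⟩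

/-- The set of real numbers, as the power set of `ω`. -/
noncomputable def reals : ZFSet.{u} := powerset (ω).toZFSet

/-- `L` carries systems of ultrafilters with arbitrarily long ordinals `D`. -/
def HasUltraSystems (L : ZFSet.{u}) : Prop :=
  L.IsOrdinal ∧ ∀ D : ZFSet.{u}, D.IsOrdinal → ∃ U, IsUltraSystem reals L D (funs reals L) U

lemma UDef.hasUltraSystems (l : ℕ) :
    UDef.{u} {Set.univ} fun _ v => HasUltraSystems (v l) := by
  have hK := singleton_univ_subset.{u}
  -- Formulas have no terms: `ω`, its power set and the set of functions enter as variables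
  -- restricted by their defining properties.
  have : UDef {Set.univ} fun A v => (v l).IsOrdinal ∧ ∀ O, O = (ω).toZFSet →
      ∀ I, (∀ x, x ∈ A → (x ∈ I ↔ x ⊆ O)) → ∀ S, (∀ x, x ∈ A → (x ∈ S ↔ IsFunc I (v l) x)) →
      ∀ D : ZFSet.{u}, D.IsOrdinal → ∃ U, IsUltraSystem I (v l) D S U :=
    (isOrdinal hK _).and (allUniv ((eqOmega hK _).imp (allUniv ((eqPowerset hK _ _).imp
      (allUniv ((eqFuns hK _ _ _).imp (allUniv ((isOrdinal hK _).imp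
        (exUniv (isUltraSystem _ _ _ _ _))))))))))
  refine this.congr fun A hA v _ => ?_
  obtain rfl : A = Set.univ := hA
  refine and_congr_right fun _ => ⟨fun h => ?_, fun h => ?_⟩
  · exact h _ rfl reals (fun x _ => mem_powerset) _ fun x _ => mem_funs
  · rintro O rfl I hI S hS
    obtain rfl : I = reals := by
      ext x
      rw [hI x trivial, reals, mem_powerset]
    obtain rfl : S = funs reals (v l) := by
      ext x
      rw [hS x trivial, mem_funs]
    exact h

end InnerModels


namespace InnerModels

open FirstOrder FirstOrder.Language ZFSet
open scoped Ordinal Cardinal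
open SetFormula UDef

/-! ### Functions as sets -/

lemma isFunc_unique {I D f x y z : ZFSet.{u}} (hf : IsFunc I D f) (hy : pair x y ∈ f)
    (hz : pair x z ∈ f) : y = z :=
  (hf.2 x (pair_mem_prod.1 (hf.1 hy)).1).unique hy hz

lemma isFunc_mem {I D f x y : ZFSet.{u}} (hf : IsFunc I D f) (h : pair x y ∈ f) : x ∈ I ∧ y ∈ D :=
  pair_mem_prod.1 (hf.1 h)

lemma isFunc_mono {I D D' f : ZFSet.{u}} (hf : IsFunc I D f) (h : D ⊆ D') : IsFunc I D' f :=
  ⟨fun z hz => by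
    obtain ⟨a, ha, b, hb, rfl⟩ := mem_prod.1 (hf.1 hz)
    exact pair_mem_prod.2 ⟨ha, h hb⟩, hf.2⟩

lemma isFunc_ext {I D D' f g : ZFSet.{u}} (hf : IsFunc I D f) (hg : IsFunc I D' g)
    (h : ∀ x ∈ I, ∃ y, pair x y ∈ f ∧ pair x y ∈ g) : f = g := by
  ext z
  constructor
  · intro hz
    obtain ⟨a, ha, b, -, rfl⟩ := mem_prod.1 (hf.1 hz)
    obtain ⟨y, h1, h2⟩ := h a ha
    rwa [isFunc_unique hf hz h1]
  · intro hz
    obtain ⟨a, ha, b, -, rfl⟩ := mem_prod.1 (hg.1 hz)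
    obtain ⟨y, h1, h2⟩ := h a ha
    rwa [isFunc_unique hg hz h2]

/-! ### Elementary embeddings of the universe -/

namespace ElemMap

lemma of_elementaryEmbedding {N : Set ZFSet.{u}} (j : ZFSet.{u} ↪ₑ[memLang] N) :
    ElemMap Set.univ N fun x => j x where
  mapsTo x _ := (j x).2
  sat_iff φ v _ := sat_iff_of_elementary j φ v

variable {N : Set ZFSet.{u}} {j : ZFSet.{u} → ZFSet.{u}}

lemma iff_univ (hj : ElemMap Set.univ N j) (hN : IsTransClass N)
    {R : Set ZFSet.{u} → (ℕ → ZFSet.{u}) → Prop} (hR : UDef transClasses R) (v : ℕ → ZFSet.{u}) :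
    R N (fun n => j (v n)) ↔ R Set.univ v :=
  hj.iff hR (singleton_univ_subset rfl) hN v fun _ => trivial

/-- Being the part of `S` cut out by `R` is a bounded statement about `Y`, `S` and the parameters,
so `j` preserves it. The point `a` of `j S` need not be in the range of `j`. -/
lemma mem_map_iff (hj : ElemMap Set.univ N j) (hN : IsTransClass N)
    {R : Set ZFSet.{u} → (ℕ → ZFSet.{u}) → Prop} (hR : UDef transClasses R) {S Y : ZFSet.{u}}
    (w : ℕ → ZFSet.{u}) (hY : ∀ s, s ∈ S → (s ∈ Y ↔ R Set.univ (vcons s w)))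
    (a : ZFSet.{u}) (ha : a ∈ j S) : a ∈ j Y ↔ R N (vcons a fun n => j (w n)) := by
  -- Position 0 holds `s`; positions 1 and 2 hold `Y` and `S`, so the parameters start at 3.
  let ρ : ℕ → ℕ := fun n => n.casesOn 0 fun n => n + 3
  have h : UDef transClasses fun A v => ∀ s, s ∈ v 1 → (s ∈ v 0 ↔ R A (vcons s fun n => v (n + 2))) :=
    ball _ subset_rfl ((UDef.mem 0 1).iff ((hR.comp ρ).congr fun A _ w _ => by
      apply iff_of_eq
      congr 1
      funext n
      cases n with
      | zero => rfl
      | succ n => rfl))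
  exact (hj.iff_univ hN h (vcons Y (vcons S w))).2 hY a ha

lemma map_mem (hj : ElemMap Set.univ N j) {x y : ZFSet.{u}} : j x ∈ j y ↔ x ∈ y :=
  hj.sat_iff (.mem 0 1) (vcons x fun _ => y) fun _ => trivial

lemma map_subset (hj : ElemMap Set.univ N j) (hN : IsTransClass N) {x y : ZFSet.{u}} :
    j x ⊆ j y ↔ x ⊆ y :=
  hj.iff_univ hN (UDef.subset subset_rfl 0 1) (vcons x fun _ => y)

lemma map_pair (hj : ElemMap Set.univ N j) (hN : IsTransClass N) (x y : ZFSet.{u}) :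
    j (pair x y) = pair (j x) (j y) :=
  (hj.iff_univ hN (UDef.eqPair subset_rfl 0 1 2) (vcons (pair x y) (vcons x fun _ => y))).2 rfl

lemma map_omega (hj : ElemMap Set.univ N j) (hN : IsTransClass N) :
    j (ω).toZFSet = (ω).toZFSet :=
  (hj.iff_univ hN (UDef.eqOmega subset_rfl 0) fun _ => (ω).toZFSet).2 rfl

lemma map_nat (hj : ElemMap Set.univ N j) (hN : IsTransClass N) (n : ℕ) :
    j (n : Ordinal).toZFSet = (n : Ordinal).toZFSet := by
  induction n with
  | zero =>
    exact ((hj.iff_univ hN (UDef.eqEmpty subset_rfl 0) fun _ => (0 : Ordinal).toZFSet).2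
      (by simp)).trans (by simp)
  | succ n ih =>
    have := (hj.iff_univ hN (UDef.eqInsert subset_rfl 0 1 1)
      (vcons ((n : Ordinal) + 1).toZFSet fun _ => (n : Ordinal).toZFSet)).2
      (Ordinal.toZFSet_add_one _)
    rw [Nat.cast_succ]
    refine this.trans ?_
    change insert (j (n : Ordinal).toZFSet) (j (n : Ordinal).toZFSet) = _
    rw [ih, Ordinal.toZFSet_add_one]

/-- `j` fixes `ω` and each natural number, hence each subset of `ω`. -/
lemma map_of_mem_reals (hj : ElemMap Set.univ N j) (hN : IsTransClass N) {x : ZFSet.{u}}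
    (hx : x ∈ reals) : j x = x := by
  have hx' : x ⊆ (ω).toZFSet := mem_powerset.1 hx
  have hfix : ∀ z ∈ (ω).toZFSet, j z = z := by
    intro z hz
    obtain ⟨a, ha, rfl⟩ := Ordinal.mem_toZFSet_iff.1 hz
    obtain ⟨n, rfl⟩ := Ordinal.lt_omega0.1 ha
    exact hj.map_nat hN n
  ext z
  constructor
  · intro hz
    have h1 : z ∈ (ω).toZFSet := hj.map_omega hN ▸ (hj.map_subset hN).2 hx' hz
    rwa [← hj.map_mem, hfix z h1]
  · intro hz
    rw [← hfix z (hx' hz)]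
    exact hj.map_mem.2 hz

lemma map_reals (hj : ElemMap Set.univ N j) (hN : IsTransClass N) (h : ∀ x ∈ reals, x ∈ N) :
    j reals = reals := by
  have := (hj.iff_univ hN (UDef.eqPowerset subset_rfl 0 1)
    (vcons reals fun _ => (ω).toZFSet)).2 fun x _ => mem_powerset (x := (ω).toZFSet)
  ext x
  constructor
  · intro hx
    exact mem_powerset.2 (hj.map_omega hN ▸ (this x (hN _ (hj.mapsTo _ trivial) x hx)).1 hx)
  · intro hx
    refine (this x (h x hx)).2 ?_
    change x ⊆ j (ω).toZFSet
    rw [hj.map_omega hN]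
    exact mem_powerset.1 hx

end ElemMap

/-- The extender derived from `j`, with functions on `reals` in place of finite sets as indices.
Since `j` fixes `reals` and each of its elements, it acts coordinatewise on families indexed by
reals; this gives completeness and coherence. -/
theorem IsStrong.hasUltraSystems {κ : Ordinal.{u}} (h : IsStrong κ) :
    HasUltraSystems κ.toZFSet := by
  refine ⟨isOrdinal_toZFSet κ, fun D hD => ?_⟩
  set L := κ.toZFSet
  set S := funs reals L
  -- The three ranks put `D` inside `j κ`, all functions from `reals` to `D` into `N`, and all reals
  -- into `N`.
  obtain ⟨N, j₀, hN, -, -, hδ, hV⟩ := h (max D.rank (max (funs reals D).rank reals.rank))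
  have hj := ElemMap.of_elementaryEmbedding j₀
  set j : ZFSet.{u} → ZFSet.{u} := fun x => j₀ x with hjdef
  have hVN : ∀ x y : ZFSet.{u}, x ∈ y → y.rank ≤ max D.rank (max (funs reals D).rank reals.rank) → x ∈ N :=
    fun x y hxy hy => hV x (mem_vonNeumann.2 ((rank_lt_of_mem hxy).trans_le hy))
  have hI : j reals = reals := hj.map_reals hN fun x hx => hVN x _ hx (by simp)
  have hfix : ∀ x ∈ reals, j x = x := fun x => hj.map_of_mem_reals hN
  have hDL : D ⊆ j L := by
    have hL : (j L).IsOrdinal := (hj.iff_univ hN (UDef.isOrdinal subset_rfl 0) fun _ => L).2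
      (isOrdinal_toZFSet κ)
    intro x hx
    rw [← hD.toZFSet_rank_eq] at hx
    exact hL.subset_of_mem hδ (Ordinal.toZFSet_subset_toZFSet_iff.2 (le_max_left _ _) hx)
  have hjS : ∀ x ∈ N, x ∈ j S ↔ IsFunc reals (j L) x := by
    have := (hj.iff_univ hN (UDef.eqFuns subset_rfl 0 1 2)
      (vcons S (vcons reals fun _ => L))).2 fun x _ => mem_funs
    intro x hx
    rw [← hI]
    exact this x hx
  have haS : ∀ a, IsFunc reals D a → a ∈ j S := fun a ha =>
    (hjS a (hVN a _ (mem_funs.2 ha) (by simp))).2 (isFunc_mono ha hDL)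
  let U := (ZFSet.prod (powerset S) (funs reals D)).sep fun p => ∃ X a, p = pair X a ∧ a ∈ j X
  have hU : ∀ X, X ⊆ S → ∀ a, IsFunc reals D a → (pair X a ∈ U ↔ a ∈ j X) := by
    intro X hX a ha
    simp only [U, mem_sep, pair_mem_prod, mem_powerset, mem_funs, hX, ha, pair_inj, true_and]
    exact ⟨by rintro ⟨_, _, ⟨rfl, rfl⟩, h⟩; exact h, fun h => ⟨_, _, ⟨rfl, rfl⟩, h⟩⟩
  refine ⟨U, ?_, ?_, ?_, ?_⟩
  · intro a ha X hX Y hY h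
    rw [hU X hX a ha, hU Y hY a ha]
    exact hj.mem_map_iff hN (R := fun _ v => ¬ v 0 ∈ v 1) (UDef.mem 0 1).not (fun _ => X) h a
      (haS a ha)
  · intro a ha G Y hY h
    have h1 := hj.mem_map_iff hN (R := fun _ v => ∀ ξ, ξ ∈ v 1 → pair ξ (v 0) ∈ v 2)
      (UDef.ball _ subset_rfl (UDef.pairMem subset_rfl _ _ _)) (vcons reals fun _ => G) h a
      (haS a ha)
    have h2 : ∀ ξ ∈ reals, ∀ X, X ⊆ S → (∀ s, s ∈ S → (s ∈ X ↔ pair ξ s ∈ G)) →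
        (a ∈ j X ↔ pair ξ a ∈ j G) := by
      intro ξ hξ X hX h
      have := hj.mem_map_iff hN (R := fun _ v => pair (v 1) (v 0) ∈ v 2)
        (UDef.pairMem subset_rfl _ _ _) (vcons ξ fun _ => G) h a (haS a ha)
      refine this.trans ?_
      change pair (j ξ) a ∈ j G ↔ _
      rw [hfix ξ hξ]
    rw [hU Y hY a ha]
    refine h1.trans ?_
    change (∀ ξ, ξ ∈ j reals → pair ξ a ∈ j G) ↔ _
    rw [hI]
    refine forall₂_congr fun ξ hξ => ⟨fun H X hX hXG => ?_, fun H => ?_⟩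
    · rwa [hU X hX a ha, h2 ξ hξ X hX hXG]
    · have h3 : ∀ s, s ∈ S → (s ∈ S.sep (fun s => pair ξ s ∈ G) ↔ pair ξ s ∈ G) := fun s hs => by
        simp [hs]
      rw [← h2 ξ hξ _ (sep_subset) h3, ← hU _ sep_subset a ha]
      exact H _ sep_subset h3
  · intro a ha b hb σ hσ hab X hX Y hY h
    have h1 := hj.mem_map_iff hN (R := fun _ v => ∃ t, t ∈ v 1 ∧ ∀ ξ, ξ ∈ v 2 → ∃ ζ, ζ ∈ v 2 ∧
        ∃ y, y ∈ v 3 ∧ pair ξ ζ ∈ v 4 ∧ pair ζ y ∈ v 0 ∧ pair ξ y ∈ t)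
      (bex _ subset_rfl (ball _ subset_rfl (bex _ subset_rfl (bex _ subset_rfl
        ((pairMem subset_rfl _ _ _).and ((pairMem subset_rfl _ _ _).and
          (pairMem subset_rfl _ _ _)))))))
      (vcons X (vcons reals (vcons L fun _ => σ))) h a (haS a ha)
    rw [hU Y hY a ha, hU X hX b hb]
    refine Iff.trans ?_ h1.symm
    change _ ↔ ∃ t, t ∈ j X ∧ ∀ ξ, ξ ∈ j reals → ∃ ζ, ζ ∈ j reals ∧
        ∃ y, y ∈ j L ∧ pair ξ ζ ∈ j σ ∧ pair ζ y ∈ a ∧ pair ξ y ∈ t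
    rw [hI]
    have hjσ : ∀ ξ ∈ reals, ∀ ζ ∈ reals, pair ξ ζ ∈ j σ ↔ pair ξ ζ ∈ σ := by
      intro ξ hξ ζ hζ
      rw [← hj.map_mem (x := pair ξ ζ) (y := σ), hj.map_pair hN, hfix ξ hξ, hfix ζ hζ]
    constructor
    · intro hbX
      refine ⟨b, hbX, fun ξ hξ => ?_⟩
      obtain ⟨ζ, hζ, y, hy, h1, h2, h3⟩ := hab ξ hξ
      exact ⟨ζ, hζ, y, hDL hy, (hjσ ξ hξ ζ hζ).2 h1, h2, h3⟩
    · rintro ⟨t, ht, H⟩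
      have htS : t ∈ j S := (hj.map_subset hN).2 hX ht
      have ht' := (hjS t (hN _ (hj.mapsTo _ trivial) t htS)).1 htS
      -- A function `t` related to `a` through `j σ` is `a ∘ σ`, that is, `b`.
      rwa [← isFunc_ext ht' hb fun ξ hξ => ?_]
      obtain ⟨ζ, hζ, y, hy, h1, h2, h3⟩ := hab ξ hξ
      obtain ⟨ζ', hζ', y', hy', h1', h2', h3'⟩ := H ξ hξ
      obtain rfl := isFunc_unique hσ h1 ((hjσ ξ hξ ζ' hζ').1 h1')
      obtain rfl := isFunc_unique ha h2 h2'
      exact ⟨y, h3', h3⟩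
  · intro a ha ξ hξ ζ hζ x hx y hy h1 h2 hxy X hX h
    rw [hU X hX a ha]
    refine (hj.mem_map_iff hN (R := fun _ v => ∃ x, x ∈ v 1 ∧ ∃ y, y ∈ v 1 ∧
      pair (v 2) x ∈ v 0 ∧ pair (v 3) y ∈ v 0 ∧ x ∈ y) (bex _ subset_rfl (bex _ subset_rfl
        ((pairMem subset_rfl _ _ _).and ((pairMem subset_rfl _ _ _).and (UDef.mem _ _)))))
      (vcons L (vcons ξ fun _ => ζ)) h a (haS a ha)).2 ?_
    change ∃ x, x ∈ j L ∧ ∃ y, y ∈ j L ∧ pair (j ξ) x ∈ a ∧ pair (j ζ) y ∈ a ∧ x ∈ y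
    rw [hfix ξ hξ, hfix ζ hζ]
    exact ⟨x, hDL hx, y, hDL hy, h1, h2, hxy⟩

end InnerModels


namespace InnerModels

open FirstOrder FirstOrder.Language ZFSet
open scoped Ordinal Cardinal
open SetFormula Filter

/-! ### The ultrapower of the universe by a system of ultrafilters -/

/-- A coherent system of `|I|⁺`-complete ultrafilters on `I → L`. -/
structure UltraSystem (I L D : Type*) where
  /-- The ultrafilter with index `a`. -/
  filter : (I → D) → Ultrafilter (I → L)
  iInter_mem : ∀ a (X : I → Set (I → L)), (∀ ξ, X ξ ∈ filter a) → ⋂ ξ, X ξ ∈ filter a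
  filter_comp : ∀ a (σ : I → I), filter (a ∘ σ) = (filter a).map (· ∘ σ)

namespace UltraSystem

variable {I L D : Type (u + 1)} (U : UltraSystem I L D)

lemma eventually_comp {a : I → D} {σ : I → I} {P : (I → L) → Prop} :
    (∀ᶠ s in U.filter (a ∘ σ), P s) ↔ ∀ᶠ s in U.filter a, P (s ∘ σ) := by
  rw [U.filter_comp]
  rfl

lemma eventually_forall {K : Type*} (hK : Nonempty (K ↪ I)) {a : I → D} {P : K → (I → L) → Prop} :
    (∀ᶠ s in U.filter a, ∀ k, P k s) ↔ ∀ k, ∀ᶠ s in U.filter a, P k s := by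
  obtain ⟨f⟩ := hK
  refine ⟨fun h k => h.mono fun s hs => hs k, fun h => ?_⟩
  have := U.iInter_mem a (fun i => {s | ∀ k, f k = i → P k s}) fun i => by
    by_cases hi : ∃ k, f k = i
    · obtain ⟨k, rfl⟩ := hi
      refine Filter.mem_of_superset (h k) fun s hs k' hk' => ?_
      rwa [f.injective hk']
    · exact Filter.mem_of_superset Filter.univ_mem fun s _ k hk => (hi ⟨k, hk⟩).elim
  refine Filter.mem_of_superset this fun s hs k => ?_
  exact Set.mem_iInter.1 hs (f k) k rfl

/-- The dual of completeness: a choice among at most `|I|` possibilities that varies with `s` is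
constant on a set of measure one. It will fix formulas, positions in enumerations and bounds. -/
lemma eventually_exists {K : Type*} (hK : Nonempty (K ↪ I)) {a : I → D} {P : K → (I → L) → Prop} :
    (∀ᶠ s in U.filter a, ∃ k, P k s) ↔ ∃ k, ∀ᶠ s in U.filter a, P k s := by
  rw [← not_iff_not, ← Ultrafilter.eventually_not]
  push Not
  rw [U.eventually_forall hK]

lemma eventually_imp {a : I → D} {P Q : (I → L) → Prop} :
    (∀ᶠ s in U.filter a, (P s → Q s)) ↔ ((∀ᶠ s in U.filter a, P s) → ∀ᶠ s in U.filter a, Q s) :=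
  Ultrafilter.eventually_imp

variable [Infinite I]

/-- Two index functions coded into one. -/
noncomputable def sumEquiv (I : Type*) [Infinite I] : I ⊕ I ≃ I :=
  Classical.choice (Cardinal.eq.1 (by simp [Cardinal.mk_sum, Cardinal.add_eq_self]))

/-- As `I × I` has the size of `I`, up to `|I|` many indices are reindexings of a single one. With
`filter_comp`, questions about many points become questions about one ultrafilter. -/
lemma exists_common {K : Type*} [Nonempty K] (hK : Nonempty (K ↪ I)) (a : K → I → D) :
    ∃ (c : I → D) (σ : K → I → I), ∀ k, c ∘ σ k = a k := by
  obtain ⟨f⟩ := hK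
  obtain ⟨e⟩ : Nonempty (I × I ≃ I) := Cardinal.eq.1 (by simp [Cardinal.mul_eq_self])
  refine ⟨fun i => a (Function.invFun f (e.symm i).1) (e.symm i).2, fun k ξ => e (f k, ξ),
    fun k => ?_⟩
  funext ξ
  simp [Function.leftInverse_invFun f.injective k]

lemma exists_common₂ (a b : I → D) : ∃ (c : I → D) (σ τ : I → I), c ∘ σ = a ∧ c ∘ τ = b := by
  let e := sumEquiv I
  refine ⟨Sum.elim a b ∘ e.symm, e ∘ Sum.inl, e ∘ Sum.inr, ?_, ?_⟩ <;> funext ξ <;> simp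

lemma exists_common' {K : Type*} (hK : Nonempty (K ↪ I)) (a : I → D) (b : K → I → D) :
    ∃ (c : I → D) (σ : I → I) (τ : K → I → I), c ∘ σ = a ∧ ∀ k, c ∘ τ k = b k := by
  cases isEmpty_or_nonempty K with
  | inl h => exact ⟨a, id, fun k => h.elim k, rfl, fun k => h.elim k⟩
  | inr h =>
    obtain ⟨c, τ, h1⟩ := exists_common hK b
    obtain ⟨c', σ, ρ, rfl, rfl⟩ := exists_common₂ a c
    exact ⟨c', σ, fun k => ρ ∘ τ k, rfl, h1⟩

lemma exists_common₃ (a b d : I → D) :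
    ∃ (c : I → D) (σ τ υ : I → I), c ∘ σ = a ∧ c ∘ τ = b ∧ c ∘ υ = d := by
  obtain ⟨c, σ, τ, rfl, rfl⟩ := exists_common₂ a b
  obtain ⟨c, ρ, υ, rfl, rfl⟩ := exists_common₂ c d
  exact ⟨c, ρ ∘ σ, ρ ∘ τ, υ, rfl, rfl, rfl⟩

/-- A point of the ultrapower is represented by a function and an index. -/
abbrev Point (I L D : Type (u + 1)) : Type (u + 1) := ((I → L) → ZFSet.{u}) × (I → D)

/-- A relation holds in the ultrapower between two points. -/
def Holds (R : ZFSet.{u} → ZFSet.{u} → Prop) (p q : Point I L D) : Prop :=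
  ∀ᶠ s in U.filter (Sum.elim p.2 q.2 ∘ (sumEquiv I).symm),
    R (p.1 (s ∘ sumEquiv I ∘ Sum.inl)) (q.1 (s ∘ sumEquiv I ∘ Sum.inr))

variable {U}

/-- `Holds` uses one particular joint index. It factors through any other common index `c`, so
coherence gives the same answer at `c`. -/
lemma holds_iff {R : ZFSet.{u} → ZFSet.{u} → Prop} {p q : Point I L D} {c : I → D} {σ τ : I → I}
    (hp : c ∘ σ = p.2) (hq : c ∘ τ = q.2) :
    U.Holds R p q ↔ ∀ᶠ s in U.filter c, R (p.1 (s ∘ σ)) (q.1 (s ∘ τ)) := by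
  have h : Sum.elim p.2 q.2 ∘ (sumEquiv I).symm = c ∘ (Sum.elim σ τ ∘ (sumEquiv I).symm) := by
    rw [← hp, ← hq, ← Sum.comp_elim, Function.comp_assoc]
  rw [Holds, h, eventually_comp]
  refine iff_of_eq ?_
  congr 1
  funext s
  have h1 : (s ∘ Sum.elim σ τ ∘ (sumEquiv I).symm) ∘ sumEquiv I ∘ Sum.inl = s ∘ σ := by
    funext ξ
    simp
  have h2 : (s ∘ Sum.elim σ τ ∘ (sumEquiv I).symm) ∘ sumEquiv I ∘ Sum.inr = s ∘ τ := by
    funext ξ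
    simp
  rw [h1, h2]

lemma holds_same {R : ZFSet.{u} → ZFSet.{u} → Prop} {f g : (I → L) → ZFSet.{u}} {a : I → D} :
    U.Holds R (f, a) (g, a) ↔ ∀ᶠ s in U.filter a, R (f s) (g s) :=
  holds_iff (σ := id) (τ := id) rfl rfl

/-- A descending sequence of points has a common index, and countable completeness yields one `s` at
which the values form a descending sequence of sets. -/
lemma wellFounded_holds (hI : Nonempty (ℕ ↪ I)) :
    WellFounded (U.Holds (· ∈ ·) : Point I L D → Point I L D → Prop) := by
  rw [wellFounded_iff_isEmpty_descending_chain]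
  refine ⟨fun ⟨p, hp⟩ => ?_⟩
  obtain ⟨c, σ, hc⟩ := exists_common hI fun n => (p n).2
  have h1 : ∀ᶠ s in U.filter c, ∀ n, (p (n + 1)).1 (s ∘ σ (n + 1)) ∈ (p n).1 (s ∘ σ n) :=
    (U.eventually_forall hI).2 fun n =>
      (holds_iff (p := p (n + 1)) (q := p n) (hc _) (hc _)).1 (hp n)
  obtain ⟨s, hs⟩ := h1.exists
  exact (wellFounded_iff_isEmpty_descending_chain.1 ZFSet.mem_wf).false
    ⟨fun n => (p n).1 (s ∘ σ n), hs⟩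

instance : IsWellFounded (Point I L D) (U.Holds (· ∈ ·)) :=
  ⟨wellFounded_holds ⟨Infinite.natEmbedding I⟩⟩

lemma holds_congr {R : ZFSet.{u} → ZFSet.{u} → Prop} {p q p' q' : Point I L D}
    (hp : U.Holds Eq p p') (hq : U.Holds Eq q q') : U.Holds R p q ↔ U.Holds R p' q' := by
  obtain ⟨c, σ, τ, υ, h1, h2, h3⟩ := exists_common₃ p.2 p'.2 q.2
  obtain ⟨c', ρ, σ', hc, h4⟩ := exists_common₂ c q'.2
  rw [← hc, Function.comp_assoc] at h1 h2 h3
  rw [holds_iff h1 h3, holds_iff h2 h4]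
  rw [holds_iff h1 h2] at hp
  rw [holds_iff h3 h4] at hq
  refine eventually_congr ?_
  filter_upwards [hp, hq] with s hs hs'
  rw [hs, hs']

lemma Holds.refl (p : Point I L D) : U.Holds Eq p p :=
  holds_same.2 (Eventually.of_forall fun _ => rfl)

/-! ### Set-likeness and the transitive collapse -/

variable [Small.{u} I] [Small.{u} L]

/-- The values that suffice to represent the elements of a point. -/
noncomputable def valueSet (q : Point I L D) : ZFSet.{u} := insert ∅ (⋃₀ (range q.1 : ZFSet.{u}))

/-- Values outside `valueSet q` occur only on a set of measure zero and may be reset to `∅`. This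
leaves only set many representatives for the elements of `q`, so that the collapse can be formed. -/
lemma exists_restricted {t q : Point I L D} (h : U.Holds (· ∈ ·) t q) :
    ∃ t' : Point I L D, (∀ s, t'.1 s ∈ valueSet q) ∧ U.Holds Eq t t' := by
  classical
  refine ⟨(fun s => if t.1 s ∈ valueSet q then t.1 s else ∅, t.2), fun s => ?_, ?_⟩
  · simp only
    split_ifs with h
    · exact h
    · simp [valueSet]
  · obtain ⟨c, σ, τ, h1, h2⟩ := exists_common₂ t.2 q.2
    rw [holds_iff h1 h2] at h
    rw [holds_iff (q := (fun s => if t.1 s ∈ valueSet q then t.1 s else ∅, t.2)) h1 h1]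
    refine h.mono fun s hs => ?_
    refine (if_pos ?_).symm
    exact ZFSet.mem_insert_iff.2 (Or.inr (ZFSet.mem_sUnion.2 ⟨_, ZFSet.mem_range_self _, hs⟩))

variable [Small.{u} D]

instance (q : Point I L D) (P : Point I L D → Prop) :
    Small.{u} {t : Point I L D // (∀ s, t.1 s ∈ valueSet q) ∧ P t} := by
  let F : {t : Point I L D // (∀ s, t.1 s ∈ valueSet q) ∧ P t} →
      ((I → L) → valueSet q) × (I → D) :=
    fun t => (fun s => ⟨t.1.1 s, t.2.1 s⟩, t.1.2)
  refine small_of_injective (f := F) fun t t' h => ?_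
  simp only [F, Prod.mk.injEq] at h
  refine Subtype.ext (Prod.ext ?_ h.2)
  funext s
  exact congrArg Subtype.val (congrFun h.1 s)

variable (U)

/-- The transitive collapse of the ultrapower. -/
noncomputable def collapse : Point I L D → ZFSet.{u} :=
  (IsWellFounded.wf (r := U.Holds (· ∈ ·))).fix fun q ih =>
    range fun t : {t : Point I L D // (∀ s, t.1 s ∈ valueSet q) ∧ U.Holds (· ∈ ·) t q} =>
      ih t.1 t.2.2

variable {U}

lemma mem_collapse_iff_restricted {q : Point I L D} {y : ZFSet.{u}} : y ∈ U.collapse q ↔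
    ∃ t : Point I L D, (∀ s, t.1 s ∈ valueSet q) ∧ U.Holds (· ∈ ·) t q ∧ U.collapse t = y := by
  rw [collapse, WellFounded.fix_eq, ZFSet.mem_range]
  simp only [Subtype.exists, exists_prop, and_assoc]

lemma collapse_congr {p q : Point I L D} (h : U.Holds Eq p q) : U.collapse p = U.collapse q := by
  induction p using (IsWellFounded.wf (r := U.Holds (· ∈ ·))).induction generalizing q with
  | _ p ih =>
    ext y
    rw [mem_collapse_iff_restricted, mem_collapse_iff_restricted]
    constructor
    · rintro ⟨t, -, ht, rfl⟩
      have htq := (holds_congr (Holds.refl t) h).1 ht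
      obtain ⟨t', h1, h2⟩ := exists_restricted htq
      exact ⟨t', h1, (holds_congr h2 (Holds.refl q)).1 htq, (ih t ht h2).symm⟩
    · rintro ⟨t, -, ht, rfl⟩
      have htp := (holds_congr (Holds.refl t) h).2 ht
      obtain ⟨t', h1, h2⟩ := exists_restricted htp
      exact ⟨t', h1, (holds_congr h2 (Holds.refl p)).1 htp, (ih t htp h2).symm⟩

lemma mem_collapse {q : Point I L D} {y : ZFSet.{u}} :
    y ∈ U.collapse q ↔ ∃ t : Point I L D, U.Holds (· ∈ ·) t q ∧ U.collapse t = y := by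
  rw [mem_collapse_iff_restricted]
  constructor
  · rintro ⟨t, -, h⟩
    exact ⟨t, h⟩
  · rintro ⟨t, h, rfl⟩
    obtain ⟨t', h1, h2⟩ := exists_restricted h
    exact ⟨t', h1, (holds_congr h2 (Holds.refl q)).1 h, (collapse_congr h2).symm⟩

/-- If `p` and `q` differ almost everywhere, one of the two inclusions fails almost everywhere.
Choosing elements of the difference gives a member of one point but not of the other, and the
induction hypothesis shows that the collapses differ as well. -/
lemma collapse_eq_iff {p q : Point I L D} : U.collapse p = U.collapse q ↔ U.Holds Eq p q := by
  refine ⟨fun h => ?_, collapse_congr⟩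
  induction p using (IsWellFounded.wf (r := U.Holds (· ∈ ·))).induction generalizing q with
  | _ p ih =>
    obtain ⟨c, σ, τ, h1, h2⟩ := exists_common₂ p.2 q.2
    by_contra hne
    rw [holds_iff h1 h2, ← Ultrafilter.eventually_not] at hne
    have hex : ∀ᶠ s in U.filter c, (∃ z, z ∈ p.1 (s ∘ σ) ∧ z ∉ q.1 (s ∘ τ)) ∨
        ∃ z, z ∈ q.1 (s ∘ τ) ∧ z ∉ p.1 (s ∘ σ) := by
      refine hne.mono fun s hs => ?_
      by_contra hcon
      push Not at hcon
      exact hs (ZFSet.ext fun z => ⟨hcon.1 z, hcon.2 z⟩)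
    rcases Ultrafilter.eventually_or.1 hex with hex | hex
    · choose! g hg using fun (s : I → L)
        (hs : ∃ z, z ∈ p.1 (s ∘ σ) ∧ z ∉ q.1 (s ∘ τ)) => hs
      let t : Point I L D := (g, c)
      have htp : U.Holds (· ∈ ·) t p := (holds_iff (c := c) (σ := id) rfl h1).2
        (hex.mono fun s hs => (hg s hs).1)
      have htq : ¬ U.Holds (· ∈ ·) t q := by
        rw [holds_iff (c := c) (σ := id) rfl h2, ← Ultrafilter.eventually_not]
        exact hex.mono fun s hs => (hg s hs).2
      obtain ⟨t', ht', h3⟩ := mem_collapse.1 (h ▸ mem_collapse.2 ⟨t, htp, rfl⟩)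
      exact htq ((holds_congr (ih t htp h3.symm) (Holds.refl q)).2 ht')
    · choose! g hg using fun (s : I → L)
        (hs : ∃ z, z ∈ q.1 (s ∘ τ) ∧ z ∉ p.1 (s ∘ σ)) => hs
      let t : Point I L D := (g, c)
      have htq : U.Holds (· ∈ ·) t q := (holds_iff (c := c) (σ := id) rfl h2).2
        (hex.mono fun s hs => (hg s hs).1)
      have htp : ¬ U.Holds (· ∈ ·) t p := by
        rw [holds_iff (c := c) (σ := id) rfl h1, ← Ultrafilter.eventually_not]
        exact hex.mono fun s hs => (hg s hs).2
      obtain ⟨t', ht', h3⟩ := mem_collapse.1 (h.symm ▸ mem_collapse.2 ⟨t, htq, rfl⟩)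
      exact htp ((holds_congr (ih t' ht' h3) (Holds.refl p)).1 ht')

lemma collapse_mem_iff {p q : Point I L D} :
    U.collapse p ∈ U.collapse q ↔ U.Holds (· ∈ ·) p q := by
  rw [mem_collapse]
  constructor
  · rintro ⟨t, h, h'⟩
    exact (holds_congr (collapse_eq_iff.1 h') (Holds.refl q)).1 h
  · exact fun h => ⟨p, h, rfl⟩

lemma collapse_comp (f : (I → L) → ZFSet.{u}) (c : I → D) (σ : I → I) :
    U.collapse (f, c ∘ σ) = U.collapse (fun s => f (s ∘ σ), c) :=
  collapse_congr ((holds_iff (c := c) (σ := σ) (τ := id) rfl rfl).2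
    (Eventually.of_forall fun _ => rfl))

/-- Łoś's theorem for families of set-sized structures. -/
theorem sat_collapse (φ : SetFormula) (A : (I → L) → ZFSet.{u}) (F : ℕ → (I → L) → ZFSet.{u})
    (a : I → D) :
    Sat (U.collapse (A, a) : Set ZFSet.{u}) φ (fun k => U.collapse (F k, a)) ↔
      ∀ᶠ s in U.filter a, Sat (A s : Set ZFSet.{u}) φ fun k => F k s := by
  induction φ generalizing A F a with
  | mem i j => simp only [Sat, collapse_mem_iff, holds_same]
  | eq i j => simp only [Sat, collapse_eq_iff, holds_same]
  | fls => simp only [Sat, Filter.eventually_false_iff_eq_bot, (U.filter a).neBot.ne]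
  | imp φ ψ h1 h2 => simp only [Sat, h1, h2, U.eventually_imp]
  | all φ ih =>
    constructor
    · intro H
      by_contra hcon
      rw [← Ultrafilter.eventually_not] at hcon
      simp only [Sat, not_forall] at hcon
      -- A function choosing counterexamples represents an element of the ultrapower at the same
      -- index.
      choose! g hg hg' using fun (s : I → L)
        (hs : ∃ x, ∃ (_ : x ∈ (A s : Set ZFSet.{u})),
          ¬ Sat (A s : Set ZFSet.{u}) φ (vcons x fun k => F k s)) => hs
      have h1 := H (U.collapse (g, a)) (collapse_mem_iff.2 (holds_same.2 (hcon.mono hg)))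
      rw [← comp_vcons (fun f => U.collapse (f, a)), ih] at h1
      obtain ⟨s, hs, hs'⟩ := (h1.and hcon).exists
      rw [comp_vcons (fun f : (I → L) → ZFSet.{u} => f s)] at hs
      exact hg' s hs' hs
    · intro H x hx
      obtain ⟨⟨g, b⟩, h, rfl⟩ := mem_collapse.1 hx
      -- An element of the collapse may come with another index than the parameters.
      obtain ⟨c, σ, τ, rfl, rfl⟩ := exists_common₂ a b
      rw [holds_iff (c := c) (σ := τ) (τ := σ) rfl rfl] at h
      simp only [collapse_comp]
      rw [← comp_vcons (fun f => U.collapse (f, c)), ih]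
      rw [eventually_comp] at H
      filter_upwards [h, H] with s hs hs'
      rw [comp_vcons (fun f : (I → L) → ZFSet.{u} => f s)]
      exact hs' _ hs

end UltraSystem

end InnerModels


namespace InnerModels

open FirstOrder FirstOrder.Language ZFSet
open scoped Ordinal Cardinal
open SetFormula Filter

lemma mem_omegaOneChangStage {β : Ordinal.{u}} {y : ZFSet.{u}} : y ∈ omegaOneChangStage β ↔
    (∃ γ < β, y ∈ defPow (omegaOneChangStage γ)) ∨
      (Order.IsSuccLimit β ∧ y ⊆ β.toZFSet ∧ y.card ≤ ℵ₁) := by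
  rw [omegaOneChangStage]
  simp only [mem_union, mem_iUnion, Subtype.exists, Set.mem_Iio, exists_prop]
  refine or_congr Iff.rfl ?_
  split_ifs with h
  · simp [h]
  · simp [h]

lemma isSuccLimit_iff_forall_exists {β : Ordinal.{u}} :
    Order.IsSuccLimit β ↔ β ≠ 0 ∧ ∀ γ < β, ∃ δ < β, γ < δ := by
  constructor
  · intro h
    exact ⟨h.ne_bot, fun γ hγ => ⟨_, h.succ_lt hγ, Order.lt_succ γ⟩⟩
  · rintro ⟨h0, h⟩
    refine ⟨by simpa using h0, fun γ hγ => ?_⟩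
    obtain ⟨δ, h1, h2⟩ := h γ hγ.lt
    exact hγ.2 h2 h1

namespace UltraSystem

variable {I L D : Type (u + 1)} {U : UltraSystem I L D} [Infinite I]
  [Small.{u} I] [Small.{u} L] [Small.{u} D]

/-- An element may need an index `c` that refines `a` along `σ`, so `A` is read at `s ∘ σ`. In this
form larger indices enter all the arguments below. -/
lemma mem_collapse_iff_exists {A : (I → L) → ZFSet.{u}} {a : I → D} {y : ZFSet.{u}} :
    y ∈ U.collapse (A, a) ↔ ∃ (c : I → D) (σ : I → I) (f : (I → L) → ZFSet.{u}), c ∘ σ = a ∧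
      (∀ᶠ s in U.filter c, f s ∈ A (s ∘ σ)) ∧ U.collapse (f, c) = y := by
  rw [mem_collapse]
  constructor
  · rintro ⟨⟨f, b⟩, h, rfl⟩
    obtain ⟨c, σ, τ, rfl, rfl⟩ := exists_common₂ a b
    rw [holds_iff (c := c) (σ := τ) (τ := σ) rfl rfl] at h
    exact ⟨c, σ, _, rfl, h, (collapse_comp _ _ _).symm⟩
  · rintro ⟨c, σ, f, rfl, h, rfl⟩
    exact ⟨(f, c), (holds_iff (c := c) (σ := id) (τ := σ) rfl rfl).2 h, rfl⟩

lemma collapse_mem_iff_same {f g : (I → L) → ZFSet.{u}} {a : I → D} :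
    U.collapse (f, a) ∈ U.collapse (g, a) ↔ ∀ᶠ s in U.filter a, f s ∈ g s :=
  collapse_mem_iff.trans holds_same

lemma collapse_eq_iff_same {f g : (I → L) → ZFSet.{u}} {a : I → D} :
    U.collapse (f, a) = U.collapse (g, a) ↔ ∀ᶠ s in U.filter a, f s = g s :=
  collapse_eq_iff.trans holds_same

lemma collapse_subset {f g : (I → L) → ZFSet.{u}} {a : I → D}
    (h : ∀ᶠ s in U.filter a, f s ⊆ g s) : U.collapse (f, a) ⊆ U.collapse (g, a) := by
  intro y hy
  obtain ⟨c, σ, t, rfl, ht, rfl⟩ := mem_collapse_iff_exists.1 hy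
  rw [eventually_comp] at h
  refine mem_collapse_iff_exists.2 ⟨c, σ, t, rfl, ?_, rfl⟩
  filter_upwards [h, ht] with s hs hs' using hs hs'

/-! ### Ordinals in the ultrapower -/

lemma mem_collapse_ordinal {h : (I → L) → Ordinal.{u}} {a : I → D} {y : ZFSet.{u}}
    (hy : y ∈ U.collapse (fun s => (h s).toZFSet, a)) :
    ∃ (c : I → D) (σ : I → I) (g : (I → L) → Ordinal.{u}), c ∘ σ = a ∧
      (∀ᶠ s in U.filter c, g s < h (s ∘ σ)) ∧ U.collapse (fun s => (g s).toZFSet, c) = y := by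
  obtain ⟨c, σ, f, rfl, hf, rfl⟩ := mem_collapse_iff_exists.1 hy
  -- `rank` recovers the ordinal almost everywhere; its value elsewhere is irrelevant.
  have hg : ∀ᶠ s in U.filter c, (f s).rank < h (s ∘ σ) ∧ f s = (f s).rank.toZFSet := by
    refine hf.mono fun s hs => ?_
    obtain ⟨α, hα, h'⟩ := Ordinal.mem_toZFSet_iff.1 hs
    rw [← h', Ordinal.rank_toZFSet]
    exact ⟨hα, rfl⟩
  exact ⟨c, σ, fun s => (f s).rank, rfl, hg.mono fun s hs => hs.1,
    collapse_eq_iff_same.2 (hg.mono fun s hs => hs.2.symm)⟩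

lemma isTransitive_collapse_ordinal (h : (I → L) → Ordinal.{u}) (a : I → D) :
    (U.collapse (fun s => (h s).toZFSet, a)).IsTransitive := by
  intro y hy z hz
  obtain ⟨c, σ, g, rfl, hg, rfl⟩ := mem_collapse_ordinal hy
  rw [collapse_comp]
  refine collapse_subset (hg.mono fun s hs => ?_) hz
  exact Ordinal.toZFSet_subset_toZFSet_iff.2 hs.le

lemma isOrdinal_collapse (h : (I → L) → Ordinal.{u}) (a : I → D) :
    (U.collapse (fun s => (h s).toZFSet, a)).IsOrdinal := by
  rw [isOrdinal_iff_forall_mem_isTransitive]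
  refine ⟨isTransitive_collapse_ordinal h a, fun y hy => ?_⟩
  obtain ⟨c, σ, g, rfl, hg, rfl⟩ := mem_collapse_ordinal hy
  exact isTransitive_collapse_ordinal g c

/-- Being nonempty without a largest element is a first-order property of `(β, ∈)`, so Łoś's theorem
applies. -/
lemma isSuccLimit_collapse_iff {h : (I → L) → Ordinal.{u}} {a : I → D} {o : Ordinal.{u}}
    (ho : U.collapse (fun s => (h s).toZFSet, a) = o.toZFSet) :
    Order.IsSuccLimit o ↔ ∀ᶠ s in U.filter a, Order.IsSuccLimit (h s) := by
  have key : ∀ (β : Ordinal.{u}) (v : ℕ → ZFSet.{u}), Order.IsSuccLimit β ↔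
      ¬ Sat (β.toZFSet : Set ZFSet.{u}) (.imp (.imp (.all .fls) .fls)
        (.imp (.all (.imp (.all (.imp (.mem 1 0) .fls)) .fls)) .fls)) v := by
    intro β v
    have h1 : ∀ P : ZFSet.{u} → Prop, (∀ x ∈ (β.toZFSet : Set ZFSet.{u}), P x) ↔
        ∀ γ < β, P γ.toZFSet := by
      intro P
      constructor
      · exact fun H γ hγ => H _ (Ordinal.toZFSet_mem_toZFSet_iff.2 hγ)
      · intro H x hx
        obtain ⟨γ, hγ, rfl⟩ := Ordinal.mem_toZFSet_iff.1 hx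
        exact H γ hγ
    have h2 : ∀ (x y : ZFSet.{u}), vcons y (vcons x v) 1 = x := fun _ _ => rfl
    simp only [Sat, h1, h2, vcons_zero, Ordinal.toZFSet_mem_toZFSet_iff,
      isSuccLimit_iff_forall_exists]
    have h3 : β ≠ 0 ↔ ¬ ∀ γ < β, False := by
      rw [← pos_iff_ne_zero]
      push Not
      exact ⟨fun h => ⟨0, h, trivial⟩, fun ⟨γ, h, _⟩ => bot_lt_of_lt h⟩
    rw [h3]
    push Not
    simp
  rw [key o fun _ => U.collapse (fun _ => ∅, a), ← ho]
  have := sat_collapse (U := U) (.imp (.imp (.all .fls) .fls)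
        (.imp (.all (.imp (.all (.imp (.mem 1 0) .fls)) .fls)) .fls)) (fun s => (h s).toZFSet)
        (fun _ _ => ∅) a
  rw [this, ← Ultrafilter.eventually_not]
  refine eventually_congr (Eventually.of_forall fun s => ?_)
  rw [key (h s)]

/-! ### Definable subsets in the ultrapower -/

/-- The defining formula may vary with `s`, but there are only countably many formulas, so
completeness fixes one almost everywhere. Parameters are chosen pointwise, and Łoś's theorem
evaluates the definition. -/
lemma collapse_mem_defPow {A f : (I → L) → ZFSet.{u}} {a : I → D}
    (h : ∀ᶠ s in U.filter a, f s ∈ defPow (A s)) : U.collapse (f, a) ∈ defPow (U.collapse (A, a)) := by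
  have hF : Nonempty (SetFormula ↪ I) := by
    obtain ⟨e, he⟩ := exists_injective_nat SetFormula
    exact ⟨(⟨e, he⟩ : SetFormula ↪ ℕ).trans (Infinite.natEmbedding I)⟩
  have h1 : ∀ᶠ s in U.filter a, ∃ φ : SetFormula, f s ⊆ A s ∧ ∃ p : ℕ → ZFSet.{u},
      (∀ x ∈ A s, ∀ k, p k ∈ A s) ∧
        ∀ x ∈ A s, (x ∈ f s ↔ Sat (A s : Set ZFSet.{u}) φ (vcons x p)) := by
    refine h.mono fun s hs => ?_
    obtain ⟨h1, φ, h2⟩ := mem_defPow.1 hs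
    exact ⟨φ, h1, h2⟩
  obtain ⟨φ, h1⟩ := (U.eventually_exists hF).1 h1
  refine mem_defPow.2 ⟨collapse_subset (h1.mono fun s hs => hs.1), φ, ?_⟩
  have h2 := h1.mono fun s hs => hs.2
  choose! p hp using fun (s : I → L) (hs : ∃ p : ℕ → ZFSet.{u}, (∀ x ∈ A s, ∀ k, p k ∈ A s) ∧
        ∀ x ∈ A s, (x ∈ f s ↔ Sat (A s : Set ZFSet.{u}) φ (vcons x p))) => hs
  refine ⟨fun k => U.collapse (fun s => p s k, a), fun x hx k => ?_, fun x hx => ?_⟩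
  · obtain ⟨c, σ, g, rfl, hg, rfl⟩ := mem_collapse_iff_exists.1 hx
    rw [eventually_comp] at h2
    simp only [collapse_comp]
    rw [collapse_mem_iff_same]
    filter_upwards [h2, hg] with s hs hs'
    exact (hp _ hs).1 _ hs' k
  · obtain ⟨c, σ, g, rfl, hg, rfl⟩ := mem_collapse_iff_exists.1 hx
    rw [eventually_comp] at h2
    simp only [collapse_comp]
    rw [collapse_mem_iff_same, ← comp_vcons (fun f => U.collapse (f, c)) g
      (fun k s => p (s ∘ σ) k), sat_collapse]
    refine eventually_congr ?_
    filter_upwards [h2, hg] with s hs hs'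
    rw [comp_vcons (fun f : (I → L) → ZFSet.{u} => f s)]
    exact (hp _ hs).2 _ hs'

/-- Countably many parameters have representatives over a common index; the same formula evaluated
at each `s` then represents `y`. -/
lemma exists_of_mem_defPow_collapse {A : (I → L) → ZFSet.{u}} {a : I → D} {y : ZFSet.{u}}
    (hy : y ∈ defPow (U.collapse (A, a))) :
    ∃ (c : I → D) (σ : I → I) (f : (I → L) → ZFSet.{u}), c ∘ σ = a ∧
      (∀ᶠ s in U.filter c, f s ∈ defPow (A (s ∘ σ))) ∧ U.collapse (f, c) = y := by
  obtain ⟨hyA, φ, p, hp, h⟩ := mem_defPow.1 hy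
  obtain ⟨c, σ, q, rfl, hq, hpq⟩ : ∃ (c : I → D) (σ : I → I) (q : ℕ → (I → L) → ZFSet.{u}), c ∘ σ = a ∧
      (∀ᶠ s in U.filter c, ∀ x ∈ A (s ∘ σ), ∀ k, q k s ∈ A (s ∘ σ)) ∧
      ((∃ x, x ∈ U.collapse (A, a)) → ∀ k, U.collapse (q k, c) = p k) := by
    by_cases hne : ∃ x, x ∈ U.collapse (A, a)
    · obtain ⟨x, hx⟩ := hne
      choose t ht htp using fun k => mem_collapse.1 (hp x hx k)
      obtain ⟨c, σ, τ, rfl, hτ⟩ := exists_common' ⟨Infinite.natEmbedding I⟩ a fun k => (t k).2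
      refine ⟨c, σ, fun k s => (t k).1 (s ∘ τ k), rfl, ?_, fun _ k => ?_⟩
      · have := (U.eventually_forall ⟨Infinite.natEmbedding I⟩).2 fun k =>
          (holds_iff (p := t k) (q := (A, c ∘ σ)) (hτ k) rfl).1 (ht k)
        exact this.mono fun s hs _ _ k => hs k
      · rw [← collapse_comp, hτ k, ← htp k]
    -- If the collapse is empty, then almost every `A s` is empty, since a choice of elements would
    -- represent a member; the parameters are then immaterial.
    · refine ⟨a, id, fun _ _ => ∅, rfl, ?_, fun h => (hne h).elim⟩
      by_contra hcon
      rw [← Ultrafilter.eventually_not] at hcon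
      have hcon' : ∀ᶠ s in U.filter a, ∃ x, x ∈ A s := hcon.mono fun s hs => by
        by_contra hs'
        exact hs fun x hx => (hs' ⟨x, hx⟩).elim
      choose! g hg using fun (s : I → L) (hs : ∃ x, x ∈ A s) => hs
      exact hne ⟨_, collapse_mem_iff_same.2 (hcon'.mono hg)⟩
  refine ⟨c, σ, fun s => (A (s ∘ σ)).sep fun x => Sat (A (s ∘ σ) : Set ZFSet.{u}) φ
    (vcons x fun k => q k s), rfl, ?_, ?_⟩
  · refine hq.mono fun s hs => mem_defPow.2 ⟨sep_subset, φ, fun k => q k s, hs, fun x hx => ?_⟩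
    rw [mem_sep, and_iff_right hx]
  · ext x
    by_cases hx : x ∈ U.collapse (A, c ∘ σ)
    · have hpq := hpq ⟨x, hx⟩
      rw [h x hx]
      rw [collapse_comp] at hx ⊢
      obtain ⟨c', ρ, g, rfl, hg, rfl⟩ := mem_collapse_iff_exists.1 hx
      rw [show p = fun k => U.collapse (q k, c' ∘ ρ) from funext fun k => (hpq k).symm]
      simp only [collapse_comp]
      rw [collapse_mem_iff_same, ← comp_vcons (fun f => U.collapse (f, c')) g
        (fun k s => q k (s ∘ ρ)), sat_collapse]
      refine eventually_congr ?_
      filter_upwards [hg] with s hs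
      rw [comp_vcons (fun f : (I → L) → ZFSet.{u} => f s), mem_sep, and_iff_right hs]
    · refine iff_of_false (fun hx' => hx ?_) fun hx' => hx (hyA hx')
      rw [collapse_comp]
      exact collapse_subset (Eventually.of_forall fun s => sep_subset) hx'

/-! ### Small subsets in the ultrapower -/

/-- Enumerate almost every `f s` by a type of size `ℵ₁`. A selector from the `f s` follows one fixed
position of these enumerations almost everywhere, so the positions exhaust the collapse. -/
lemma card_collapse_le (hI : Nonempty ((ℵ₁ : Cardinal.{u}).out ↪ I)) {f : (I → L) → ZFSet.{u}}
    {a : I → D} (h : ∀ᶠ s in U.filter a, (f s).card ≤ ℵ₁) : (U.collapse (f, a)).card ≤ ℵ₁ := by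
  have hex : ∀ s : I → L, (f s).card ≤ ℵ₁ → ∃ F : (ℵ₁ : Cardinal.{u}).out → ZFSet.{u},
      ∀ x ∈ f s, ∃ k, F k = x := by
    classical
    intro s hs
    rw [ZFSet.card, ← Cardinal.mk_out ℵ₁] at hs
    obtain ⟨e⟩ := hs
    refine ⟨fun k => if h : ∃ x, e x = k then ((equivShrink (f s)).symm h.choose : ZFSet.{u})
      else ∅, fun x hx => ⟨e (equivShrink _ ⟨x, hx⟩), ?_⟩⟩
    have h : ∃ y, e y = e (equivShrink _ ⟨x, hx⟩) := ⟨_, rfl⟩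
    refine (dif_pos h).trans ?_
    rw [e.injective h.choose_spec]
    simp
  choose! F hF using hex
  have hsub : U.collapse (f, a) ⊆ range fun k => U.collapse (fun s => F s k, a) := by
    intro y hy
    obtain ⟨c, σ, g, rfl, hg, rfl⟩ := mem_collapse_iff_exists.1 hy
    rw [eventually_comp] at h
    have h1 : ∀ᶠ s in U.filter c, ∃ k, F (s ∘ σ) k = g s := by
      filter_upwards [h, hg] with s hs hs' using hF _ hs _ hs'
    obtain ⟨k, hk⟩ := (U.eventually_exists hI).1 h1
    refine mem_range.2 ⟨k, ?_⟩
    rw [collapse_comp]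
    exact collapse_eq_iff_same.2 hk
  refine (card_mono hsub).trans ?_
  have := lift_card_range_le (f := fun k => U.collapse (fun s => F s k, a))
  simpa using this

/-- Representatives of all elements of `y` share an index, because an index absorbs `ℵ₁` many
others; the set of their values at `s` then represents `y`. -/
lemma exists_of_subset_collapse (hI : Nonempty ((ℵ₁ : Cardinal.{u}).out ↪ I))
    {A : (I → L) → ZFSet.{u}} {a : I → D} {y : ZFSet.{u}} (hy : y ⊆ U.collapse (A, a))
    (hc : y.card ≤ ℵ₁) :
    ∃ (c : I → D) (σ : I → I) (f : (I → L) → ZFSet.{u}), c ∘ σ = a ∧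
      (∀ᶠ s in U.filter c, f s ⊆ A (s ∘ σ) ∧ (f s).card ≤ ℵ₁) ∧ U.collapse (f, c) = y := by
  have hK : Nonempty (Shrink.{u} y ↪ I) := by
    rw [ZFSet.card, ← Cardinal.mk_out ℵ₁] at hc
    obtain ⟨e⟩ := hc
    obtain ⟨e'⟩ := hI
    exact ⟨e.trans e'⟩
  choose t ht hty using fun k : Shrink.{u} y => mem_collapse.1 (hy ((equivShrink y).symm k).2)
  obtain ⟨c, σ, τ, rfl, hτ⟩ := exists_common' hK a fun k => (t k).2
  refine ⟨c, σ, fun s => range fun k : Shrink.{u} y => (t k).1 (s ∘ τ k), rfl, ?_, ?_⟩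
  · have := (U.eventually_forall hK).2 fun k =>
      (holds_iff (p := t k) (q := (A, c ∘ σ)) (hτ k) rfl).1 (ht k)
    refine this.mono fun s hs => ⟨fun x hx => ?_, ?_⟩
    · obtain ⟨k, rfl⟩ := mem_range.1 hx
      exact hs k
    · refine le_trans ?_ hc
      have := lift_card_range_le (f := fun k : Shrink.{u} y => (t k).1 (s ∘ τ k))
      simpa [ZFSet.card] using this
  · have hk : ∀ k, U.collapse (fun s => (t k).1 (s ∘ τ k), c) = ((equivShrink y).symm k : ZFSet.{u}) := by
      intro k
      rw [← hty k, ← collapse_comp, hτ k]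
    ext x
    constructor
    · intro hx
      obtain ⟨c', ρ, g, rfl, hg, rfl⟩ := mem_collapse_iff_exists.1 hx
      simp only [mem_range] at hg
      obtain ⟨k, hg⟩ := (U.eventually_exists hK).1 hg
      rw [← collapse_eq_iff_same, ← collapse_comp (fun s => (t k).1 (s ∘ τ k)), hk k] at hg
      rw [← hg]
      exact ((equivShrink y).symm k).2
    · intro hx
      have := hk (equivShrink y ⟨x, hx⟩)
      rw [Equiv.symm_apply_apply] at this
      change _ = x at this
      rw [← this, collapse_mem_iff_same]
      exact Eventually.of_forall fun s => mem_range_self _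

/-! ### The stages of the Chang model in the ultrapower -/

/-- Both ways of forming a stage commute with the ultrapower: definable power sets by Łoś's theorem,
small subsets of limits by completeness and closure. The function `h` is arbitrary because ordinals
below `o` are in general represented by nonconstant functions. -/
theorem collapse_omegaOneChangStage (hI : Nonempty ((ℵ₁ : Cardinal.{u}).out ↪ I)) (o : Ordinal.{u})
    (h : (I → L) → Ordinal.{u}) (a : I → D)
    (ho : U.collapse (fun s => (h s).toZFSet, a) = o.toZFSet) :
    U.collapse (fun s => omegaOneChangStage (h s), a) = omegaOneChangStage o := by
  induction o using WellFoundedLT.induction generalizing h a with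
  | _ o ih =>
    ext y
    constructor
    · intro hy
      obtain ⟨c, σ, f, rfl, hf, rfl⟩ := mem_collapse_iff_exists.1 hy
      rw [collapse_comp] at ho
      simp only [mem_omegaOneChangStage] at hf
      rw [mem_omegaOneChangStage]
      rcases Ultrafilter.eventually_or.1 hf with hf | hf
      · left
        choose! g hg using fun (s : I → L) (hs : ∃ γ < h (s ∘ σ),
          f s ∈ defPow (omegaOneChangStage γ)) => hs
        have h1 : U.collapse (fun s => (g s).toZFSet, c) ∈ o.toZFSet := by
          rw [← ho, collapse_mem_iff_same]
          exact hf.mono fun s hs => Ordinal.toZFSet_mem_toZFSet_iff.2 (hg s hs).1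
        obtain ⟨γ, hγ, h2⟩ := Ordinal.mem_toZFSet_iff.1 h1
        refine ⟨γ, hγ, ?_⟩
        rw [← ih γ hγ g c h2.symm]
        exact collapse_mem_defPow (hf.mono fun s hs => (hg s hs).2)
      · right
        refine ⟨(isSuccLimit_collapse_iff ho).2 (hf.mono fun s hs => hs.1), ?_,
          card_collapse_le hI (hf.mono fun s hs => hs.2.2)⟩
        rw [← ho]
        exact collapse_subset (hf.mono fun s hs => hs.2.1)
    · intro hy
      rcases mem_omegaOneChangStage.1 hy with ⟨γ, hγ, hy⟩ | ⟨hlim, hsub, hcard⟩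
      · have h1 := Ordinal.toZFSet_mem_toZFSet_iff.2 hγ
        rw [← ho] at h1
        obtain ⟨c, σ, g, rfl, hg, h2⟩ := mem_collapse_ordinal h1
        rw [← ih γ hγ g c h2] at hy
        obtain ⟨c, ρ, f, rfl, hf, rfl⟩ := exists_of_mem_defPow_collapse hy
        rw [eventually_comp] at hg
        refine mem_collapse_iff_exists.2 ⟨c, ρ ∘ σ, f, rfl, ?_, rfl⟩
        filter_upwards [hg, hf] with s hs hs'
        exact mem_omegaOneChangStage.2 (Or.inl ⟨_, hs, hs'⟩)
      · rw [isSuccLimit_collapse_iff ho] at hlim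
        rw [← ho] at hsub
        obtain ⟨c, σ, f, rfl, hf, rfl⟩ := exists_of_subset_collapse hI hsub hcard
        rw [eventually_comp] at hlim
        refine mem_collapse_iff_exists.2 ⟨c, σ, f, rfl, ?_, rfl⟩
        filter_upwards [hlim, hf] with s hs hs'
        exact mem_omegaOneChangStage.2 (Or.inr ⟨hs, hs'⟩)

end UltraSystem

end InnerModels


namespace InnerModels

open FirstOrder FirstOrder.Language ZFSet
open scoped Ordinal Cardinal
open SetFormula Filter

/-! ### Reflection in the Chang model -/

/-- The union of the stages of the Chang model below `η`. -/
noncomputable def changBelow (η : Ordinal.{u}) : ZFSet.{u} :=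
  ⋃ β : Set.Iio η, omegaOneChangStage (β : Ordinal.{u})

lemma mem_changBelow {η : Ordinal.{u}} {x : ZFSet.{u}} :
    x ∈ changBelow η ↔ ∃ β < η, x ∈ omegaOneChangStage β := by
  simp [changBelow]

lemma changBelow_mono {η η' : Ordinal.{u}} (h : η ≤ η') : changBelow η ⊆ changBelow η' := by
  intro x hx
  obtain ⟨β, hβ, hx⟩ := mem_changBelow.1 hx
  exact mem_changBelow.2 ⟨β, hβ.trans_le h, hx⟩

/-- Formulas together with valuations in `changBelow α` form a small type, so stages chosen for the
witnesses have a supremum. -/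
lemma exists_witness_bound (α : Ordinal.{u}) : ∃ β : Ordinal.{u}, α ≤ β ∧
    ∀ (φ : SetFormula) (v : ℕ → ZFSet.{u}), (∀ n, v n ∈ changBelow α) →
      (∃ x ∈ omegaOneChang, ¬ Sat omegaOneChang φ (vcons x v)) →
      ∃ x ∈ changBelow β, ¬ Sat omegaOneChang φ (vcons x v) := by
  let ι := SetFormula × (ℕ → changBelow α)
  have hw : ∀ i : ι, ∃ β : Ordinal.{u},
      (∃ x ∈ omegaOneChang, ¬ Sat omegaOneChang i.1 (vcons x fun n => i.2 n)) →
      ∃ x ∈ omegaOneChangStage β, ¬ Sat omegaOneChang i.1 (vcons x fun n => i.2 n) := by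
    intro i
    by_cases h : ∃ x ∈ omegaOneChang, ¬ Sat omegaOneChang i.1 (vcons x fun n => i.2 n)
    · obtain ⟨x, ⟨β, hβ⟩, hx⟩ := h
      exact ⟨β, fun _ => ⟨x, hβ, hx⟩⟩
    · exact ⟨0, fun h' => (h h').elim⟩
  choose f hf using hw
  have : Small.{u} ι := inferInstance
  refine ⟨max α (Order.succ (⨆ i, f i)), le_max_left _ _, fun φ v hv h => ?_⟩
  obtain ⟨x, hx, hx'⟩ := hf (φ, fun n => ⟨v n, hv n⟩) h
  refine ⟨x, mem_changBelow.2 ⟨_, lt_max_of_lt_right (Order.lt_succ_of_le ?_), hx⟩, hx'⟩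
  exact Ordinal.le_iSup f _

/-- Every function on the ordinals has a closure point of countable cofinality at which the Chang
model is reflected. -/
theorem exists_reflecting (f : Ordinal.{u} → Ordinal.{u}) (α : Ordinal.{u}) :
    ∃ e : ℕ → Ordinal.{u}, α ≤ e 0 ∧ (∀ n, f (e n) ≤ e (n + 1)) ∧
      ∀ (φ : SetFormula) (v : ℕ → ZFSet.{u}), (∀ n, v n ∈ changBelow (⨆ n, e n)) →
        (Sat (changBelow (⨆ n, e n) : Set ZFSet.{u}) φ v ↔ Sat omegaOneChang φ v) := by
  choose g hg hg' using exists_witness_bound.{u}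
  -- Each step absorbs the witnesses for the previous one and the value of `f` there.
  let e : ℕ → Ordinal.{u} := fun n => n.rec α fun _ β => max (g β) (f β)
  have he : Monotone e := monotone_nat_of_le_succ fun n => (hg (e n)).trans (le_max_left _ _)
  have hsup : ∀ x, x ∈ changBelow (⨆ n, e n) ↔ ∃ n, x ∈ changBelow (e n) := by
    intro x
    constructor
    · intro hx
      obtain ⟨β, hβ, hx⟩ := mem_changBelow.1 hx
      obtain ⟨n, hn⟩ := (Ordinal.lt_iSup_iff).1 hβ
      exact ⟨n, mem_changBelow.2 ⟨β, hn, hx⟩⟩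
    · rintro ⟨n, hn⟩
      exact changBelow_mono (Ordinal.le_iSup e n) hn
  refine ⟨e, le_rfl, fun n => le_max_right _ _, fun φ => ?_⟩
  induction φ with
  | mem i j => exact fun v _ => Iff.rfl
  | eq i j => exact fun v _ => Iff.rfl
  | fls => exact fun v _ => Iff.rfl
  | imp φ ψ h1 h2 => exact fun v hv => imp_congr (h1 v hv) (h2 v hv)
  | all φ ih =>
    intro v hv
    constructor
    · intro H
      by_contra hcon
      simp only [Sat, not_forall] at hcon
      have hb : ∃ N, ∀ n < φ.bound, v n ∈ changBelow (e N) := by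
        induction φ.bound with
        | zero => exact ⟨0, fun n hn => by omega⟩
        | succ m ihm =>
          obtain ⟨N, hN⟩ := ihm
          obtain ⟨N', hN'⟩ := (hsup _).1 (hv m)
          refine ⟨max N N', fun n hn => ?_⟩
          rcases Nat.lt_succ_iff_lt_or_eq.1 hn with h | rfl
          · exact changBelow_mono (he (le_max_left _ _)) (hN n h)
          · exact changBelow_mono (he (le_max_right _ _)) hN'
      obtain ⟨N, hN⟩ := hb
      obtain ⟨N', hN'⟩ := (hsup _).1 (hv 0)
      -- An infinite valuation may be cofinal in the supremum. Only the finitely many values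
      -- relevant to `φ` are kept; the others become `v 0`.
      let w : ℕ → ZFSet.{u} := fun n => if n < φ.bound then v n else v 0
      have hw : ∀ n, w n ∈ changBelow (e (max N N')) := by
        intro n
        simp only [w]
        split_ifs with h
        · exact changBelow_mono (he (le_max_left _ _)) (hN n h)
        · exact changBelow_mono (he (le_max_right _ _)) hN'
      have hvw : ∀ (A : Set ZFSet.{u}) x, Sat A φ (vcons x v) ↔ Sat A φ (vcons x w) := by
        intro A x
        refine sat_congr A φ _ _ fun n hn => ?_
        cases n with
        | zero => rfl
        | succ n => simp [w, show n < φ.bound by omega]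
      simp only [hvw] at hcon
      obtain ⟨x, hx, hx'⟩ := hg' _ φ w hw (by simpa using hcon)
      have hx1 : x ∈ changBelow (⨆ n, e n) :=
        (hsup x).2 ⟨max N N' + 1, changBelow_mono (le_max_left _ _) hx⟩
      rw [← hvw, ← ih _ (vcons_mem (A := (changBelow (⨆ n, e n) : Set ZFSet.{u})) hx1 hv)] at hx'
      exact hx' (H x hx1)
    · intro H x hx
      refine (ih _ (vcons_mem (A := (changBelow (⨆ n, e n) : Set ZFSet.{u})) hx hv)).2 (H x ?_)
      obtain ⟨β, -, hβ⟩ := mem_changBelow.1 hx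
      exact ⟨β, hβ⟩

/-! ### Ordinals fixed and ordinals moved by the ultrapower embedding -/

namespace UltraSystem

variable {I L D : Type (u + 1)} (U : UltraSystem I L D) [Infinite I]
  [Small.{u} I] [Small.{u} L] [Small.{u} D]

/-- The action of the ultrapower embedding on the ordinals. -/
noncomputable def ordinalMap (a : I → D) (ν : Ordinal.{u}) : Ordinal.{u} :=
  (U.collapse (fun _ => ν.toZFSet, a)).rank

variable {U}

lemma toZFSet_ordinalMap (a : I → D) (ν : Ordinal.{u}) :
    (U.ordinalMap a ν).toZFSet = U.collapse (fun _ => ν.toZFSet, a) :=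
  (isOrdinal_collapse (fun _ => ν) a).toZFSet_rank_eq

lemma ordinalMap_strictMono (a : I → D) : StrictMono (U.ordinalMap a) := by
  intro ν ν' h
  rw [← Ordinal.toZFSet_mem_toZFSet_iff, toZFSet_ordinalMap, toZFSet_ordinalMap,
    collapse_mem_iff_same]
  exact Eventually.of_forall fun _ => Ordinal.toZFSet_mem_toZFSet_iff.2 h

/-- By countable completeness, a function bounded by the supremum is bounded by one `e n` almost
everywhere. So the embedding is continuous at such suprema. -/
lemma ordinalMap_iSup {a : I → D} {e : ℕ → Ordinal.{u}}
    (he : ∀ n, U.ordinalMap a (e n) ≤ e (n + 1)) :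
    U.ordinalMap a (⨆ n, e n) = ⨆ n, e n := by
  refine le_antisymm ?_ (ordinalMap_strictMono a).le_apply
  rw [← Ordinal.toZFSet_subset_toZFSet_iff, toZFSet_ordinalMap]
  intro y hy
  obtain ⟨c, σ, g, rfl, hg, rfl⟩ := mem_collapse_ordinal hy
  simp only [Ordinal.lt_iSup_iff] at hg
  obtain ⟨n, hn⟩ := (U.eventually_exists ⟨Infinite.natEmbedding I⟩).1 hg
  have h1 : U.collapse (fun s => (g s).toZFSet, c) ∈ (U.ordinalMap (c ∘ σ) (e n)).toZFSet := by
    rw [toZFSet_ordinalMap, collapse_comp, collapse_mem_iff_same]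
    exact hn.mono fun s hs => Ordinal.toZFSet_mem_toZFSet_iff.2 hs
  exact Ordinal.toZFSet_subset_toZFSet_iff.2 ((he n).trans (Ordinal.le_iSup e _)) h1

/-- The ordinals below `η` may move, but as `η` is fixed they are exactly those represented by
functions into `η`, and the stages along such functions are known. -/
lemma collapse_changBelow (hI : Nonempty ((ℵ₁ : Cardinal.{u}).out ↪ I)) {a : I → D}
    {η : Ordinal.{u}} (hη : U.ordinalMap a η = η) :
    U.collapse (fun _ => changBelow η, a) = changBelow η := by
  have hη' : U.collapse (fun _ => η.toZFSet, a) = η.toZFSet := by rw [← toZFSet_ordinalMap, hη]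
  ext y
  constructor
  · intro hy
    obtain ⟨c, σ, f, rfl, hf, rfl⟩ := mem_collapse_iff_exists.1 hy
    simp only [mem_changBelow] at hf
    choose! h hh using fun (s : I → L) (hs : ∃ β < η, f s ∈ omegaOneChangStage β) => hs
    have h1 : U.collapse (fun s => (h s).toZFSet, c) ∈ η.toZFSet := by
      rw [← hη', collapse_comp, collapse_mem_iff_same]
      exact hf.mono fun s hs => Ordinal.toZFSet_mem_toZFSet_iff.2 (hh s hs).1
    obtain ⟨γ, hγ, h2⟩ := Ordinal.mem_toZFSet_iff.1 h1
    refine mem_changBelow.2 ⟨γ, hγ, ?_⟩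
    rw [← collapse_omegaOneChangStage hI γ h c h2.symm, collapse_mem_iff_same]
    exact hf.mono fun s hs => (hh s hs).2
  · intro hy
    obtain ⟨γ, hγ, hy⟩ := mem_changBelow.1 hy
    have h1 := Ordinal.toZFSet_mem_toZFSet_iff.2 hγ
    rw [← hη'] at h1
    obtain ⟨c, σ, h, rfl, hh, h2⟩ := mem_collapse_ordinal h1
    rw [← collapse_omegaOneChangStage hI γ h c h2] at hy
    obtain ⟨c, ρ, f, rfl, hf, rfl⟩ := mem_collapse_iff_exists.1 hy
    rw [eventually_comp] at hh
    refine mem_collapse_iff_exists.2 ⟨c, ρ ∘ σ, f, rfl, ?_, rfl⟩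
    filter_upwards [hh, hf] with s hs hs'
    exact mem_changBelow.2 ⟨_, hs, hs'⟩

/-- The ultrapower embedding fixes every ordinal that is definable over the Chang model. -/
theorem ordinalMap_eq_of_definable (hI : Nonempty ((ℵ₁ : Cardinal.{u}).out ↪ I)) (a : I → D)
    {μ : Ordinal.{u}} (hμ : μ.toZFSet ∈ omegaOneChang) (ψ : SetFormula)
    (hψ : ∀ x ∈ omegaOneChang, Sat omegaOneChang ψ (fun _ => x) ↔ x = μ.toZFSet) :
    U.ordinalMap a μ = μ := by
  obtain ⟨β, hβ⟩ := hμ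
  obtain ⟨e, he0, he, hrefl⟩ := exists_reflecting (U.ordinalMap a) (Order.succ β)
  have hη := collapse_changBelow hI (ordinalMap_iSup he)
  set η := ⨆ n, e n
  have hμη : μ.toZFSet ∈ changBelow η :=
    mem_changBelow.2 ⟨β, (Order.succ_le_iff.1 he0).trans_le (Ordinal.le_iSup e 0), hβ⟩
  have h1 : Sat (changBelow η : Set ZFSet.{u}) ψ fun _ => μ.toZFSet :=
    (hrefl ψ _ fun _ => hμη).2 ((hψ _ ⟨β, hβ⟩).2 rfl)
  -- The definition of `μ`, reflected down to the fixed set `changBelow η`, passes to the image of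
  -- `μ`; reflecting up then identifies the image with `μ`.
  have h2 := (sat_collapse (U := U) ψ (fun _ => changBelow η) (fun _ _ => μ.toZFSet) a).2
    (Eventually.of_forall fun _ => h1)
  have h3 : (U.ordinalMap a μ).toZFSet ∈ changBelow η := by
    rw [← hη, toZFSet_ordinalMap, collapse_mem_iff_same]
    exact Eventually.of_forall fun _ => hμη
  rw [hη, ← toZFSet_ordinalMap] at h2
  have h4 := (hrefl ψ _ fun _ => h3).1 h2
  obtain ⟨γ, -, hγ⟩ := mem_changBelow.1 h3
  exact Ordinal.toZFSet_injective ((hψ _ ⟨γ, hγ⟩).1 h4)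

/-- A coordinate function at the index constantly `β` represents an ordinal below the image of `κ`,
and these ordinals increase strictly with `β < δ`. -/
lemma lt_ordinalMap {l d : ZFSet.{u}} {κ δ : Ordinal.{u}} (hl : l = κ.toZFSet) (hd : d = δ.toZFSet)
    [Small.{u} l] [Small.{u} d] {U : UltraSystem I l d}
    (hU : ∀ (a : I → d) (ξ ζ : I), (a ξ : ZFSet.{u}) ∈ (a ζ : ZFSet.{u}) →
      ∀ᶠ s : I → l in U.filter a, (s ξ : ZFSet.{u}) ∈ (s ζ : ZFSet.{u})) (a : I → d)
    {α : Ordinal.{u}} (hα : α < δ) : α < U.ordinalMap a κ := by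
  subst hl hd
  obtain ⟨ξ, ζ, hne⟩ := exists_pair_ne I
  let p : ∀ β < δ, Point I κ.toZFSet δ.toZFSet := fun β hβ =>
    (fun s => s ξ, fun _ => ⟨β.toZFSet, Ordinal.toZFSet_mem_toZFSet_iff.2 hβ⟩)
  have hp : ∀ β (hβ : β < δ), U.collapse (p β hβ) ∈ (U.ordinalMap a κ).toZFSet := by
    intro β hβ
    rw [toZFSet_ordinalMap, collapse_mem_iff]
    exact Eventually.of_forall fun s => (s _).2
  choose f hf hfp using fun β hβ => Ordinal.mem_toZFSet_iff.1 (hp β hβ)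
  have hlt : ∀ β (hβ : β < δ) γ (hγ : γ < δ), β < γ → f β hβ < f γ hγ := by
    classical
    intro β hβ γ hγ h
    rw [← Ordinal.toZFSet_mem_toZFSet_iff, hfp, hfp, collapse_mem_iff]
    -- Both constant indices are reindexings of this one, which takes the two values at `ξ` and `ζ`.
    let c : I → δ.toZFSet := fun i => if i = ξ then ⟨β.toZFSet, Ordinal.toZFSet_mem_toZFSet_iff.2 hβ⟩
      else ⟨γ.toZFSet, Ordinal.toZFSet_mem_toZFSet_iff.2 hγ⟩
    refine (holds_iff (c := c) (σ := fun _ => ξ) (τ := fun _ => ζ) ?_ ?_).2 (hU c ξ ζ ?_)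
    · funext i
      simp [c, p]
    · funext i
      simp [c, p, hne.symm]
    · simpa [c, hne.symm] using h
  have hle : ∀ β (hβ : β < δ), β ≤ f β hβ := by
    intro β
    induction β using WellFoundedLT.induction with
    | _ β ih =>
      intro hβ
      by_contra hcon
      rw [not_le] at hcon
      have h1 := hlt _ (hcon.trans hβ) β hβ hcon
      exact (ih _ hcon (hcon.trans hβ)).not_gt h1
  exact (hle α hα).trans_lt (hf α hα)

end UltraSystem

end InnerModels


namespace InnerModels

open FirstOrder FirstOrder.Language ZFSet
open scoped Ordinal Cardinal
open SetFormula Filter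

/-! ### From systems of ultrafilters in the universe to ultrapowers -/

/-- The graph of a function. -/
noncomputable def graph {x y : ZFSet.{u}} (s : x → y) : ZFSet.{u} :=
  range fun ξ : x => pair ξ (s ξ)

section graph

variable {x y : ZFSet.{u}}

lemma pair_mem_graph {s : x → y} {a b : ZFSet.{u}} :
    pair a b ∈ graph s ↔ ∃ ξ : x, (ξ : ZFSet.{u}) = a ∧ (s ξ : ZFSet.{u}) = b := by
  simp [graph, pair_inj]

lemma pair_mem_graph_coe {s : x → y} {ξ : x} {b : ZFSet.{u}} :
    pair ξ b ∈ graph s ↔ (s ξ : ZFSet.{u}) = b := by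
  rw [pair_mem_graph]
  constructor
  · rintro ⟨ζ, h, rfl⟩
    rw [Subtype.ext h]
  · exact fun h => ⟨ξ, rfl, h⟩

lemma isFunc_graph (s : x → y) : IsFunc x y (graph s) := by
  constructor
  · intro z hz
    obtain ⟨ξ, rfl⟩ := mem_range.1 hz
    exact pair_mem_prod.2 ⟨ξ.2, (s ξ).2⟩
  · intro z hz
    exact ⟨s ⟨z, hz⟩, pair_mem_graph_coe (ξ := ⟨z, hz⟩).2 rfl,
      fun w hw => ((pair_mem_graph_coe (ξ := ⟨z, hz⟩)).1 hw).symm⟩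

lemma exists_graph_eq {f : ZFSet.{u}} (hf : IsFunc x y f) : ∃ s : x → y, graph s = f := by
  choose s hs using fun ξ : x => (hf.2 ξ ξ.2).exists
  refine ⟨fun ξ => ⟨s ξ, (isFunc_mem hf (hs ξ)).2⟩, isFunc_ext (isFunc_graph _) hf
    fun z hz => ⟨s ⟨z, hz⟩, ?_, hs ⟨z, hz⟩⟩⟩
  exact pair_mem_graph_coe (ξ := ⟨z, hz⟩).2 rfl

lemma graph_injective : Function.Injective (graph : (x → y) → ZFSet.{u}) := by
  intro s t h
  funext ξ
  have h1 : pair ξ (s ξ) ∈ graph t := h ▸ pair_mem_graph_coe.2 rfl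
  exact (Subtype.ext (pair_mem_graph_coe.1 h1)).symm

/-- The set of graphs of the functions in a set. -/
noncomputable def graphs (X : Set (x → y)) : ZFSet.{u} :=
  (funs x y).sep fun f => ∃ s ∈ X, graph s = f

lemma graphs_subset (X : Set (x → y)) : graphs X ⊆ funs x y := sep_subset

lemma graph_mem_graphs {X : Set (x → y)} {s : x → y} : graph s ∈ graphs X ↔ s ∈ X := by
  rw [graphs, mem_sep, mem_funs, and_iff_right (isFunc_graph s)]
  exact ⟨fun ⟨t, ht, h⟩ => graph_injective h ▸ ht, fun h => ⟨s, h, rfl⟩⟩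

lemma forall_mem_funs {P : ZFSet.{u} → Prop} :
    (∀ f, f ∈ funs x y → P f) ↔ ∀ s : x → y, P (graph s) := by
  refine ⟨fun h s => h _ (mem_funs.2 (isFunc_graph s)), fun h f hf => ?_⟩
  obtain ⟨s, rfl⟩ := exists_graph_eq (mem_funs.1 hf)
  exact h s

lemma eq_graphs {X : Set (x → y)} {Y : ZFSet.{u}} (hY : Y ⊆ funs x y)
    (h : ∀ s : x → y, graph s ∈ Y ↔ s ∈ X) : Y = graphs X := by
  ext f
  constructor
  · intro hf
    obtain ⟨s, rfl⟩ := exists_graph_eq (mem_funs.1 (hY hf))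
    exact graph_mem_graphs.2 ((h s).1 hf)
  · intro hf
    obtain ⟨s, rfl⟩ := exists_graph_eq (mem_funs.1 (graphs_subset X hf))
    exact (h s).2 (graph_mem_graphs.1 hf)

end graph

/-! ### Set-coded systems as instances of `UltraSystem` -/

namespace IsUltraSystem

variable {I L D U : ZFSet.{u}} (hU : IsUltraSystem I L D (funs I L) U)
include hU

lemma compl_iff (a : I → D) (X : Set (I → L)) :
    pair (graphs Xᶜ) (graph a) ∈ U ↔ ¬ pair (graphs X) (graph a) ∈ U :=
  hU.compl _ (isFunc_graph a) _ (graphs_subset X) _ (graphs_subset _)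
    (forall_mem_funs.2 fun s => by simp [graph_mem_graphs])

lemma iInter_iff (a : I → D) (X : I → Set (I → L)) :
    pair (graphs (⋂ ξ, X ξ)) (graph a) ∈ U ↔ ∀ ξ, pair (graphs (X ξ)) (graph a) ∈ U := by
  -- `G` codes the family `X` as one set, the form in which `inter` speaks of families.
  let G : ZFSet.{u} := range fun p : {p : I × (I → L) // p.2 ∈ X p.1} => pair p.1.1 (graph p.1.2)
  have hG : ∀ (ξ : I) (s : I → L), pair ξ (graph s) ∈ G ↔ s ∈ X ξ := by
    intro ξ s
    rw [mem_range]
    constructor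
    · rintro ⟨⟨⟨ζ, t⟩, h⟩, h'⟩
      obtain ⟨h1, h2⟩ := pair_inj.1 h'
      obtain rfl : ζ = ξ := Subtype.ext h1
      obtain rfl : t = s := graph_injective h2
      exact h
    · exact fun h => ⟨⟨(ξ, s), h⟩, rfl⟩
  refine (hU.inter _ (isFunc_graph a) G _ (graphs_subset _) (forall_mem_funs.2 fun s => ?_)).trans
    ⟨fun H ξ => ?_, fun H ξ hξ Y hY h => ?_⟩
  · rw [graph_mem_graphs, Set.mem_iInter]
    exact ⟨fun h ξ hξ => (hG ⟨ξ, hξ⟩ s).2 (h _), fun h ξ => (hG ξ s).1 (h ξ ξ.2)⟩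
  · exact H ξ ξ.2 _ (graphs_subset _) (forall_mem_funs.2 fun s => by rw [graph_mem_graphs, hG])
  · rw [eq_graphs hY fun s => (forall_mem_funs.1 h s).trans (hG ⟨ξ, hξ⟩ s)]
    exact H _

/-- Two distinct elements of `I` suffice to write a binary intersection as an `I`-indexed one. -/
lemma inter_iff [Nontrivial I] (a : I → D) (X Y : Set (I → L)) :
    pair (graphs (X ∩ Y)) (graph a) ∈ U ↔
      pair (graphs X) (graph a) ∈ U ∧ pair (graphs Y) (graph a) ∈ U := by
  classical
  obtain ⟨ξ, ζ, hne⟩ := exists_pair_ne I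
  have h : X ∩ Y = ⋂ η, if η = ξ then X else Y := by
    ext s
    rw [Set.mem_iInter]
    constructor
    · intro hs η
      split_ifs
      exacts [hs.1, hs.2]
    · intro hs
      exact ⟨by simpa using hs ξ, by simpa [hne.symm] using hs ζ⟩
  rw [h, hU.iInter_iff]
  constructor
  · intro H
    exact ⟨by simpa using H ξ, by simpa [hne.symm] using H ζ⟩
  · rintro ⟨h1, h2⟩ η
    split_ifs
    exacts [h1, h2]

/-- The ultrafilters of a system in the universe. -/
noncomputable def ultrafilter [Nontrivial I] (a : I → D) : Ultrafilter (I → L) :=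
  .ofComplNotMemIff
    { sets := {X | pair (graphs X) (graph a) ∈ U}
      univ_sets := by
        by_contra h
        have h1 : pair (graphs (∅ : Set (I → L))) (graph a) ∈ U := by
          rw [← Set.compl_univ]
          exact (hU.compl_iff a _).2 h
        rw [← Set.inter_univ ∅, hU.inter_iff] at h1
        exact h h1.2
      sets_of_superset := fun {X Y} hX hXY => by
        rw [← Set.inter_eq_left.2 hXY] at hX
        exact ((hU.inter_iff a X Y).1 hX).2
      inter_sets := fun {X Y} hX hY => (hU.inter_iff a X Y).2 ⟨hX, hY⟩ }
    fun X => ((hU.compl_iff a X).not.trans not_not :)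

lemma mem_ultrafilter [Nontrivial I] {a : I → D} {X : Set (I → L)} :
    X ∈ hU.ultrafilter a ↔ pair (graphs X) (graph a) ∈ U := Iff.rfl

/-- A system of ultrafilters in the universe as an `UltraSystem`. -/
noncomputable def toUltraSystem [Nontrivial I] : UltraSystem I L D where
  filter := hU.ultrafilter
  iInter_mem a X h := (hU.iInter_iff a X).2 h
  filter_comp a σ := by
    ext X
    rw [Ultrafilter.mem_map, mem_ultrafilter, mem_ultrafilter]
    refine hU.coherent _ (isFunc_graph a) _ (isFunc_graph _) _ (isFunc_graph σ)
      (fun ξ hξ => ⟨_, (σ ⟨ξ, hξ⟩).2, _, (a (σ ⟨ξ, hξ⟩)).2, ?_, ?_, ?_⟩) _ (graphs_subset _) _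
      (graphs_subset _) (forall_mem_funs.2 fun s => ?_)
    · exact pair_mem_graph_coe (ξ := ⟨ξ, hξ⟩).2 rfl
    · exact pair_mem_graph_coe.2 rfl
    · exact pair_mem_graph_coe (ξ := ⟨ξ, hξ⟩).2 rfl
    · rw [graph_mem_graphs, Set.mem_preimage]
      constructor
      · intro h
        refine ⟨_, graph_mem_graphs.2 h, fun ξ hξ =>
          ⟨_, (σ ⟨ξ, hξ⟩).2, _, (s (σ ⟨ξ, hξ⟩)).2, ?_, ?_, ?_⟩⟩
        · exact pair_mem_graph_coe (ξ := ⟨ξ, hξ⟩).2 rfl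
        · exact pair_mem_graph_coe.2 rfl
        · exact pair_mem_graph_coe (ξ := ⟨ξ, hξ⟩).2 rfl
      · rintro ⟨f, hf, h⟩
        obtain ⟨t, rfl⟩ := exists_graph_eq (mem_funs.1 (graphs_subset X hf))
        suffices s ∘ σ = t from this ▸ graph_mem_graphs.1 hf
        funext ξ
        obtain ⟨ζ, hζ, y, hy, h1, h2, h3⟩ := h ξ ξ.2
        rw [pair_mem_graph_coe] at h1 h3
        subst h1
        rw [pair_mem_graph_coe] at h2
        exact Subtype.ext (h2.trans h3.symm)

lemma eventually_mem [Nontrivial I] (a : I → D) (ξ ζ : I)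
    (h : (a ξ : ZFSet.{u}) ∈ (a ζ : ZFSet.{u})) :
    ∀ᶠ s : I → L in hU.toUltraSystem.filter a, (s ξ : ZFSet.{u}) ∈ (s ζ : ZFSet.{u}) := by
  refine hU.mono _ (isFunc_graph a) ξ ξ.2 ζ ζ.2 _ (a ξ).2 _ (a ζ).2 (pair_mem_graph_coe.2 rfl)
    (pair_mem_graph_coe.2 rfl) h _ (graphs_subset _) (forall_mem_funs.2 fun s => ?_)
  rw [graph_mem_graphs]
  constructor
  · exact fun h => ⟨_, (s ξ).2, _, (s ζ).2, pair_mem_graph_coe.2 rfl, pair_mem_graph_coe.2 rfl, h⟩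
  · rintro ⟨x, hx, y, hy, h1, h2, h3⟩
    rw [pair_mem_graph_coe] at h1 h2
    subst h1 h2
    exact h3

end IsUltraSystem

/-! ### Definable ordinals of the Chang model lie below `κ` -/

/-- Cantor's theorem. The reals serve as index set because they are this numerous and yet fixed
pointwise by elementary embeddings of the universe. -/
lemma nonempty_aleph_one_embedding_reals : Nonempty ((ℵ₁ : Cardinal.{u}).out ↪ reals.{u}) := by
  have h : (ℵ₁ : Cardinal.{u}) ≤ #(Shrink.{u} reals.{u}) := by
    change _ ≤ reals.card
    rw [reals, card_powerset, Ordinal.card_toZFSet, Ordinal.card_omega0, ← Cardinal.succ_aleph0]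
    exact Order.succ_le_of_lt (Cardinal.cantor _)
  rw [← Cardinal.mk_out ℵ₁] at h
  obtain ⟨e⟩ := h
  exact ⟨e.trans (equivShrink _).symm.toEmbedding⟩

instance : Infinite reals.{u} := by
  obtain ⟨e⟩ := nonempty_aleph_one_embedding_reals.{u}
  have : Infinite (ℵ₁ : Cardinal.{u}).out := by
    rw [Cardinal.infinite_iff, Cardinal.mk_out]
    exact Cardinal.aleph0_le_aleph 1
  exact Infinite.of_injective e e.injective

/-- Ordinals that are definable over the Chang model are below every ordinal that carries
arbitrarily long systems of ultrafilters. -/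
theorem HasUltraSystems.lt_of_definable {κ μ : Ordinal.{u}} (hκ : HasUltraSystems κ.toZFSet)
    (hμ : μ.toZFSet ∈ omegaOneChang) (ψ : SetFormula)
    (hψ : ∀ x ∈ omegaOneChang, Sat omegaOneChang ψ (fun _ => x) ↔ x = μ.toZFSet) : μ < κ := by
  by_contra hle
  rw [not_lt] at hle
  -- Length `μ + 1` makes the image of `κ` exceed `μ` itself.
  obtain ⟨U, hU⟩ := hκ.2 (Order.succ μ).toZFSet (isOrdinal_toZFSet _)
  let a : reals.{u} → (Order.succ μ).toZFSet := fun _ =>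
    ⟨μ.toZFSet, Ordinal.toZFSet_mem_toZFSet_iff.2 (Order.lt_succ μ)⟩
  have h1 := UltraSystem.lt_ordinalMap rfl rfl hU.eventually_mem a (Order.lt_succ μ)
  have h2 := UltraSystem.ordinalMap_eq_of_definable (U := hU.toUltraSystem)
    nonempty_aleph_one_embedding_reals a hμ ψ hψ
  have h3 := (UltraSystem.ordinalMap_strictMono (U := hU.toUltraSystem) a).monotone hle
  -- With `j` the action of the embedding on ordinals, `μ < j(κ) ≤ j(μ) = μ`.
  exact (h1.trans_le h3).ne' h2

end InnerModels


namespace InnerModels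

open FirstOrder FirstOrder.Language ZFSet
open scoped Ordinal Cardinal
open SetFormula

/-! ### Finite sets of ordinals -/

lemma mem_code {s : Finset Ordinal.{u}} {x : ZFSet.{u}} :
    x ∈ code s ↔ ∃ ξ ∈ s, ξ.toZFSet = x := by
  simp [code]

lemma toZFSet_mem_code {s : Finset Ordinal.{u}} {ξ : Ordinal.{u}} : ξ.toZFSet ∈ code s ↔ ξ ∈ s := by
  rw [mem_code]
  exact ⟨fun ⟨ζ, h, h'⟩ => Ordinal.toZFSet_injective h' ▸ h, fun h => ⟨ξ, h, rfl⟩⟩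

lemma code_injective : Function.Injective code.{u} := by
  intro s t h
  ext ξ
  rw [← toZFSet_mem_code, h, toZFSet_mem_code]

@[simp] lemma code_empty : code (∅ : Finset Ordinal.{u}) = ∅ := by
  rw [ZFSet.eq_empty]
  intro x hx
  obtain ⟨ξ, h, -⟩ := mem_code.1 hx
  simp at h

lemma code_subset {s : Finset Ordinal.{u}} {κ : Ordinal.{u}} :
    code s ⊆ κ.toZFSet ↔ Below s κ := by
  constructor
  · exact fun h ξ hξ => Ordinal.toZFSet_mem_toZFSet_iff.1 (h (toZFSet_mem_code.2 hξ))
  · intro h x hx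
    obtain ⟨ξ, hξ, rfl⟩ := mem_code.1 hx
    exact Ordinal.toZFSet_mem_toZFSet_iff.2 (h ξ hξ)

lemma code_mem_brk {s : Finset Ordinal.{u}} {κ : Ordinal.{u}} {n : ℕ} :
    code s ∈ brk κ n ↔ Below s κ ∧ s.card = n := by
  rw [brk, mem_sep, mem_powerset, code_subset]
  refine and_congr_right fun _ => ⟨fun ⟨t, ht, h⟩ => ?_, fun h => ⟨s, h, rfl⟩⟩
  rw [code_injective h, ht]

lemma exists_of_mem_brk {x : ZFSet.{u}} {κ : Ordinal.{u}} {n : ℕ} (h : x ∈ brk κ n) :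
    ∃ s : Finset Ordinal.{u}, Below s κ ∧ s.card = n ∧ x = code s := by
  obtain ⟨s, -, rfl⟩ := (mem_sep.1 h).2
  exact ⟨s, (code_mem_brk.1 h).1, (code_mem_brk.1 h).2, rfl⟩

lemma code_mem_brkSep {s : Finset Ordinal.{u}} {κ : Ordinal.{u}} {n : ℕ}
    {P : Finset Ordinal.{u} → Prop} :
    code s ∈ brkSep κ n P ↔ (Below s κ ∧ s.card = n) ∧ P s := by
  rw [brkSep, mem_sep, code_mem_brk]
  refine and_congr_right fun _ => ⟨fun ⟨t, h, ht⟩ => ?_, fun h => ⟨s, rfl, h⟩⟩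
  rwa [code_injective h]

lemma brkSep_subset {κ : Ordinal.{u}} {n : ℕ} {P : Finset Ordinal.{u} → Prop} :
    brkSep κ n P ⊆ brk κ n := sep_subset

lemma subset_of_forall_code {X Y : ZFSet.{u}} {κ : Ordinal.{u}} {n : ℕ} (hX : X ⊆ brk κ n)
    (h : ∀ s : Finset Ordinal.{u}, Below s κ → s.card = n → code s ∈ X → code s ∈ Y) : X ⊆ Y := by
  intro x hx
  obtain ⟨s, h1, h2, rfl⟩ := exists_of_mem_brk (hX hx)
  exact h s h1 h2 hx

lemma brkSep_congr {κ : Ordinal.{u}} {n : ℕ} {P Q : Finset Ordinal.{u} → Prop}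
    (h : ∀ s : Finset Ordinal.{u}, Below s κ → s.card = n → (P s ↔ Q s)) :
    brkSep κ n P = brkSep κ n Q := by
  ext x
  constructor <;> intro hx
  · exact subset_of_forall_code brkSep_subset (fun s h1 h2 h3 =>
      code_mem_brkSep.2 ⟨⟨h1, h2⟩, (h s h1 h2).1 (code_mem_brkSep.1 h3).2⟩) hx
  · exact subset_of_forall_code brkSep_subset (fun s h1 h2 h3 =>
      code_mem_brkSep.2 ⟨⟨h1, h2⟩, (h s h1 h2).2 (code_mem_brkSep.1 h3).2⟩) hx

/-- The number of elements of `s` below `ξ`. -/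
noncomputable def rankIn (s : Finset Ordinal.{u}) (ξ : Ordinal.{u}) : ℕ := by
  classical exact (s.filter (· < ξ)).card

lemma rankIn_lt_rankIn {s : Finset Ordinal.{u}} {ξ ζ : Ordinal.{u}} (hξ : ξ ∈ s) (h : ξ < ζ) :
    rankIn s ξ < rankIn s ζ := by
  classical
  refine Finset.card_lt_card (Finset.ssubset_iff_of_subset ?_ |>.2 ⟨ξ, by simp [hξ, h], by simp⟩)
  intro x hx
  simp only [Finset.mem_filter] at hx ⊢
  exact ⟨hx.1, hx.2.trans h⟩

lemma rankIn_injOn (s : Finset Ordinal.{u}) : Set.InjOn (rankIn s) s := by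
  intro ξ hξ ζ hζ h
  rcases lt_trichotomy ξ ζ with h' | h' | h'
  · exact absurd h (rankIn_lt_rankIn hξ h').ne
  · exact h'
  · exact absurd h (rankIn_lt_rankIn hζ h').ne'

lemma image_rankIn (s : Finset Ordinal.{u}) : s.image (rankIn s) = Finset.range s.card := by
  classical
  refine Finset.eq_of_subset_of_card_le ?_ ?_
  · intro k hk
    obtain ⟨ξ, hξ, rfl⟩ := Finset.mem_image.1 hk
    exact Finset.mem_range.2 (Finset.card_lt_card
      (Finset.ssubset_iff_of_subset (Finset.filter_subset _ _) |>.2 ⟨ξ, hξ, by simp⟩))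
  · rw [Finset.card_range, Finset.card_image_of_injOn (rankIn_injOn s)]

lemma mem_proj {a b s : Finset Ordinal.{u}} {η : Ordinal.{u}} :
    η ∈ proj a b s ↔ η ∈ s ∧ ∃ ξ ∈ a, rankIn b ξ = rankIn s η := by
  simp only [proj, Finset.mem_filter, rankIn]

lemma proj_subset (a b s : Finset Ordinal.{u}) : proj a b s ⊆ s := fun _ h => (mem_proj.1 h).1

lemma exists_rankIn_eq {b s : Finset Ordinal.{u}} (h : s.card = b.card) {ξ : Ordinal.{u}}
    (hξ : ξ ∈ b) : ∃ η ∈ s, rankIn s η = rankIn b ξ := by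
  have : rankIn b ξ ∈ s.image (rankIn s) := by
    rw [image_rankIn, h, ← image_rankIn]
    exact Finset.mem_image_of_mem _ hξ
  exact Finset.mem_image.1 this

lemma proj_self {b s : Finset Ordinal.{u}} (h : s.card = b.card) : proj b b s = s := by
  refine (proj_subset b b s).antisymm fun η hη => mem_proj.2 ⟨hη, ?_⟩
  exact exists_rankIn_eq h.symm hη

lemma card_proj {a b s : Finset Ordinal.{u}} (hab : a ⊆ b) (h : s.card = b.card) :
    (proj a b s).card = a.card := by
  classical
  rw [← Finset.card_image_of_injOn ((rankIn_injOn b).mono (Finset.coe_subset.2 hab)),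
    ← Finset.card_image_of_injOn ((rankIn_injOn s).mono (Finset.coe_subset.2 (proj_subset a b s)))]
  congr 1
  ext k
  simp only [Finset.mem_image]
  constructor
  · rintro ⟨η, hη, rfl⟩
    obtain ⟨ξ, hξ, h⟩ := (mem_proj.1 hη).2
    exact ⟨ξ, hξ, h⟩
  · rintro ⟨ξ, hξ, rfl⟩
    obtain ⟨η, hη, h'⟩ := exists_rankIn_eq h (hab hξ)
    exact ⟨η, mem_proj.2 ⟨hη, ξ, hξ, h'.symm⟩, h'⟩

lemma code_proj_mem_brk {a b s : Finset Ordinal.{u}} {κ : Ordinal.{u}} (hab : a ⊆ b)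
    (hs : Below s κ) (h : s.card = b.card) : code (proj a b s) ∈ brk κ a.card :=
  code_mem_brk.2 ⟨fun ξ hξ => hs ξ (proj_subset _ _ _ hξ), card_proj hab h⟩

/-- `z` has exactly `k` predecessors in `t`. -/
def HasRank : ℕ → ZFSet.{u} → ZFSet.{u} → Prop
  | 0, z, t => ∀ y, y ∈ t → ¬ y ∈ z
  | k + 1, z, t => ∃ y, y ∈ t ∧ (y ∈ z ∧ (HasRank k y t ∧ ∀ x, x ∈ t → (x ∈ z → (x = y ∨ x ∈ y))))

/-- For fixed `k` the recursion unfolds to a bounded formula. This makes projections of finite sets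
definable, so that functions composed with them can be found inside `M`. -/
lemma UDef.hasRank {K : Set (Set ZFSet.{u})} (hK : K ⊆ transClasses) (k i j : ℕ) :
    UDef K fun _ v => HasRank k (v i) (v j) := by
  induction k generalizing i j with
  | zero => exact UDef.ball _ hK (UDef.mem _ _).not
  | succ k ih =>
    exact UDef.bex _ hK ((UDef.mem _ _).and ((ih _ _).and (UDef.ball _ hK
      ((UDef.mem _ _).imp ((UDef.eq _ _).or (UDef.mem _ _))))))

lemma hasRank_code {s : Finset Ordinal.{u}} {k : ℕ} {η : Ordinal.{u}} :
    HasRank k η.toZFSet (code s) ↔ rankIn s η = k := by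
  classical
  have hall : ∀ P : ZFSet.{u} → Prop, (∀ y, y ∈ code s → P y) ↔ ∀ ξ ∈ s, P ξ.toZFSet := by
    intro P
    simp only [mem_code, forall_exists_index, and_imp]
    exact ⟨fun h ξ hξ => h _ ξ hξ rfl, fun h y ξ hξ e => e ▸ h ξ hξ⟩
  have hex : ∀ P : ZFSet.{u} → Prop, (∃ y, y ∈ code s ∧ P y) ↔ ∃ ξ ∈ s, P ξ.toZFSet := by
    intro P
    simp only [mem_code]
    exact ⟨fun ⟨y, ⟨ξ, hξ, e⟩, h⟩ => ⟨ξ, hξ, e ▸ h⟩, fun ⟨ξ, hξ, h⟩ => ⟨_, ⟨ξ, hξ, rfl⟩, h⟩⟩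
  induction k generalizing η with
  | zero =>
    rw [HasRank, hall, rankIn, Finset.card_eq_zero, Finset.filter_eq_empty_iff]
    simp only [Ordinal.toZFSet_mem_toZFSet_iff]
  | succ k ih =>
    rw [HasRank, hex]
    simp only [hall, Ordinal.toZFSet_mem_toZFSet_iff, ih, Ordinal.toZFSet_injective.eq_iff]
    constructor
    · rintro ⟨ξ, hξ, h1, rfl, h2⟩
      have : (s.filter fun x => x < η) = insert ξ (s.filter fun x => x < ξ) := by
        ext x
        simp only [Finset.mem_filter, Finset.mem_insert]
        constructor
        · rintro ⟨hx, hx'⟩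
          exact (h2 x hx hx').imp id fun h => ⟨hx, h⟩
        · rintro (rfl | ⟨hx, hx'⟩)
          exacts [⟨hξ, h1⟩, ⟨hx, hx'.trans h1⟩]
      rw [rankIn, this, Finset.card_insert_of_notMem (by simp), rankIn]
    · intro h
      have hne : (s.filter fun x => x < η).Nonempty := by
        rw [← Finset.card_pos]
        rw [rankIn] at h
        omega
      obtain ⟨ξ, hξ, h2⟩ : ∃ ξ, (ξ ∈ s ∧ ξ < η) ∧ ∀ x ∈ s, x < η → x = ξ ∨ x < ξ := by
        obtain ⟨ξ, hξ, h2⟩ := Finset.exists_max_image (s.filter fun x => x < η) (fun x => x) hne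
        rw [Finset.mem_filter] at hξ
        refine ⟨ξ, hξ, fun x hx hx' => ?_⟩
        refine LE.le.eq_or_lt (h2 x ?_)
        rw [Finset.mem_filter]
        exact ⟨hx, hx'⟩
      refine ⟨ξ, hξ.1, hξ.2, ?_, h2⟩
      have : (s.filter fun x => x < η) = insert ξ (s.filter fun x => x < ξ) := by
        ext x
        simp only [Finset.mem_filter, Finset.mem_insert]
        constructor
        · rintro ⟨hx, hx'⟩
          exact (h2 x hx hx').imp id fun h => ⟨hx, h⟩
        · rintro (rfl | ⟨hx, hx'⟩)
          exacts [hξ, ⟨hx, hx'.trans hξ.2⟩]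
      rw [rankIn, this, Finset.card_insert_of_notMem (by simp)] at h
      rw [rankIn]
      omega

/-- `w` consists of the elements of `t` with ranks in `J`. -/
def IsRankPart (J : Finset ℕ) (t w : ZFSet.{u}) : Prop :=
  w ⊆ t ∧ ∀ z, z ∈ t → (z ∈ w ↔ ∃ k ∈ J, HasRank k z t)

lemma UDef.isRankPart {K : Set (Set ZFSet.{u})} (hK : K ⊆ transClasses) (J : Finset ℕ) (i j : ℕ) :
    UDef K fun _ v => IsRankPart J (v i) (v j) := by
  have h : ∀ i j : ℕ, UDef K fun _ v => ∃ k ∈ J, HasRank k (v i) (v j) := by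
    intro i j
    induction J using Finset.induction with
    | empty => exact UDef.fls.congr fun _ _ _ _ => by simp
    | insert m J _ ih =>
      exact ((UDef.hasRank hK m i j).or ih).congr fun _ _ _ _ => by simp
  exact (UDef.subset hK _ _).and (UDef.ball _ hK ((UDef.mem _ _).iff (h _ _)))

/-- The sets `a` and `b` enter only through a finite set of natural numbers, so the projection needs
no parameters. -/
lemma isRankPart_code {a b s : Finset Ordinal.{u}} {w : ZFSet.{u}} :
    IsRankPart (a.image (rankIn b)) (code s) w ↔ w = code (proj a b s) := by
  have h : ∀ η ∈ s, (∃ k ∈ a.image (rankIn b), HasRank k η.toZFSet (code s)) ↔ η ∈ proj a b s := by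
    intro η hη
    simp [hasRank_code, mem_proj, hη, eq_comm]
  constructor
  · rintro ⟨h1, h2⟩
    ext z
    constructor
    · intro hz
      obtain ⟨η, hη, rfl⟩ := mem_code.1 (h1 hz)
      exact toZFSet_mem_code.2 ((h η hη).1 ((h2 _ (h1 hz)).1 hz))
    · intro hz
      obtain ⟨η, hη, rfl⟩ := mem_code.1 hz
      have hs := proj_subset _ _ _ hη
      exact (h2 _ (toZFSet_mem_code.2 hs)).2 ((h η hs).2 hη)
  · rintro rfl
    refine ⟨fun z hz => ?_, fun z hz => ?_⟩
    · obtain ⟨η, hη, rfl⟩ := mem_code.1 hz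
      exact toZFSet_mem_code.2 (proj_subset _ _ _ hη)
    · obtain ⟨η, hη, rfl⟩ := mem_code.1 hz
      rw [h η hη, toZFSet_mem_code]

/-! ### Values of functions -/

lemma app_eq {d r f x y : ZFSet.{u}} (hf : IsFunc d r f) (h : pair x y ∈ f) : app f x = y := by
  have : (⋃₀ (⋃₀ f : ZFSet.{u}) : ZFSet.{u}).sep (fun y => pair x y ∈ f) = {y} := by
    ext z
    rw [mem_sep, mem_singleton]
    constructor
    · exact fun hz => isFunc_unique hf hz.2 h
    · rintro rfl
      refine ⟨mem_sUnion.2 ⟨{x, z}, mem_sUnion.2 ⟨_, h, ?_⟩, ?_⟩, h⟩ <;> simp [pair]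
  rw [app, this, sUnion_singleton]

lemma pair_app_mem {d f x : ZFSet.{u}} (hf : IsFunOn f d) (hx : x ∈ d) : pair x (app f x) ∈ f := by
  obtain ⟨r, hf⟩ := hf
  obtain ⟨y, hy⟩ := (hf.2 x hx).exists
  rwa [app_eq hf hy]

lemma IsTransClass.of_pair_mem {M : Set ZFSet.{u}} (hM : IsTransClass M) {x y : ZFSet.{u}}
    (h : pair x y ∈ M) : x ∈ M ∧ y ∈ M := by
  have h1 : {x, y} ∈ M := hM _ h _ (by simp [pair])
  exact ⟨hM _ h1 _ (by simp), hM _ h1 _ (by simp)⟩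

lemma app_mem_class {M : Set ZFSet.{u}} (hM : IsTransClass M) {d f x : ZFSet.{u}} (hfM : f ∈ M)
    (hf : IsFunOn f d) (hx : x ∈ d) : app f x ∈ M :=
  (hM.of_pair_mem (hM _ hfM _ (pair_app_mem hf hx))).2

end InnerModels


namespace InnerModels

open FirstOrder FirstOrder.Language ZFSet
open scoped Ordinal Cardinal
open SetFormula

/-! ### Transitive classes into which the universe embeds -/

/-- `M` is a transitive class into which the universe embeds elementarily. -/
structure IsElemTarget (M : Set ZFSet.{u}) : Prop where
  trans : IsTransClass M
  exists_elemMap : ∃ i, ElemMap Set.univ M i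

/-- The value of a term over a valuation: a variable, or the value at the variable `s` of a
function given by a variable. -/
noncomputable def appVal (s : ℕ) (t : ℕ ⊕ ℕ) (v : ℕ → ZFSet.{u}) : ZFSet.{u} :=
  t.elim v fun m => app (v m) (v s)

lemma mem_app {f x z : ZFSet.{u}} : z ∈ app f x ↔ ∃ y, pair x y ∈ f ∧ z ∈ y := by
  simp only [app, mem_sUnion, mem_sep]
  refine ⟨fun ⟨y, h, hz⟩ => ⟨y, h.2, hz⟩, fun ⟨y, h, hz⟩ => ⟨y, ⟨⟨{x, y}, ⟨_, h, ?_⟩, ?_⟩, h⟩, hz⟩⟩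
    <;> simp [pair]

lemma appVal_subset {A : Set ZFSet.{u}} (hA : IsTransClass A) (s : ℕ) (t : ℕ ⊕ ℕ)
    {v : ℕ → ZFSet.{u}} (hv : ∀ n, v n ∈ A) {z : ZFSet.{u}} (hz : z ∈ appVal s t v) : z ∈ A := by
  rcases t with m | m
  · exact hA _ (hv m) _ hz
  · obtain ⟨y, h, hz⟩ := mem_app.1 hz
    exact hA _ (hA.of_pair_mem (hA _ (hv m) _ h)).2 _ hz

lemma UDef.memAppVal (i s : ℕ) (t : ℕ ⊕ ℕ) :
    UDef transClasses fun _ v => v i ∈ appVal.{u} s t v := by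
  rcases t with m | m
  · exact UDef.mem _ _
  · have : UDef transClasses.{u} fun A v => ∃ y, y ∈ A ∧ (pair (v s) y ∈ v m ∧ v i ∈ y) :=
      UDef.ex ((UDef.pairMem subset_rfl _ _ _).and (UDef.mem _ _))
    refine this.congr fun A hA v hv => ?_
    refine Iff.trans ?_ mem_app.symm
    exact ⟨fun ⟨y, _, h⟩ => ⟨y, h⟩,
      fun ⟨y, h⟩ => ⟨y, (IsTransClass.of_pair_mem hA (hA _ (hv m) _ h.1)).2, h⟩⟩

/-- The shift of a term below a quantifier. -/
def shiftTerm (t : ℕ ⊕ ℕ) : ℕ ⊕ ℕ := t.map (· + 1) (· + 1)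

/-- For arbitrary valuations a value of `app` need not belong to `A`, but its elements do; atomic
formulas are therefore expressed through elements. -/
lemma UDef.satAppVal (φ : SetFormula) (s : ℕ) (T : ℕ → ℕ ⊕ ℕ) :
    UDef transClasses.{u} fun A v => Sat A φ fun k => appVal s (T k) v := by
  induction φ generalizing s T with
  | mem i j =>
    have : UDef transClasses.{u} fun A v => ∃ a, a ∈ A ∧ (a ∈ appVal s (T j) v ∧
        ∀ z, z ∈ A → (z ∈ a ↔ z ∈ appVal s (T i) v)) := by
      refine UDef.ex (UDef.and ?_ (UDef.all ((UDef.mem _ _).iff ?_)))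
      · exact (UDef.memAppVal 0 (s + 1) (shiftTerm (T j))).congr fun A _ v _ => by
          rcases T j with m | m <;> rfl
      · exact (UDef.memAppVal 0 (s + 2) (shiftTerm (shiftTerm (T i)))).congr fun A _ v _ => by
          rcases T i with m | m <;> rfl
    refine this.congr fun A hA v hv => ⟨?_, fun h => ?_⟩
    · rintro ⟨a, ha, h, h'⟩
      have : a = appVal s (T i) v := by
        ext z
        exact ⟨fun hz => (h' z (hA _ ha _ hz)).1 hz,
          fun hz => (h' z (appVal_subset hA _ _ hv hz)).2 hz⟩
      change appVal s (T i) v ∈ appVal s (T j) v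
      rwa [← this]
    · exact ⟨_, appVal_subset hA _ _ hv h, h, fun _ _ => Iff.rfl⟩
  | eq i j =>
    have : UDef transClasses.{u} fun A v => ∀ z, z ∈ A →
        (z ∈ appVal s (T i) v ↔ z ∈ appVal s (T j) v) := by
      refine UDef.all (UDef.iff ?_ ?_)
      · exact (UDef.memAppVal 0 (s + 1) (shiftTerm (T i))).congr fun A _ v _ => by
          rcases T i with m | m <;> rfl
      · exact (UDef.memAppVal 0 (s + 1) (shiftTerm (T j))).congr fun A _ v _ => by
          rcases T j with m | m <;> rfl
    refine this.congr fun A hA v hv => ⟨fun h => ?_, fun h z _ => ?_⟩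
    · change appVal s (T i) v = appVal s (T j) v
      ext z
      exact ⟨fun hz => (h z (appVal_subset hA _ _ hv hz)).1 hz,
        fun hz => (h z (appVal_subset hA _ _ hv hz)).2 hz⟩
    · rw [show appVal s (T i) v = appVal s (T j) v from h]
  | fls => exact UDef.fls
  | imp φ ψ h1 h2 => exact (h1 s T).imp (h2 s T)
  | all φ ih =>
    refine UDef.all (Q := fun A v x => Sat A φ (vcons x fun k => appVal s (T k) v)) ?_
    refine (ih (s + 1) fun k => k.casesOn (.inl 0) fun k => shiftTerm (T k)).congr
      fun A _ v _ => iff_of_eq ?_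
    congr 1
    funext k
    cases k with
    | zero => rfl
    | succ k =>
      change appVal (s + 1) (shiftTerm (T k)) v = appVal s (T k) _
      rcases T k with m | m <;> rfl

/-- The set of values of a class function on a set, as a function. -/
lemma exists_isFunc (d : ZFSet.{u}) (f : ZFSet.{u} → ZFSet.{u}) :
    ∃ r g : ZFSet.{u}, IsFunc d r g ∧ ∀ x ∈ d, pair x (f x) ∈ g := by
  let r : ZFSet.{u} := ZFSet.range fun x : d => f x
  let g : ZFSet.{u} := ZFSet.range fun x : d => pair x (f x)
  have hg : ∀ x ∈ d, pair x (f x) ∈ g := fun x hx => mem_range.2 ⟨⟨x, hx⟩, rfl⟩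
  refine ⟨r, g, ⟨fun z hz => ?_, fun x hx => ⟨f x, hg x hx, fun y hy => ?_⟩⟩, hg⟩
  · obtain ⟨⟨x, hx⟩, rfl⟩ := mem_range.1 hz
    exact pair_mem_prod.2 ⟨hx, mem_range.2 ⟨⟨x, hx⟩, rfl⟩⟩
  · obtain ⟨⟨z, hz⟩, h⟩ := mem_range.1 hy
    obtain ⟨rfl, rfl⟩ := pair_inj.1 h
    rfl

/-! ### Closure properties transferred from the universe -/

namespace IsElemTarget

variable {M : Set ZFSet.{u}} {R : Set ZFSet.{u} → (ℕ → ZFSet.{u}) → Prop}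

/-- This avoids verifying axioms of ZFC in `M`: each closure property is a uniformly definable
statement, evident in the universe and carried over by elementarity. -/
lemma valid (hM : IsElemTarget M) (hR : UDef transClasses R) (h : ∀ v, R Set.univ v)
    (w : ℕ → ZFSet.{u}) (hw : ∀ n, w n ∈ M) : R M w := by
  obtain ⟨i, hi⟩ := hM.exists_elemMap
  exact hi.forall_of_forall hR (singleton_univ_subset rfl) hM.trans ⟨∅, trivial⟩ (fun v _ => h v)
    w hw

lemma pair_mem (hM : IsElemTarget M) {x y : ZFSet.{u}} (hx : x ∈ M) (hy : y ∈ M) :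
    pair x y ∈ M := by
  have h : UDef transClasses.{u} fun A v => ∃ z, z ∈ A ∧ z = pair (v 0) (v 1) :=
    UDef.ex (UDef.eqPair subset_rfl _ _ _)
  obtain ⟨z, hz, rfl⟩ := hM.valid h (fun v => ⟨_, trivial, rfl⟩) (vcons x fun _ => y)
    (vcons_mem hx fun _ => hy)
  exact hz

lemma upair_mem (hM : IsElemTarget M) {x y : ZFSet.{u}} (hx : x ∈ M) (hy : y ∈ M) :
    ({x, y} : ZFSet.{u}) ∈ M :=
  hM.trans _ (hM.pair_mem hx hy) _ (by simp [pair])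

lemma singleton_mem (hM : IsElemTarget M) {x : ZFSet.{u}} (hx : x ∈ M) :
    ({x} : ZFSet.{u}) ∈ M :=
  hM.trans _ (hM.pair_mem hx hx) _ (by simp [pair])

lemma empty_mem (hM : IsElemTarget M) : (∅ : ZFSet.{u}) ∈ M := by
  obtain ⟨i, hi⟩ := hM.exists_elemMap
  have h := (hi.iff_univ hM.trans (UDef.eqEmpty subset_rfl 0) fun _ => ∅).2 rfl
  exact h ▸ hi.mapsTo ∅ trivial

/-- Separation. -/
lemma sep_mem (hM : IsElemTarget M) (hR : UDef transClasses R) {w : ℕ → ZFSet.{u}}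
    (hw : ∀ n, w n ∈ M) : ((w 0).sep fun x => R M (vcons x w)) ∈ M := by
  let ρ : ℕ → ℕ := fun n => n.casesOn 0 fun n => n + 2
  have h : UDef transClasses fun A v => ∃ Y, Y ∈ A ∧ ∀ x, x ∈ A →
      (x ∈ Y ↔ x ∈ v 0 ∧ R A (vcons x v)) := by
    refine UDef.ex (UDef.all ((UDef.mem _ _).iff ((UDef.mem _ _).and ?_)))
    exact (hR.comp ρ).congr fun A _ w _ => by
      apply iff_of_eq
      congr 1
      funext n
      cases n <;> rfl
  obtain ⟨Y, hY, h⟩ := hM.valid h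
    (fun v => ⟨(v 0).sep fun x => R Set.univ (vcons x v), trivial, fun x _ => mem_sep⟩) w hw
  convert hY using 1
  ext x
  rw [ZFSet.mem_sep]
  exact ⟨fun hx => (h x (hM.trans _ (hw 0) _ hx.1)).2 hx, fun hx => (h x (hM.trans _ hY _ hx)).1 hx⟩

/-- Choice of witnesses. -/
lemma exists_skolem (hM : IsElemTarget M) (hR : UDef transClasses R) {w : ℕ → ZFSet.{u}}
    (hw : ∀ n, w n ∈ M) : ∃ g ∈ M, IsFunOn g (w 0) ∧ ∀ x ∈ w 0,
      (∃ y, y ∈ M ∧ R M (vcons y (vcons x w))) → R M (vcons (app g x) (vcons x w)) := by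
  -- Position 2 is skipped; it holds the function `g` being quantified.
  let ρ₁ : ℕ → ℕ := fun n => n.casesOn 0 fun n => n.casesOn 1 fun n => n + 3
  have hρ₁ : UDef transClasses fun A v =>
      R A (vcons (v 0) (vcons (v 1) fun n => v (n + 3))) :=
    (hR.comp ρ₁).congr fun A _ w _ => by
      apply iff_of_eq
      congr 1
      funext n
      rcases n with _ | _ | n <;> rfl
  have h : UDef transClasses fun A v => ∃ g, g ∈ A ∧ ((∃ r, r ∈ A ∧ IsFunc (v 0) r g) ∧
      ∀ x, x ∈ v 0 → ((∃ y, y ∈ A ∧ R A (vcons y (vcons x v))) →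
        ∃ y, y ∈ A ∧ (pair x y ∈ g ∧ R A (vcons y (vcons x v))))) :=
    UDef.ex ((UDef.ex (UDef.isFunc subset_rfl _ _ _)).and (UDef.ball _ subset_rfl
      ((UDef.ex hρ₁).imp (UDef.ex ((UDef.pairMem subset_rfl _ _ _).and hρ₁)))))
  obtain ⟨g, hg, ⟨r, -, hr⟩, h⟩ := hM.valid h (fun v => by
    classical
    obtain ⟨r, g, hg, h⟩ := exists_isFunc (v 0) fun x =>
      if h : ∃ y, R Set.univ (vcons y (vcons x v)) then h.choose else ∅
    refine ⟨g, trivial, ⟨r, trivial, hg⟩, fun x hx => ?_⟩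
    rintro ⟨y, -, hy⟩
    have h' : ∃ y, R Set.univ (vcons y (vcons x v)) := ⟨y, hy⟩
    have := h x hx
    rw [dif_pos h'] at this
    exact ⟨_, trivial, this, h'.choose_spec⟩) w hw
  refine ⟨g, hg, ⟨r, hr⟩, fun x hx hy => ?_⟩
  obtain ⟨y, -, h1, h2⟩ := h x hx hy
  rwa [app_eq hr h1]

end IsElemTarget

end InnerModels


namespace InnerModels

open FirstOrder FirstOrder.Language ZFSet
open scoped Ordinal Cardinal
open SetFormula

/-! ### Measures of an extender -/

lemma brkSep_true (κ : Ordinal.{u}) (n : ℕ) : (brkSep κ n fun _ => True) = brk κ n := by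
  ext x
  refine ⟨fun h => brkSep_subset h, fun h => ?_⟩
  obtain ⟨s, h1, h2, rfl⟩ := exists_of_mem_brk h
  exact code_mem_brkSep.2 ⟨⟨h1, h2⟩, trivial⟩

lemma brkSep_false (κ : Ordinal.{u}) (n : ℕ) : (brkSep κ n fun _ => False) = ∅ := by
  rw [ZFSet.eq_empty]
  exact fun x hx => (mem_sep.1 hx).2.choose_spec.2

lemma sep_brk {κ : Ordinal.{u}} {n : ℕ} (P : ZFSet.{u} → Prop) :
    (brk κ n).sep P = brkSep κ n fun s => P (code s) := by
  ext x
  rw [mem_sep]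
  constructor
  · rintro ⟨h, hP⟩
    obtain ⟨s, h1, h2, rfl⟩ := exists_of_mem_brk h
    exact code_mem_brkSep.2 ⟨⟨h1, h2⟩, hP⟩
  · intro h
    obtain ⟨s, h1, h2, rfl⟩ := exists_of_mem_brk (brkSep_subset h)
    exact ⟨code_mem_brk.2 ⟨h1, h2⟩, (code_mem_brkSep.1 h).2⟩

section Extender

variable {M : Set ZFSet.{u}} {E : ZFSet.{u}} {κ l : Ordinal.{u}} {a : Finset Ordinal.{u}}
  {P Q : Finset Ordinal.{u} → Prop}

namespace IsExtender

lemma mem_of_meas (hE : IsExtender M E κ l) {X : ZFSet.{u}} (h : Meas E a X) : X ∈ M := by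
  obtain ⟨b, Y, hp, -, hY, -⟩ := hE.dom _ h
  exact (pair_inj.1 hp).2 ▸ hY

lemma below_of_meas (hE : IsExtender M E κ l) {X : ZFSet.{u}} (h : Meas E a X) : Below a l := by
  obtain ⟨b, Y, hp, hb, -, -⟩ := hE.dom _ h
  exact code_injective (pair_inj.1 hp).1 ▸ hb

lemma brk_mem (hE : IsExtender M E κ l) (ha : Below a l) : brk κ a.card ∈ M :=
  hE.mem_of_meas (hE.whole a ha)

lemma meas_mono (hE : IsExtender M E κ l) (hP : Meas E a (brkSep κ a.card P))
    (hQ : brkSep κ a.card Q ∈ M)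
    (h : ∀ s, Below s κ → s.card = a.card → P s → Q s) : Meas E a (brkSep κ a.card Q) :=
  hE.upward a _ _ hP (subset_of_forall_code brkSep_subset fun s h1 h2 h3 =>
    code_mem_brkSep.2 ⟨⟨h1, h2⟩, h s h1 h2 (code_mem_brkSep.1 h3).2⟩) brkSep_subset hQ

/-- Completeness for the two-term sequence of `X` and `Y`, which lies in `M` because `M` is closed
under pairs. -/
lemma meas_inter (hE : IsExtender M E κ l) (hM : IsElemTarget M) {X Y : ZFSet.{u}}
    (hX : Meas E a X) (hY : Meas E a Y) :
    Meas E a ((brk κ a.card).sep fun x => x ∈ X ∧ x ∈ Y) := by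
  have h0 : (0 : Ordinal.{u}).toZFSet = ∅ := by simp
  have h1 : (1 : Ordinal.{u}).toZFSet = {∅} := by
    rw [← zero_add (1 : Ordinal.{u}), Ordinal.toZFSet_add_one, h0]
    ext; simp
  have h2 : (2 : Ordinal.{u}).toZFSet = {{∅}, ∅} := by
    rw [← one_add_one_eq_two, Ordinal.toZFSet_add_one, h1]
  have hlt : ∀ ξ : Ordinal.{u}, ξ < 2 ↔ ξ = 0 ∨ ξ = 1 := by
    intro ξ
    rw [← one_add_one_eq_two, Order.lt_add_one_iff, Order.le_one_iff]
  have hne : ({∅} : ZFSet.{u}) ≠ ∅ := fun h => by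
    have : (∅ : ZFSet.{u}) ∈ ({∅} : ZFSet.{u}) := by simp
    rw [h] at this
    exact notMem_empty _ this
  have hXM := hE.mem_of_meas hX
  have hYM := hE.mem_of_meas hY
  set g : ZFSet.{u} := {pair ∅ X, pair {∅} Y}
  have hg : IsFunc (2 : Ordinal.{u}).toZFSet {X, Y} g := by
    rw [h2]
    refine ⟨fun z hz => ?_, fun z hz => ?_⟩
    · rcases ZFSet.mem_pair.1 hz with rfl | rfl <;> simp
    · rcases ZFSet.mem_pair.1 hz with rfl | rfl
      · exact ⟨Y, by simp [g], by simp [g, hne]⟩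
      · exact ⟨X, by simp [g], by simp [g, hne.symm]⟩
  have hg0 : app g ∅ = X := app_eq hg (by simp [g])
  have hg1 : app g {∅} = Y := app_eq hg (by simp [g])
  have hgM : g ∈ M := hM.upair_mem (hM.pair_mem hM.empty_mem hXM)
    (hM.pair_mem (hM.singleton_mem hM.empty_mem) hYM)
  convert hE.complete a (hE.below_of_meas hX) 2
    ((Ordinal.natCast_lt_omega0 2).trans hE.omega_lt) g hgM ⟨_, hg⟩ ?_ using 4
  · simp only [hlt, forall_eq_or_imp, forall_eq, h0, h1, hg0, hg1]
  · simp only [hlt, forall_eq_or_imp, forall_eq, h0, h1, hg0, hg1]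
    exact ⟨hX, hY⟩

lemma meas_imp (hE : IsExtender M E κ l) (hM : IsElemTarget M) (ha : Below a l)
    (hP : brkSep κ a.card P ∈ M) (hQ : brkSep κ a.card Q ∈ M)
    (hPQ : brkSep κ a.card (fun s => P s → Q s) ∈ M) :
    Meas E a (brkSep κ a.card fun s => P s → Q s) ↔
      (Meas E a (brkSep κ a.card P) → Meas E a (brkSep κ a.card Q)) := by
  constructor
  · intro h1 h2
    have h3 := hE.meas_inter hM h1 h2
    rw [sep_brk] at h3
    refine hE.meas_mono h3 hQ fun s _ _ h => ?_
    exact (code_mem_brkSep.1 h.1).2 (code_mem_brkSep.1 h.2).2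
  · intro h
    rcases hE.ultra a ha _ hP brkSep_subset with h1 | h1
    · exact hE.meas_mono (h h1) hPQ fun s _ _ h _ => h
    · refine hE.upward a _ _ h1 ?_ brkSep_subset hPQ
      refine subset_of_forall_code (fun x hx => (mem_sdiff.1 hx).1) fun s h2 h3 h4 => ?_
      refine code_mem_brkSep.2 ⟨⟨h2, h3⟩, fun h5 => ?_⟩
      exact ((mem_sdiff.1 h4).2 (code_mem_brkSep.2 ⟨⟨h2, h3⟩, h5⟩)).elim

lemma not_meas_false (hE : IsExtender M E κ l) :
    ¬ Meas E a (brkSep κ a.card fun _ => False) := by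
  rw [brkSep_false]
  exact hE.notEmpty a

/-- The measures decide only sets in `M`; this one is in `M` by separation, with the function values
substituted into `φ` as terms. -/
lemma brkSep_sat_mem (hE : IsExtender M E κ l) (hM : IsElemTarget M) (ha : Below a l)
    (φ : SetFormula) {F : ℕ → ZFSet.{u}} (hF : ∀ k, F k ∈ M) :
    (brkSep κ a.card fun s => Sat M φ fun k => app (F k) (code s)) ∈ M := by
  have := hM.sep_mem (UDef.satAppVal φ 0 fun k => .inr (k + 2))
    (vcons_mem (hE.brk_mem ha) hF)
  rw [vcons_zero, sep_brk] at this
  exact this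

/-- A function can be represented at any larger index. -/
lemma exists_lift (hE : IsExtender M E κ l) (hM : IsElemTarget M) {c : Finset Ordinal.{u}}
    (hac : a ⊆ c) (hc : Below c l) {f : ZFSet.{u}} (hf : f ∈ M)
    (hfun : IsFunOn f (brk κ a.card)) :
    ∃ g ∈ M, IsFunOn g (brk κ c.card) ∧ ∀ s, Below s κ → s.card = c.card →
      app g (code s) = app f (code (proj a c s)) := by
  -- Composition with the projection is obtained in `M` as a Skolem function for a definable
  -- relation.
  have hR : UDef transClasses.{u} fun A v => ∃ w, w ∈ A ∧
      (IsRankPart (a.image (rankIn c)) (v 1) w ∧ pair w (v 0) ∈ v 3) :=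
    UDef.ex ((UDef.isRankPart subset_rfl _ _ _).and (UDef.pairMem subset_rfl _ _ _))
  obtain ⟨g, hg, hgfun, h⟩ := hM.exists_skolem hR
    (vcons_mem (hE.brk_mem hc) fun _ => hf)
  refine ⟨g, hg, hgfun, fun s h1 h2 => ?_⟩
  have hs : code (proj a c s) ∈ brk κ a.card := code_proj_mem_brk hac h1 h2
  have hp := pair_app_mem hfun hs
  have hpM := hM.trans.of_pair_mem (hM.trans _ hf _ hp)
  obtain ⟨w, -, h3, h4⟩ := h (code s) (code_mem_brk.2 ⟨h1, h2⟩)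
    ⟨_, hpM.2, _, hpM.1, isRankPart_code.2 rfl, hp⟩
  obtain rfl := isRankPart_code.1 h3
  exact (app_eq hfun.choose_spec h4).symm

end IsExtender

/-! ### Łoś's theorem for extender ultrapowers -/

/-- The collapse `(a, f) ↦ [a, f]` of the ultrapower of `M` by `E` onto `N`. -/
structure IsCollapse (M : Set ZFSet.{u}) (E : ZFSet.{u}) (κ l : Ordinal.{u}) (N : Set ZFSet.{u})
    (cls : Finset Ordinal.{u} → ZFSet.{u} → ZFSet.{u}) : Prop where
  mem_iff : ∀ y, y ∈ N ↔ ∃ a f, Below a l ∧ f ∈ M ∧ IsFunOn f (brk κ a.card) ∧ cls a f = y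
  rel : ∀ a f b g, Below a l → f ∈ M → IsFunOn f (brk κ a.card) →
      Below b l → g ∈ M → IsFunOn g (brk κ b.card) →
      (cls a f ∈ cls b g ↔ Meas E (a ∪ b) (brkSep κ (a ∪ b).card fun s =>
        app f (code (proj a (a ∪ b) s)) ∈ app g (code (proj b (a ∪ b) s)))) ∧
      (cls a f = cls b g ↔ Meas E (a ∪ b) (brkSep κ (a ∪ b).card fun s =>
        app f (code (proj a (a ∪ b) s)) = app g (code (proj b (a ∪ b) s))))

namespace IsCollapse

variable {N : Set ZFSet.{u}} {cls : Finset Ordinal.{u} → ZFSet.{u} → ZFSet.{u}}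

lemma cls_eq (hU : IsCollapse M E κ l N cls) (hE : IsExtender M E κ l) {c : Finset Ordinal.{u}}
    (hac : a ⊆ c) (hc : Below c l) {f g : ZFSet.{u}} (hf : f ∈ M)
    (hfun : IsFunOn f (brk κ a.card)) (hg : g ∈ M) (hgfun : IsFunOn g (brk κ c.card))
    (h : ∀ s, Below s κ → s.card = c.card → app g (code s) = app f (code (proj a c s))) :
    cls a f = cls c g := by
  rw [(hU.rel a f c g (fun ξ hξ => hc ξ (hac hξ)) hf hfun hc hg hgfun).2,
    Finset.union_eq_right.2 hac]
  have : (brkSep κ c.card fun s => app f (code (proj a c s)) = app g (code (proj c c s))) =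
      brk κ c.card := by
    rw [← brkSep_true]
    refine brkSep_congr fun s h1 h2 => iff_of_true ?_ trivial
    rw [proj_self h2, h s h1 h2]
  rw [this]
  exact hE.whole c hc

/-- The quantifier step needs Skolem functions and separated sets inside `M`; they exist since `M`
is the target of an elementary embedding of the universe. -/
theorem sat_cls (hU : IsCollapse M E κ l N cls) (hE : IsExtender M E κ l) (hM : IsElemTarget M)
    (φ : SetFormula) (ha : Below a l) {F : ℕ → ZFSet.{u}} (hF : ∀ k, F k ∈ M)
    (hfun : ∀ k, IsFunOn (F k) (brk κ a.card)) :
    Sat N φ (fun k => cls a (F k)) ↔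
      Meas E a (brkSep κ a.card fun s => Sat M φ fun k => app (F k) (code s)) := by
  induction φ generalizing a F with
  | mem i j =>
    have h := (hU.rel a (F i) a (F j) ha (hF i) (hfun i) ha (hF j) (hfun j)).1
    rw [Finset.union_self] at h
    refine h.trans (iff_of_eq (congrArg _ (brkSep_congr fun s _ h2 => ?_)))
    rw [proj_self h2]
    rfl
  | eq i j =>
    have h := (hU.rel a (F i) a (F j) ha (hF i) (hfun i) ha (hF j) (hfun j)).2
    rw [Finset.union_self] at h
    refine h.trans (iff_of_eq (congrArg _ (brkSep_congr fun s _ h2 => ?_)))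
    rw [proj_self h2]
    rfl
  | fls => exact iff_of_false id hE.not_meas_false
  | imp φ ψ h1 h2 =>
    exact (imp_congr (h1 ha hF hfun) (h2 ha hF hfun)).trans
      (hE.meas_imp hM ha (hE.brkSep_sat_mem hM ha φ hF) (hE.brkSep_sat_mem hM ha ψ hF)
        (hE.brkSep_sat_mem hM ha (φ.imp ψ) hF)).symm
  | all φ ih =>
    constructor
    · intro h
      -- Counterexamples to `φ`: variable 0 is the value, variable 1 the argument, and `F k` sits at
      -- position `k + 3`.
      have hR := UDef.satAppVal.{u} (φ.imp .fls) 1 fun k => k.casesOn (.inl 0) fun k => .inr (k + 3)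
      obtain ⟨g, hg, hgfun, hsk⟩ := hM.exists_skolem hR (vcons_mem (hE.brk_mem ha) hF)
      have hsk' : ∀ x ∈ brk κ a.card, (∃ y, y ∈ M ∧ ¬ Sat M φ (vcons y fun k => app (F k) x)) →
          ¬ Sat M φ (vcons (app g x) fun k => app (F k) x) := by
        have key : ∀ y x : ZFSet.{u}, (fun k : ℕ => appVal 1
            (k.casesOn (.inl 0) fun k => .inr (k + 3) : ℕ ⊕ ℕ)
            (vcons y (vcons x (vcons (brk κ a.card) F)))) = vcons y fun k => app (F k) x := by
          intro y x
          funext k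
          cases k <;> rfl
        simp only [key] at hsk
        exact hsk
      have h1 := h (cls a g) ((hU.mem_iff _).2 ⟨a, g, ha, hg, hgfun, rfl⟩)
      rw [← comp_vcons (cls a), ih ha (vcons_mem hg hF)
        (fun k => by cases k; exacts [hgfun, hfun _])] at h1
      refine hE.meas_mono h1 (hE.brkSep_sat_mem hM ha _ hF) fun s h2 h3 h4 y hy => ?_
      by_contra h5
      refine hsk' _ (code_mem_brk.2 ⟨h2, h3⟩) ⟨y, hy, h5⟩ ?_
      rwa [comp_vcons fun f => app f (code s)] at h4
    · intro h y hy
      classical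
      obtain ⟨b, g, hb, hg, hgfun, rfl⟩ := (hU.mem_iff y).1 hy
      -- The parameters and the new element are lifted to the joint index `a ∪ b`.
      have hc : Below (a ∪ b) l := fun ξ hξ => (Finset.mem_union.1 hξ).elim (ha ξ) (hb ξ)
      choose F' hF' hfun' hF'eq using fun k =>
        hE.exists_lift hM Finset.subset_union_left hc (hF k) (hfun k)
      obtain ⟨g', hg', hgfun', hg'eq⟩ := hE.exists_lift hM Finset.subset_union_right hc hg hgfun
      have e1 : cls b g = cls (a ∪ b) g' :=
        hU.cls_eq hE Finset.subset_union_right hc hg hgfun hg' hgfun' hg'eq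
      have e2 : (fun k => cls a (F k)) = fun k => cls (a ∪ b) (F' k) := funext fun k =>
        hU.cls_eq hE Finset.subset_union_left hc (hF k) (hfun k) (hF' k) (hfun' k) (hF'eq k)
      have hFg := vcons_mem hg' hF'
      rw [e1, e2, ← comp_vcons (cls (a ∪ b)), ih hc hFg
        (fun k => by cases k; exacts [hgfun', hfun' _])]
      rw [hE.coherent a (a ∪ b) Finset.subset_union_left hc _
        (hE.brkSep_sat_mem hM ha φ.all hF) brkSep_subset] at h
      refine hE.meas_mono h (hE.brkSep_sat_mem hM hc _ hFg) fun s h1 h2 h3 => ?_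
      rw [comp_vcons fun f => app f (code s)]
      simp only [hF'eq _ s h1 h2]
      exact (code_mem_brkSep.1 h3).2 _
        (app_mem_class hM.trans hg' hgfun' (code_mem_brk.2 ⟨h1, h2⟩))

end IsCollapse

/-- Images under `j` are classes of constant functions at the index `∅`. As `[κ]^0 = {∅}`, the set
measured in Łoś's theorem is everything or empty. -/
theorem IsUltrapower.elemMap {N : Set ZFSet.{u}} {j : ZFSet.{u} → ZFSet.{u}}
    (h : IsUltrapower M E κ l N j) (hE : IsExtender M E κ l) (hM : IsElemTarget M) :
    ElemMap M N j := by
  obtain ⟨-, cls, h1, h2, h3⟩ := h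
  have hU : IsCollapse M E κ l N cls := ⟨h1, h2⟩
  have h0 : Below (∅ : Finset Ordinal.{u}) l := fun ξ hξ => by simp at hξ
  have hcode : ∀ x, x ∈ brk κ (∅ : Finset Ordinal.{u}).card ↔ x = ∅ := by
    intro x
    constructor
    · intro hx
      obtain ⟨s, -, hs, rfl⟩ := exists_of_mem_brk hx
      rw [Finset.card_eq_zero.1 (hs.trans Finset.card_empty), code_empty]
    · rintro rfl
      rw [← code_empty]
      exact code_mem_brk.2 ⟨fun ξ hξ => by simp at hξ, rfl⟩
  have hfun : ∀ x, IsFunc (brk κ (∅ : Finset Ordinal.{u}).card) {x} {pair ∅ x} := by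
    intro x
    refine ⟨fun z hz => ?_, fun z hz => ?_⟩
    · rw [mem_singleton.1 hz]
      exact pair_mem_prod.2 ⟨(hcode _).2 rfl, by simp⟩
    · obtain rfl := (hcode z).1 hz
      exact ⟨x, by simp, by simp⟩
  have happ : ∀ x, app {pair ∅ x} ∅ = x := fun x => app_eq (hfun x) (by simp)
  have hmem : ∀ x ∈ M, ({pair ∅ x} : ZFSet.{u}) ∈ M := fun x hx =>
    hM.singleton_mem (hM.pair_mem hM.empty_mem hx)
  refine ⟨fun x hx => ?_, fun φ v hv => ?_⟩
  · rw [h3 x hx]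
    exact (h1 _).2 ⟨∅, _, h0, hmem x hx, ⟨_, hfun x⟩, rfl⟩
  · have e : (fun n => j (v n)) = fun n => cls ∅ {pair ∅ (v n)} := funext fun n => h3 _ (hv n)
    rw [e, hU.sat_cls hE hM φ h0 (F := fun n => {pair ∅ (v n)}) (fun n => hmem _ (hv n))
      fun n => ⟨_, hfun _⟩]
    have e' : (brkSep κ (∅ : Finset Ordinal.{u}).card fun s =>
        Sat M φ fun k => app {pair ∅ (v k)} (code s)) =
        brkSep κ (∅ : Finset Ordinal.{u}).card fun _ => Sat M φ v := by
      refine brkSep_congr fun s _ h => ?_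
      rw [Finset.card_eq_zero.1 (h.trans Finset.card_empty), code_empty]
      simp only [happ]
    rw [e']
    by_cases hs : Sat M φ v
    · simp only [hs, iff_true, brkSep_true]
      exact hE.whole ∅ h0
    · simp only [hs, iff_false]
      exact hE.not_meas_false

end Extender

end InnerModels


namespace InnerModels

open FirstOrder FirstOrder.Language ZFSet
open scoped Ordinal Cardinal
open SetFormula

/-! ### Iterated ultrapowers are elementary -/

lemma ElemMap.congr {A B : Set ZFSet.{u}} {f g : ZFSet.{u} → ZFSet.{u}} (hf : ElemMap A B f)
    (h : ∀ x ∈ A, f x = g x) : ElemMap A B g where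
  mapsTo x hx := h x hx ▸ hf.mapsTo x hx
  sat_iff φ v hv := by
    rw [← hf.sat_iff φ v hv]
    simp only [h _ (hv _)]

lemma ElemMap.refl (A : Set ZFSet.{u}) : ElemMap A A fun x => x :=
  ⟨fun _ hx => hx, fun _ _ _ => Iff.rfl⟩

lemma eq_zero_or_succ_or_isSuccLimit (ν : WithTop Ordinal.{u}) :
    ν = 0 ∨ (∃ ρ : Ordinal.{u}, ν = ((ρ + 1 : Ordinal.{u}) : WithTop Ordinal.{u})) ∨
      Order.IsSuccLimit ν := by
  by_cases h0 : ν = 0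
  · exact Or.inl h0
  refine Or.inr ?_
  by_cases h : Order.IsSuccPrelimit ν
  · refine Or.inr ⟨fun hmin => h0 ?_, h⟩
    exact le_antisymm (hmin (by simp)) (by simp)
  · left
    obtain ⟨ρ, hρ⟩ := Order.not_isSuccPrelimit_iff.1 h
    lift ρ to Ordinal.{u} using hρ.lt.ne_top
    refine ⟨ρ, ?_⟩
    have h1 : (ρ : WithTop Ordinal.{u}) < ((ρ + 1 : Ordinal.{u}) : WithTop Ordinal.{u}) :=
      WithTop.coe_lt_coe.2 (Order.lt_add_one_iff.2 le_rfl)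
    have h2 : ((ρ + 1 : Ordinal.{u}) : WithTop Ordinal.{u}) ≤ ν := by
      induction ν with
      | top => exact le_top
      | coe n => exact WithTop.coe_le_coe.2 (Order.add_one_le_of_lt (WithTop.coe_lt_coe.1 hρ.lt))
    exact (h2.lt_or_eq.resolve_left (hρ.2 h1)).symm

namespace IsIteration

variable {θ : WithTop Ordinal.{u}} {M : WithTop Ordinal.{u} → Set ZFSet.{u}}
  {i : WithTop Ordinal.{u} → WithTop Ordinal.{u} → ZFSet.{u} → ZFSet.{u}}
  {E : Ordinal.{u} → ZFSet.{u}} {κ l : Ordinal.{u} → Ordinal.{u}}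

lemma eq_iff (h : IsIteration θ M i E κ l) {μ ν : WithTop Ordinal.{u}} (hμ : μ ≤ ν) (hν : ν ≤ θ)
    {x y : ZFSet.{u}} (hx : x ∈ M μ) (hy : y ∈ M μ) : i μ ν x = i μ ν y ↔ x = y := by
  refine ⟨fun e => ?_, fun e => e ▸ rfl⟩
  have key : ∀ {x y}, x ∈ M μ → y ∈ M μ → i μ ν x = i μ ν y → x ⊆ y := by
    intro x y hx hy e z hz
    have hzM := h.trans μ (hμ.trans hν) x hx z hz
    rw [← h.mem_iff μ ν hμ hν z hzM y hy, ← e]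
    exact (h.mem_iff μ ν hμ hν z hzM x hx).2 hz
  ext z
  exact ⟨fun hz => key hx hy e hz, fun hz => key hy hx e.symm hz⟩

/-- The direct limit of elementary embeddings is elementary. -/
lemma sat_limit (h : IsIteration θ M i E κ l) {ν : WithTop Ordinal.{u}} (hν : ν ≤ θ)
    (hlim : Order.IsSuccLimit ν)
    (ih : ∀ σ < ν, ∀ μ ≤ σ, ElemMap (M μ) (M σ) (i μ σ)) (φ : SetFormula)
    {μ : WithTop Ordinal.{u}} (hμ : μ < ν) (v : ℕ → ZFSet.{u}) (hv : ∀ n, v n ∈ M μ) :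
    Sat (M ν) φ (fun n => i μ ν (v n)) ↔ Sat (M μ) φ v := by
  induction φ generalizing μ v with
  | mem a b => exact h.mem_iff μ ν hμ.le hν _ (hv a) _ (hv b)
  | eq a b => exact h.eq_iff hμ.le hν (hv a) (hv b)
  | fls => exact Iff.rfl
  | imp φ ψ h1 h2 => exact imp_congr (h1 hμ v hv) (h2 hμ v hv)
  | all φ hφ =>
    constructor
    · intro H x hx
      rw [← hφ hμ _ (vcons_mem hx hv), comp_vcons]
      exact H _ (h.mapsTo μ ν hμ.le hν x hx)
    · intro H y hy
      obtain ⟨ρ, hρ, x, hx, rfl⟩ := h.limit ν hν hlim y hy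
      -- The new element and the parameters meet in the model at `max μ ρ`, where the induction
      -- hypothesis applies.
      have hσ : max μ ρ < ν := max_lt hμ hρ
      have hx' := h.mapsTo ρ _ (le_max_right μ ρ) (hσ.le.trans hν) x hx
      have hv' := fun n => h.mapsTo μ _ (le_max_left μ ρ) (hσ.le.trans hν) _ (hv n)
      have H' := ((ih _ hσ μ (le_max_left μ ρ)).sat_iff φ.all v hv).2 H _ hx'
      rw [← hφ hσ _ (vcons_mem hx' hv'), comp_vcons] at H'
      rw [h.comp ρ _ ν (le_max_right μ ρ) hσ.le hν x hx] at H'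
      simpa only [h.comp μ _ ν (le_max_left μ ρ) hσ.le hν _ (hv _)] using H'

/-- At a successor, Łoś's theorem requires an elementary embedding of the universe into `M ρ`; the
induction supplies the map from stage `0`. -/
theorem elemMap (h : IsIteration θ M i E κ l) {ν : WithTop Ordinal.{u}} (hν : ν ≤ θ)
    {μ : WithTop Ordinal.{u}} (hμ : μ ≤ ν) : ElemMap (M μ) (M ν) (i μ ν) := by
  induction ν using WellFoundedLT.induction generalizing μ with
  | _ ν ih =>
    rcases hμ.eq_or_lt with rfl | hμ
    · exact (ElemMap.refl _).congr fun x hx => (h.id μ hν x hx).symm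
    rcases eq_zero_or_succ_or_isSuccLimit ν with rfl | ⟨ρ, rfl⟩ | hlim
    · exact (not_lt_of_ge (by simp) hμ).elim
    · have hlt : (ρ : WithTop Ordinal.{u}) < ((ρ + 1 : Ordinal.{u}) : WithTop Ordinal.{u}) :=
        WithTop.coe_lt_coe.2 (Order.lt_add_one_iff.2 le_rfl)
      have hρ : (ρ : WithTop Ordinal.{u}) ≤ θ := hlt.le.trans hν
      have hμρ : μ ≤ (ρ : WithTop Ordinal.{u}) := by
        lift μ to Ordinal.{u} using hμ.ne_top
        exact WithTop.coe_le_coe.2 (Order.lt_add_one_iff.1 (WithTop.coe_lt_coe.1 hμ))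
      have h0 := ih ρ hlt hρ (μ := 0) (by simp)
      rw [h.zero] at h0
      obtain ⟨-, hE, hU⟩ := h.succ ρ (hlt.trans_le hν)
      exact ((hU.elemMap hE ⟨h.trans ρ hρ, _, h0⟩).comp (ih ρ hlt hρ hμρ)).congr fun x hx =>
        h.comp μ ρ _ hμρ hlt.le hν x hx
    · exact ⟨h.mapsTo μ ν hμ.le hν, fun φ v hv => h.sat_limit hν hlim
        (fun σ hσ μ hμ => ih σ hσ (hσ.le.trans hν) hμ) φ hμ v hv⟩

end IsIteration

theorem IsIteratedUltrapower.elemMap {M : Set ZFSet.{u}} {i : ZFSet.{u} → ZFSet.{u}}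
    (h : IsIteratedUltrapower M i) : IsTransClass M ∧ ElemMap Set.univ M i := by
  obtain ⟨θ, Ms, is, E, κ, l, hI, rfl, rfl⟩ := h
  have := hI.elemMap le_rfl (μ := 0) (by simp)
  rw [hI.zero] at this
  exact ⟨hI.trans θ le_rfl, this⟩

/-! ### Strong cardinals and definable submodels of the Chang model -/

/-- Relativization of a formula to a definable subclass. -/
lemma UDef.satRelative {C M : Set ZFSet.{u}} (hMC : M ⊆ C)
    (hM : UDef {C} fun _ v => v 0 ∈ M) (φ : SetFormula) : UDef {C} fun _ v => Sat M φ v := by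
  induction φ with
  | mem i j => exact UDef.mem i j
  | eq i j => exact UDef.eq i j
  | fls => exact UDef.fls
  | imp φ ψ h1 h2 => exact h1.imp h2
  | all φ ih =>
    have : UDef {C} fun A v => ∀ x, x ∈ A → (x ∈ M → Sat M φ (vcons x v)) :=
      UDef.all (hM.imp (ih.congr fun A _ v _ => iff_of_eq (congrArg _ (by
        funext n; cases n <;> rfl))))
    refine this.congr fun A hA v _ => ?_
    obtain rfl : A = C := hA
    exact ⟨fun H x hx => H x (hMC hx) hx, fun H x _ hx => H x hx⟩

/-- Strength quantifies over class embeddings, whereas `HasUltraSystems` is first-order over sets;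
its least instance is therefore definable without parameters. -/
lemma exists_definable_hasUltraSystems (h : ∃ κ : Ordinal.{u}, HasUltraSystems κ.toZFSet) :
    ∃ κ : Ordinal.{u}, HasUltraSystems κ.toZFSet ∧ ∃ χ : SetFormula, ∀ x : ZFSet.{u},
      Sat Set.univ χ (fun _ => x) ↔ x = κ.toZFSet := by
  obtain ⟨κ, hκ, hmin⟩ := WellFounded.has_min (wellFounded_lt (α := Ordinal.{u}))
    {κ | HasUltraSystems κ.toZFSet} h
  have hR : UDef {Set.univ} fun _ v => HasUltraSystems (v 0) ∧
      ∀ y, y ∈ v 0 → ¬ HasUltraSystems.{u} y :=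
    (UDef.hasUltraSystems 0).and
      (UDef.ball _ singleton_univ_subset (UDef.hasUltraSystems 0).not)
  obtain ⟨χ, hχ⟩ := hR
  refine ⟨κ, hκ, χ, fun x => (hχ _ rfl _ fun _ => trivial).trans ⟨?_, ?_⟩⟩
  · rintro ⟨h1, h2⟩
    have hx : x.rank.toZFSet = x := h1.1.toZFSet_rank_eq
    change HasUltraSystems x at h1
    change ∀ y, y ∈ x → ¬ HasUltraSystems y at h2
    rw [← hx] at h1 h2 ⊢
    refine congrArg _ (le_antisymm ?_ (not_lt.1 (hmin _ h1)))
    exact not_lt.1 fun h3 => h2 _ (Ordinal.toZFSet_mem_toZFSet_iff.2 h3) hκ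
  · rintro rfl
    refine ⟨hκ, fun y hy => ?_⟩
    obtain ⟨a, ha, rfl⟩ := Ordinal.mem_toZFSet_iff.1 hy
    exact fun h => hmin a h ha

/-- By elementarity `i κ` is the unique element of `M` satisfying the definition of `κ`, and
definability of `M` turns this into a definition over the Chang model. Then `i κ < κ`, against the
strict monotonicity of `i` on ordinals. -/
theorem not_isStrong_of_elemMap {M : Set ZFSet.{u}} {i : ZFSet.{u} → ZFSet.{u}}
    (hM : IsTransClass M) (hi : ElemMap Set.univ M i) (hdef : IsDefinableSubmodel M) :
    ¬ ∃ κ : Ordinal.{u}, IsStrong κ := by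
  rintro ⟨κ₀, hκ₀⟩
  obtain ⟨κ, hκ, χ, hχ⟩ := exists_definable_hasUltraSystems ⟨κ₀, hκ₀.hasUltraSystems⟩
  have hR : UDef transClasses.{u} fun A v => ∀ y, y ∈ A → (Sat A χ (fun _ => y) ↔ y = v 0) :=
    UDef.all ((UDef.sat χ fun _ => 0).iff (UDef.eq 0 1))
  have hχM := (hi.iff_univ hM hR fun _ => κ.toZFSet).2 fun y _ => hχ y
  have hord : (i κ.toZFSet).IsOrdinal :=
    (hi.iff_univ hM (UDef.isOrdinal subset_rfl 0) fun _ => κ.toZFSet).2 (isOrdinal_toZFSet κ)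
  have hmono : StrictMono fun α : Ordinal.{u} => (i α.toZFSet).rank := fun α β h =>
    rank_lt_of_mem (hi.map_mem.2 (Ordinal.toZFSet_mem_toZFSet_iff.2 h))
  have hiM := hi.mapsTo κ.toZFSet trivial
  obtain ⟨hMC, hdef⟩ := hdef
  obtain ⟨ψ, hψ⟩ : UDef {omegaOneChang.{u}} fun _ v => v 0 ∈ M ∧ Sat M χ fun _ => v 0 := by
    obtain ⟨τ, hτ⟩ := exists_sat_iff_mem hdef
    have hMdef : UDef {omegaOneChang.{u}} fun _ v => v 0 ∈ M :=
      ⟨τ, fun A hA v hv => by obtain rfl : A = _ := hA; exact hτ v hv⟩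
    exact hMdef.and ((UDef.satRelative hMC hMdef χ).comp fun _ => 0)
  refine absurd (hκ.lt_of_definable (μ := (i κ.toZFSet).rank) ?_ ψ fun x hx => ?_)
    (not_lt_of_ge hmono.le_apply)
  · rw [hord.toZFSet_rank_eq]
    exact hMC hiM
  · rw [hord.toZFSet_rank_eq, hψ _ rfl _ fun _ => hx]
    exact ⟨fun h => (hχM x h.1).1 h.2, fun h => ⟨h ▸ hiM, (hχM x (h ▸ hiM)).2 h⟩⟩

end InnerModels

theorem mainTheorem10 (𝓔 : Ordinal.{u} → ZFSet.{u})
    (h𝓔 : InnerModels.IsExtenderSequence 𝓔)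
    (hV : InnerModels.relConstructible 𝓔 = (Set.univ : Set ZFSet.{u}))
    (M : Set ZFSet.{u}) (i : ZFSet.{u} → ZFSet.{u})
    (hi : InnerModels.IsIteratedUltrapower M i)
    (hM : InnerModels.IsDefinableSubmodel M) :
    ¬ ∃ κ : Ordinal.{u}, InnerModels.IsStrong κ :=
  InnerModels.not_isStrong_of_elemMap hi.elemMap.1 hi.elemMap.2 hM
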